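/- An instance of scheduling with a fixed communication delay consists of a directed acyclic graph on $n$ jobs, job sizes $p_v>0$, $m$ machines with speeds $s_i>0$, and a delay $\rho\ge 0$; job $v$ takes time $p_v/s_i$ on machine $i$. A schedule $\sigma$ assigns to each pair $(v,i)$ a start time $\sigma(v,i)\in[0,\infty]$ ($\infty$ meaning that $v$ is not run on $i$) such that every job has a finite start time on at least one machine, each machine runs at most one job at a time without preemption, and whenever $v$ starts on $i$ at time $t$, each predecessor $u$ of $v$ (i.e. there is a directed path of nonzero length from $u$ to $v$) has a copy that completes on $i$ by time $t$ or on another machine by time $t-\rho$. The makespan is the largest completion time of any copy of any job. A no-duplication schedule is a schedule in which every job is processed exactly once. **Lower bound.** There is a constant $c>0$ such that for every integer $\rho\ge 2$ there is an instance with delay $\rho$, unit job sizes, unit machine speeds, $n/2=m=2^{\rho}$, and a precedence graph that is a binary out-tree (a rooted tree with edges directed away from the root and at most two children per job), for which every no-duplication schedule has makespan at least $c\cdot\frac{\rho}{\log_2\rho}$ times the optimal makespan over all schedules (with duplication allowed). **Upper bound.** There is a constant $K>0$ such that for every instance with $n\ge2$ jobs, $m\ge2$ machines and delay $\rho$, and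 every schedule with makespan $M^*\ge\rho$, there is a no-duplication schedule of the same instance with makespan at most $K\cdot M^*\log_2^2 n\,\log_2 m$. Moreover, with the same constant $K$, such a no-duplication schedule can be computed by a single polynomial-time algorithm: given any such instance and schedule with rational data (sizes, speeds, delay and finite start times coded as fractions in binary), it runs in time polynomial in the length of the input and outputs such a no-duplication schedule. -/

import Mathlib

/-! ## Scheduling with precedence constraints, related machines and a communication delay -/

namespace Sched

/-- An instance with jobs `Fin n`, machines `Fin m` and numerical data in `𝕜` (the reals, or the
rationals when the instance is the input of an algorithm): a directed acyclic graph on the jobs,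
positive job sizes, positive machine speeds and a nonnegative communication delay. -/
structure Instance (𝕜 : Type) [Field 𝕜] [LinearOrder 𝕜] (n m : ℕ) where
  edge : Fin n → Fin n → Prop
  acyclic : ∀ v, ¬ Relation.TransGen edge v v
  size : Fin n → 𝕜
  size_pos : ∀ v, 0 < size v
  speed : Fin m → 𝕜
  speed_pos : ∀ i, 0 < speed i
  delay : 𝕜
  delay_nonneg : 0 ≤ delay

/-- `σ v i = some t`: a copy of job `v` starts on machine `i` at time `t`;
`σ v i = none` (start time `∞`): job `v` is not scheduled on machine `i`. -/
abbrev Assignment (𝕜 : Type) (n m : ℕ) : Type := Fin n → Fin m → Option 𝕜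

namespace Instance

variable {𝕜 : Type} [Field 𝕜] [LinearOrder 𝕜] {n m : ℕ}

/-- `u` is a predecessor of `v`: there is a directed path of nonzero length from `u` to `v`. -/
def Pred (I : Instance 𝕜 n m) (u v : Fin n) : Prop := Relation.TransGen I.edge u v

/-- Time needed to run job `v` on machine `i`. -/
def runTime (I : Instance 𝕜 n m) (v : Fin n) (i : Fin m) : 𝕜 := I.size v / I.speed i

/-- Schedules of the instance; duplication of jobs on several machines is allowed. -/
structure IsSchedule (I : Instance 𝕜 n m) (σ : Assignment 𝕜 n m) : Prop where
  /-- Every job is processed somewhere. -/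
  scheduled : ∀ v, ∃ i t, σ v i = some t
  /-- Time starts at `0`. -/
  start_nonneg : ∀ v i t, σ v i = some t → 0 ≤ t
  /-- A machine runs at most one job at any time, without preemption. -/
  exclusive : ∀ i u v s t, u ≠ v → σ u i = some s → σ v i = some t →
    s + I.runTime u i ≤ t ∨ t + I.runTime v i ≤ s
  /-- If `v` starts on `i` at time `t`, each predecessor of `v` has a copy that completes on `i`
  by time `t`, or on another machine by time `t - delay`. -/
  precedence : ∀ u v i t, I.Pred u v → σ v i = some t →
    (∃ s, σ u i = some s ∧ s + I.runTime u i ≤ t) ∨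
    (∃ j s, j ≠ i ∧ σ u j = some s ∧ s + I.runTime u j ≤ t - I.delay)

/-- A schedule in which every job is processed exactly once. -/
def IsNoDupSchedule (I : Instance 𝕜 n m) (σ : Assignment 𝕜 n m) : Prop :=
  I.IsSchedule σ ∧ ∀ v, ∃! i, σ v i ≠ none

/-- `M` is the makespan of `σ`: the largest completion time of any copy of any job. -/
def IsMakespan (I : Instance 𝕜 n m) (σ : Assignment 𝕜 n m) (M : 𝕜) : Prop :=
  IsGreatest {c | ∃ v i t, σ v i = some t ∧ c = t + I.runTime v i} M

/-- `M` is the optimal makespan over all schedules, with duplication allowed. -/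
def IsOptimalMakespan (I : Instance 𝕜 n m) (M : 𝕜) : Prop :=
  IsLeast {C | ∃ σ, I.IsSchedule σ ∧ I.IsMakespan σ C} M

/-- The precedence graph is a rooted tree with edges directed away from the root, in which every
job has at most two children. -/
def IsBinaryOutTree (I : Instance 𝕜 n m) : Prop :=
  (∃ r, ∀ v, v ≠ r → I.Pred r v) ∧
  (∀ u u' v, I.edge u v → I.edge u' v → u = u') ∧
  (∀ u, {v | I.edge u v}.ncard ≤ 2)

end Instance

/-! ## A model of computation with a step count

Programs act on binary trees (pairs and a single atom). Every primitive step is charged the size of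
the tree that it handles, so that no value in a run is larger than the charged time, and the time
is within a polynomial of that of a Turing machine. -/

/-- Binary trees. A list is coded as `cons x₁ (cons x₂ (… nil))`. -/
inductive Data : Type
  | nil : Data
  | cons : Data → Data → Data

namespace Data

def size : Data → ℕ
  | nil => 1
  | cons a b => a.size + b.size + 1

def fst : Data → Data
  | nil => nil
  | cons a _ => a

def snd : Data → Data
  | nil => nil
  | cons _ b => b

/-- The list coded by a tree. -/
def toList : Data → List Data
  | nil => []
  | cons a b => a :: b.toList

open Classical in
/-- The natural number with a given list of binary digits, least significant digit first;
the atom is the digit `0`, every other tree is the digit `1`. -/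
noncomputable def toNat : Data → ℕ
  | nil => 0
  | cons a b => (if a = nil then 0 else 1) + 2 * b.toNat

/-- `x` codes the truth value of `p`. -/
def CodesProp (x : Data) (p : Prop) : Prop := x ≠ nil ↔ p

/-- `x` codes the rational `q` as a fraction with sign, numerator and denominator in binary,
not necessarily in lowest terms. -/
def CodesRat (x : Data) (q : ℚ) : Prop :=
  ∃ s a b, x = cons (cons s a) b ∧ b.toNat ≠ 0 ∧
    ((s = nil ∧ q = (a.toNat : ℚ) / (b.toNat : ℚ)) ∨
      (s ≠ nil ∧ q = -((a.toNat : ℚ) / (b.toNat : ℚ))))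

/-- `x` codes a start time in `ℚ ∪ {∞}`; a code of a rational is never the atom. -/
def CodesTime (x : Data) : Option ℚ → Prop
  | none => x = nil
  | some q => x.CodesRat q

/-- `x` is the list of codes, in the sense of `R`, of the values `f 0, …, f (k - 1)`. -/
def CodesFun {α : Type} (R : Data → α → Prop) {k : ℕ} (x : Data) (f : Fin k → α) : Prop :=
  List.Forall₂ R x.toList (List.ofFn f)

/-- `x` codes an assignment of start times, as a matrix. -/
def CodesAssignment {n m : ℕ} (x : Data) (σ : Assignment ℚ n m) : Prop :=
  CodesFun (CodesFun CodesTime) x σ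

/-- `x` codes an instance: adjacency matrix, job sizes, machine speeds, delay. -/
def CodesInstance {n m : ℕ} (x : Data) (I : Instance ℚ n m) : Prop :=
  ∃ e p s d, x = cons e (cons p (cons s d)) ∧ CodesFun (CodesFun CodesProp) e I.edge ∧
    CodesFun CodesRat p I.size ∧ CodesFun CodesRat s I.speed ∧ d.CodesRat I.delay

/-- `x` codes an instance together with an assignment of start times. -/
def CodesInput {n m : ℕ} (x : Data) (I : Instance ℚ n m) (σ : Assignment ℚ n m) : Prop :=
  ∃ a b, x = cons a b ∧ a.CodesInstance I ∧ b.CodesAssignment σ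

end Data

/-- Programs: identity, the atom, the two projections, pairing, composition (`comp g f` runs `f`
first), a conditional, and the loop "while `c` gives a nonatomic value, apply `f`". -/
inductive Prog : Type
  | id : Prog
  | nil : Prog
  | fst : Prog
  | snd : Prog
  | cons : Prog → Prog → Prog
  | comp : Prog → Prog → Prog
  | cond : Prog → Prog → Prog → Prog
  | loop : Prog → Prog → Prog

/-- `Runs P x y t`: the program `P` halts on input `x` with output `y` after time `t`. -/
inductive Runs : Prog → Data → Data → ℕ → Prop
  | id (x) : Runs Prog.id x x x.size
  | nil (x) : Runs Prog.nil x Data.nil x.size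
  | fst (x) : Runs Prog.fst x x.fst x.size
  | snd (x) : Runs Prog.snd x x.snd x.size
  | cons {f g x y z a b} : Runs f x y a → Runs g x z b →
      Runs (Prog.cons f g) x (Data.cons y z) (a + b + 1)
  | comp {f g x y z a b} : Runs f x y a → Runs g y z b →
      Runs (Prog.comp g f) x z (a + b + 1)
  | cond_true {c f g x w y a b} : Runs c x w a → w ≠ Data.nil → Runs f x y b →
      Runs (Prog.cond c f g) x y (a + b + 1)
  | cond_false {c f g x y a b} : Runs c x Data.nil a → Runs g x y b →
      Runs (Prog.cond c f g) x y (a + b + 1)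
  | loop_done {c f x a} : Runs c x Data.nil a →
      Runs (Prog.loop c f) x x (a + x.size)
  | loop_step {c f x w y z a b d} : Runs c x w a → w ≠ Data.nil → Runs f x y b →
      Runs (Prog.loop c f) y z d → Runs (Prog.loop c f) x z (a + b + d + 1)

end Sched

namespace Sched

open Polynomial

/-! ## Polynomial-time computable functions -/

/-! ### Trees as unary numerals, truth values and lists -/

namespace Data

/-! Lower bound. Number a complete binary tree as a heap from `1` and put job `0` above it, so that
`v / 2` is the parent of `v` and `Nat.size v` its depth. With duplication, each of the `2 ^ ρ`
machines runs the whole path to its own leaf and nothing is communicated; the makespan `ρ + 2` is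
the length of such a path. Without duplication, let the only copy of `v` start at time `t`. The more
than `ρ` descendants that lie `k ≈ log ρ` levels below `v` can start before `t + ρ` only on the
machine of `v`, which has `ρ - 1` slots for them. So every `k` levels cost time `ρ`
(`exists_late_descendant`), and there are about `ρ / k` such stages.

Upper bound. Group the jobs by their earliest completion times into windows of length `ρ`, chosen
greedily so that different windows start more than `ρ` apart. Only copies completed within the
window of their job are kept. If some such copy starts before the window, the job is crossing; two
crossing copies on one machine in one window would overlap, so there is at most one. A job whose
usable copies start inside the window cannot wait for a message from a job first completed in the
same window. Hence a noncrossing predecessor in that window is completed, before the job, on every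
machine usable for the job: the sets of usable machines shrink along the order `Before`. Clustering
then assigns each job to one usable machine and to a round, so that a predecessor in this order is
in an earlier round or on the same machine. Time is stretched by a factor proportional to the number
of rounds: within a window every round replays the original timing in a block of length `2 * ρ`,
half for running and half for communication (`newStart_bounds`, `precedence_aux`, `exclusive_aux`).

Clustering is region growing (`exists_good`). A round treats the free jobs that have nearly the
maximal number `μ` of machines. Two such jobs with a common predecessor have nearly equal machine
sets, both being almost all of a set of at most `μ` machines. So all jobs of a ball of logarithmic
radius share half of the machines of its centre, and some machine serves half of the ball. A radius
at which the ball at most doubles makes the jobs above the cluster at most four times as many as the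
cluster; they wait for a later round. A round thus assigns a quarter of its jobs, `O(log n)` rounds
lower `μ` by a factor `1 - 1 / scale n`, and `O(log n * log m)` such drops suffice.

Polynomial time. All constructions are written with bounded quantifiers, counting, rational
arithmetic and iterations of polynomial length, and `PolyTime` is closed under these. Iteration
needs in addition a polynomial bound on all intermediate values. -/

theorem size_pos (x : Data) : 0 < x.size := by
  cases x <;> simp [size]

theorem size_fst_le (x : Data) : x.fst.size ≤ x.size := by
  cases x <;> simp [size, fst]; omega

theorem size_snd_le (x : Data) : x.snd.size ≤ x.size := by
  cases x <;> simp [size, snd]; omega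

@[simp] theorem fst_cons (a b : Data) : (cons a b).fst = a := rfl
@[simp] theorem snd_cons (a b : Data) : (cons a b).snd = b := rfl

/-- Unary numerals. -/
def un : ℕ → Data
  | 0 => nil
  | k + 1 => cons nil (un k)

theorem size_un (k : ℕ) : (un k).size = 2 * k + 1 := by
  induction k with
  | zero => rfl
  | succ k ih => simp [un, size, ih]; omega

open Classical in
/-- The digit that codes the truth value of `p`. -/
noncomputable def bit (p : Prop) : Data := if p then cons nil nil else nil

theorem bit_eq_nil {p : Prop} : bit p = nil ↔ ¬ p := by
  unfold bit; split_ifs with h <;> simp [h]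

theorem bit_ne_nil {p : Prop} : bit p ≠ nil ↔ p := by simp [bit_eq_nil]

theorem size_bit_le (p : Prop) : (bit p).size ≤ 3 := by
  unfold bit; split_ifs <;> simp [size]

/-- The length of the list coded by a tree. -/
def len (x : Data) : ℕ := x.toList.length

@[simp] theorem len_nil : len nil = 0 := rfl
@[simp] theorem len_cons (a b : Data) : len (cons a b) = len b + 1 := rfl

theorem len_le_size (x : Data) : x.len ≤ x.size := by
  induction x with
  | nil => simp
  | cons a b _ ih => simp [size]; omega

@[simp] theorem len_un (k : ℕ) : (un k).len = k := by
  induction k with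
  | zero => rfl
  | succ k ih => simp [un, ih]

/-- The tail of a list after its first `k` entries. -/
def drop (k : ℕ) (x : Data) : Data := snd^[k] x

@[simp] theorem drop_zero (x : Data) : drop 0 x = x := rfl

theorem drop_succ (k : ℕ) (x : Data) : drop (k + 1) x = (drop k x).snd := by
  simp [drop, Function.iterate_succ_apply']

theorem drop_succ' (k : ℕ) (x : Data) : drop (k + 1) x = drop k x.snd := by
  simp [drop, Function.iterate_succ_apply]

theorem len_snd (x : Data) : x.snd.len = x.len - 1 := by
  cases x <;> simp [snd]

theorem len_drop (k : ℕ) (x : Data) : (drop k x).len = x.len - k := by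
  induction k with
  | zero => simp
  | succ k ih => rw [drop_succ, len_snd, ih]; omega

theorem eq_nil_iff_len {x : Data} : x = nil ↔ x.len = 0 := by
  cases x <;> simp

theorem size_drop_le (k : ℕ) (x : Data) : (drop k x).size ≤ x.size := by
  induction k with
  | zero => simp
  | succ k ih => rw [drop_succ]; exact (size_snd_le _).trans ih

theorem drop_un (k n : ℕ) : drop k (un n) = un (n - k) := by
  induction k with
  | zero => simp
  | succ k ih =>
    rw [drop_succ, ih]
    rcases h : n - k with _ | j
    · rw [show n - (k + 1) = 0 by omega]; rfl
    · rw [show n - (k + 1) = j by omega]; rfl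

theorem toList_drop (k : ℕ) (x : Data) : (drop k x).toList = x.toList.drop k := by
  induction k generalizing x with
  | zero => simp
  | succ k ih =>
    rw [drop_succ', ih]
    cases x <;> simp [snd, toList]

/-- The entry of a list at a given position. -/
def nth (k : ℕ) (x : Data) : Data := (drop k x).fst

theorem nth_eq_getElem {k : ℕ} {x : Data} (h : k < x.toList.length) : nth k x = x.toList[k] := by
  have h1 := toList_drop k x
  rw [List.drop_eq_getElem_cons h] at h1
  unfold nth
  cases hd : drop k x with
  | nil => rw [hd] at h1; exact (List.cons_ne_nil _ _ h1.symm).elim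
  | cons a b => rw [hd, toList, List.cons.injEq] at h1; exact h1.1

/-- The tree that codes a list. -/
def ofList : List Data → Data
  | [] => nil
  | a :: l => cons a (ofList l)

@[simp] theorem toList_ofList (l : List Data) : (ofList l).toList = l := by
  induction l with
  | nil => rfl
  | cons a l ih => simp [ofList, toList, ih]

/-- The list of the values of a function. -/
def tab {n : ℕ} (f : Fin n → Data) : Data := ofList (List.ofFn f)

@[simp] theorem toList_tab {n : ℕ} (f : Fin n → Data) : (tab f).toList = List.ofFn f := by
  simp [tab]

theorem nth_tab {n : ℕ} (f : Fin n → Data) (i : Fin n) : nth i (tab f) = f i := by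
  rw [nth_eq_getElem (by simp)]; simp

theorem size_ofList_le (l : List Data) (b : ℕ) (h : ∀ a ∈ l, a.size ≤ b) :
    (ofList l).size ≤ l.length * (b + 1) + 1 := by
  induction l with
  | nil => simp [ofList, size]
  | cons a l ih =>
    have h1 := h a (by simp)
    have h2 := ih (fun a' ha => h a' (by simp [ha]))
    simp only [ofList, size, List.length_cons]
    nlinarith

theorem size_tab_le {n : ℕ} (f : Fin n → Data) (b : ℕ) (h : ∀ i, (f i).size ≤ b) :
    (tab f).size ≤ n * (b + 1) + 1 := by
  have := size_ofList_le (List.ofFn f) b (by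
    intro a ha
    rw [List.mem_ofFn] at ha
    obtain ⟨i, rfl⟩ := ha
    exact h i)
  simpa [tab] using this

end Data

open Data

/-- Since every primitive step is charged for the tree it handles, a time bound is also a bound on
the output; compositions therefore need no separate size estimates. -/
theorem Runs.size_le {P : Prog} {x y : Data} {t : ℕ} (h : Runs P x y t) : y.size ≤ t := by
  induction h with
  | id x => exact le_rfl
  | nil x => exact size_pos x
  | fst x => exact size_fst_le x
  | snd x => exact size_snd_le x
  | cons _ _ h1 h2 => simp [size]; omega
  | comp _ _ h1 h2 => omega
  | cond_true _ _ _ h1 h2 => omega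
  | cond_false _ _ h1 h2 => omega
  | loop_done _ h1 => omega
  | loop_step _ _ _ _ h1 h2 h3 => omega

theorem eval_mono (q : ℕ[X]) {a b : ℕ} (h : a ≤ b) : q.eval a ≤ q.eval b := by
  rw [Polynomial.eval_eq_sum_range, Polynomial.eval_eq_sum_range]
  gcongr

/-- A bound that is polynomial in the size of the situation. -/
def PolyBound {Γ : Type} (e : Γ → Data) (f : Γ → ℕ) : Prop :=
  ∃ q : ℕ[X], ∀ c, f c ≤ q.eval (e c).size

/-- `F` is computed in polynomial time from the code `e` of a situation. -/
def PolyTime {Γ : Type} (e F : Γ → Data) : Prop :=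
  ∃ (P : Prog) (q : ℕ[X]), ∀ c, ∃ t, Runs P (e c) (F c) t ∧ t ≤ q.eval (e c).size

/-! ### Closure properties of polynomial-time computation -/

section

variable {Γ : Type} {e F G H : Γ → Data}

theorem PolyBound.size : PolyBound e (fun c => (e c).size) := ⟨X, by simp⟩

theorem PolyBound.const (k : ℕ) : PolyBound e (fun _ => k) := ⟨C k, by simp⟩

theorem PolyBound.add {f g : Γ → ℕ} (hf : PolyBound e f) (hg : PolyBound e g) :
    PolyBound e (fun c => f c + g c) := by
  obtain ⟨p, hp⟩ := hf
  obtain ⟨q, hq⟩ := hg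
  exact ⟨p + q, fun c => by rw [eval_add]; exact add_le_add (hp c) (hq c)⟩

theorem PolyBound.mul {f g : Γ → ℕ} (hf : PolyBound e f) (hg : PolyBound e g) :
    PolyBound e (fun c => f c * g c) := by
  obtain ⟨p, hp⟩ := hf
  obtain ⟨q, hq⟩ := hg
  exact ⟨p * q, fun c => by rw [eval_mul]; exact Nat.mul_le_mul (hp c) (hq c)⟩

theorem PolyBound.mono {f g : Γ → ℕ} (hf : PolyBound e f) (h : ∀ c, g c ≤ f c) :
    PolyBound e g := by
  obtain ⟨p, hp⟩ := hf
  exact ⟨p, fun c => (h c).trans (hp c)⟩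

theorem PolyBound.trans {f : Γ → ℕ} (hF : PolyBound e (fun c => (F c).size))
    (hf : PolyBound F f) : PolyBound e f := by
  obtain ⟨p, hp⟩ := hF
  obtain ⟨q, hq⟩ := hf
  exact ⟨q.comp p, fun c => (hq c).trans (by rw [eval_comp]; exact eval_mono q (hp c))⟩

theorem PolyTime.bound (h : PolyTime e F) : PolyBound e (fun c => (F c).size) := by
  obtain ⟨P, q, h⟩ := h
  refine ⟨q, fun c => ?_⟩
  obtain ⟨t, h1, h2⟩ := h c
  exact h1.size_le.trans h2

theorem PolyTime.of_bound (P : Prog) {f : Γ → ℕ} (hf : PolyBound e f)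
    (h : ∀ c, ∃ t, Runs P (e c) (F c) t ∧ t ≤ f c) : PolyTime e F := by
  obtain ⟨q, hq⟩ := hf
  refine ⟨P, q, fun c => ?_⟩
  obtain ⟨t, h1, h2⟩ := h c
  exact ⟨t, h1, h2.trans (hq c)⟩

/-- Together with `PolyTime.of_bound` this hides the polynomial behind a plain function of the
situation, so that the time estimates below become linear arithmetic. -/
theorem PolyTime.program (h : PolyTime e F) : ∃ (P : Prog) (f : Γ → ℕ), PolyBound e f ∧
    ∀ c, ∃ t, Runs P (e c) (F c) t ∧ t ≤ f c := by
  obtain ⟨P, q, h⟩ := h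
  exact ⟨P, fun c => q.eval (e c).size, ⟨q, fun _ => le_rfl⟩, h⟩

theorem PolyTime.congr (h : PolyTime e F) (hFG : ∀ c, F c = G c) : PolyTime e G := by
  rwa [← funext hFG]

theorem PolyTime.refl : PolyTime e e :=
  ⟨Prog.id, X, fun c => ⟨_, Runs.id _, by simp⟩⟩

theorem PolyTime.nil : PolyTime e (fun _ => Data.nil) :=
  ⟨Prog.nil, X, fun c => ⟨_, Runs.nil _, by simp⟩⟩

theorem PolyTime.trans (hF : PolyTime e F) (hG : PolyTime F G) : PolyTime e G := by
  have hb := hF.bound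
  obtain ⟨P, f, hf, h1⟩ := hF.program
  obtain ⟨P', f', hf', h2⟩ := hG.program
  refine PolyTime.of_bound (Prog.comp P' P) ((hf.add (hb.trans hf')).add (.const 1)) fun c => ?_
  obtain ⟨a, ha, ha'⟩ := h1 c
  obtain ⟨b, hb, hb'⟩ := h2 c
  exact ⟨_, Runs.comp ha hb, by omega⟩

theorem PolyTime.fst (h : PolyTime e F) : PolyTime e (fun c => (F c).fst) :=
  h.trans ⟨Prog.fst, X, fun _ => ⟨_, Runs.fst _, by simp⟩⟩

theorem PolyTime.snd (h : PolyTime e F) : PolyTime e (fun c => (F c).snd) :=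
  h.trans ⟨Prog.snd, X, fun _ => ⟨_, Runs.snd _, by simp⟩⟩

theorem PolyTime.cons (hF : PolyTime e F) (hG : PolyTime e G) :
    PolyTime e (fun c => Data.cons (F c) (G c)) := by
  obtain ⟨P, f, hf, h1⟩ := hF.program
  obtain ⟨P', f', hf', h2⟩ := hG.program
  refine PolyTime.of_bound (Prog.cons P P') ((hf.add hf').add (.const 1)) fun c => ?_
  obtain ⟨a, ha, ha'⟩ := h1 c
  obtain ⟨b, hb, hb'⟩ := h2 c
  exact ⟨_, Runs.cons ha hb, by omega⟩

theorem PolyTime.const (d : Data) : PolyTime e (fun _ => d) := by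
  induction d with
  | nil => exact .nil
  | cons a b ha hb => exact ha.cons hb

open Classical in
theorem PolyTime.ite {p : Γ → Prop} (hp : PolyTime e (fun c => bit (p c))) (hF : PolyTime e F)
    (hG : PolyTime e G) : PolyTime e (fun c => if p c then F c else G c) := by
  obtain ⟨P0, f0, hf0, h0⟩ := hp.program
  obtain ⟨P, f, hf, h1⟩ := hF.program
  obtain ⟨P', f', hf', h2⟩ := hG.program
  refine PolyTime.of_bound (Prog.cond P0 P P') ((hf0.add (hf.add hf')).add (.const 1)) fun c => ?_
  obtain ⟨d, hd, hd'⟩ := h0 c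
  obtain ⟨a, ha, ha'⟩ := h1 c
  obtain ⟨b, hb, hb'⟩ := h2 c
  by_cases h : p c
  · rw [if_pos h]
    exact ⟨_, Runs.cond_true hd (bit_ne_nil.2 h) ha, by omega⟩
  · rw [if_neg h]
    rw [bit_eq_nil.2 h] at hd
    exact ⟨_, Runs.cond_false hd hb, by omega⟩

theorem PolyTime.reindex {Γ' : Type} (h : PolyTime e F) (π : Γ' → Γ) :
    PolyTime (fun g => e (π g)) (fun g => F (π g)) := by
  obtain ⟨P, q, h⟩ := h
  exact ⟨P, q, fun g => h (π g)⟩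

/-- Substitution: the situation may be computed from a richer one. -/
theorem PolyTime.subst {Γ' : Type} {e' : Γ' → Data} (h : PolyTime e F) (π : Γ' → Γ)
    (hπ : PolyTime e' (fun g => e (π g))) : PolyTime e' (fun g => F (π g)) :=
  hπ.trans (h.reindex π)

/-- Weakening by a second component. -/
theorem PolyTime.lift (h : PolyTime e F) : PolyTime (fun c => Data.cons (e c) (G c)) F :=
  PolyTime.refl.fst.trans h

theorem PolyTime.not {p : Γ → Prop} (hp : PolyTime e (fun c => bit (p c))) :
    PolyTime e (fun c => bit (¬ p c)) :=
  (hp.ite .nil (.const (Data.cons Data.nil Data.nil))).congr fun c => by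
    unfold bit; by_cases h : p c <;> simp [h]

theorem PolyTime.and {p q : Γ → Prop} (hp : PolyTime e (fun c => bit (p c)))
    (hq : PolyTime e (fun c => bit (q c))) : PolyTime e (fun c => bit (p c ∧ q c)) :=
  (hp.ite hq .nil).congr fun c => by
    unfold bit; by_cases h : p c <;> by_cases h' : q c <;> simp [h, h']

theorem PolyTime.or {p q : Γ → Prop} (hp : PolyTime e (fun c => bit (p c)))
    (hq : PolyTime e (fun c => bit (q c))) : PolyTime e (fun c => bit (p c ∨ q c)) :=
  (hp.not.and hq.not).not.congr fun c => congrArg bit (propext (by tauto))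

theorem PolyTime.imp {p q : Γ → Prop} (hp : PolyTime e (fun c => bit (p c)))
    (hq : PolyTime e (fun c => bit (q c))) : PolyTime e (fun c => bit (p c → q c)) :=
  (hp.not.or hq).congr fun c => congrArg bit (propext (by tauto))

theorem PolyTime.bit_iff {p q : Γ → Prop} (hp : PolyTime e (fun c => bit (p c)))
    (h : ∀ c, p c ↔ q c) : PolyTime e (fun c => bit (q c)) :=
  hp.congr fun c => by rw [propext (h c)]

/-- Any nonatomic tree counts as true; this normalizes it to a digit `bit`, the only form that the
other combinators accept. -/
theorem PolyTime.bit_ne_nil (h : PolyTime e F) : PolyTime e (fun c => bit (F c ≠ Data.nil)) := by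
  obtain ⟨P, f, hf, h⟩ := h.program
  have hc := (PolyTime.const (e := e) (Data.cons Data.nil Data.nil)).program
  obtain ⟨P1, f1, hf1, h1⟩ := hc
  obtain ⟨P2, f2, hf2, h2⟩ := (PolyTime.nil (e := e)).program
  refine PolyTime.of_bound (Prog.cond P P1 P2) ((hf.add (hf1.add hf2)).add (.const 1)) fun c => ?_
  obtain ⟨d, hd, hd'⟩ := h c
  obtain ⟨a, ha, ha'⟩ := h1 c
  obtain ⟨b, hb, hb'⟩ := h2 c
  by_cases hn : F c = Data.nil
  · rw [bit_eq_nil.2 (by simpa using hn)]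
    rw [hn] at hd
    exact ⟨_, Runs.cond_false hd hb, by omega⟩
  · rw [bit, if_pos hn]
    exact ⟨_, Runs.cond_true hd hn ha, by omega⟩

/-- Iteration along a list `N`: the `k`-th step sees the situation, the rest of the list, and the
`k`-th state. -/
theorem PolyTime.loop {N : Γ → Data} {s : (c : Γ) → ℕ → Data} (hN : PolyTime e N)
    (h0 : PolyTime e (fun c => s c 0))
    (hs : PolyTime (fun p : (c : Γ) × Fin (N c).len =>
        Data.cons (Data.cons (e p.1) (drop p.2 (N p.1))) (s p.1 p.2))
      (fun p => s p.1 (p.2 + 1)))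
    (hb : ∃ f : Γ → ℕ, PolyBound e f ∧ ∀ c, ∀ k ≤ (N c).len, (s c k).size ≤ f c) :
    PolyTime e (fun c => s c (N c).len) := by
  obtain ⟨f, hf, hb⟩ := hb
  obtain ⟨PN, fN, hfN, hN'⟩ := (hN.cons (PolyTime.refl.cons h0)).program
  obtain ⟨S, q, hS⟩ := hs
  -- The loop carries the triple (rest of the list, code of the situation, current state) and stops
  -- when the list is exhausted.
  let body : Prog := Prog.cons (Prog.comp Prog.snd Prog.fst) (Prog.cons (Prog.comp Prog.fst Prog.snd)
    (Prog.comp S (Prog.cons (Prog.cons (Prog.comp Prog.fst Prog.snd) Prog.fst)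
      (Prog.comp Prog.snd Prog.snd))))
  -- `w` bounds the input of one step and `B` the cost of one pass through the loop.
  let w : Γ → ℕ := fun c => (N c).size + (e c).size + f c + 2
  have hw : PolyBound e w := ((hN.bound.add .size).add hf).add (.const 2)
  let B : Γ → ℕ := fun c => 20 * w c + 20 + q.eval (w c)
  have hB : PolyBound e B :=
    (((PolyBound.const 20).mul hw).add (.const 20)).add (by
      obtain ⟨p, hp⟩ := hw
      exact ⟨q.comp p, fun c => by rw [eval_comp]; exact eval_mono q (hp c)⟩)
  -- The induction is on the number `j` of passes that remain, because `Runs.loop_step` adds a pass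
  -- at the beginning of a run.
  have key : ∀ c, ∀ j ≤ (N c).len, ∃ t,
      Runs (Prog.loop Prog.fst body)
        (Data.cons (drop ((N c).len - j) (N c)) (Data.cons (e c) (s c ((N c).len - j))))
        (Data.cons Data.nil (Data.cons (e c) (s c (N c).len))) t ∧ t ≤ (j + 1) * B c := by
    intro c j
    induction j with
    | zero =>
      intro _
      have hnil : drop ((N c).len - 0) (N c) = Data.nil := by
        rw [eq_nil_iff_len, len_drop]; omega
      rw [hnil]
      refine ⟨_, Runs.loop_done (Runs.fst _), ?_⟩
      have := hb c ((N c).len - 0) (by omega)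
      simp only [size, B, w]
      omega
    | succ j ih =>
      intro hj
      obtain ⟨t, ht, htb⟩ := ih (by omega)
      set k := (N c).len - (j + 1) with hk
      have hk1 : (N c).len - j = k + 1 := by omega
      rw [hk1] at ht
      have hne : drop k (N c) ≠ Data.nil := by
        rw [Ne, eq_nil_iff_len, len_drop]; omega
      obtain ⟨d, hd, hdb⟩ := hS ⟨c, ⟨k, by omega⟩⟩
      simp only at hd hdb
      have hsz1 := hb c k (by omega)
      have hsz2 := size_drop_le k (N c)
      have hbody := Runs.cons (Runs.comp
          (Runs.fst (Data.cons (drop k (N c)) (Data.cons (e c) (s c k)))) (Runs.snd _))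
        (Runs.cons (Runs.comp (Runs.snd (Data.cons (drop k (N c)) (Data.cons (e c) (s c k))))
          (Runs.fst _))
          (Runs.comp (Runs.cons (Runs.cons (Runs.comp
              (Runs.snd (Data.cons (drop k (N c)) (Data.cons (e c) (s c k)))) (Runs.fst _))
              (Runs.fst (Data.cons (drop k (N c)) (Data.cons (e c) (s c k)))))
            (Runs.comp (Runs.snd (Data.cons (drop k (N c)) (Data.cons (e c) (s c k))))
              (Runs.snd _))) hd))
      simp only [fst_cons, snd_cons] at hbody
      rw [← drop_succ] at hbody
      refine ⟨_, Runs.loop_step (Runs.fst _) hne hbody ht, ?_⟩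
      have hq : q.eval (Data.cons (Data.cons (e c) (drop k (N c))) (s c k)).size ≤ q.eval (w c) :=
        eval_mono q (by simp only [size, w]; omega)
      have : (j + 1 + 1) * B c = (j + 1) * B c + B c := by ring
      rw [this]
      simp only [size] at *
      simp only [B, w] at *
      omega
  refine PolyTime.of_bound
    (Prog.comp (Prog.comp Prog.snd Prog.snd) (Prog.comp (Prog.loop Prog.fst body) PN))
    (f := fun c => fN c + ((N c).size + 1) * B c + 4 * w c + 20)
    (((hfN.add ((hN.bound.add (.const 1)).mul hB)).add ((PolyBound.const 4).mul hw)).add (.const 20))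
    fun c => ?_
  obtain ⟨a, ha, hab⟩ := hN' c
  obtain ⟨t, ht, htb⟩ := key c (N c).len le_rfl
  simp only [Nat.sub_self, drop_zero] at ht
  refine ⟨_, Runs.comp (Runs.comp ha ht) (Runs.comp (Runs.snd _) (Runs.snd _)), ?_⟩
  have hsz1 := hb c (N c).len le_rfl
  have h3 : ((N c).len + 1) * B c ≤ ((N c).size + 1) * B c :=
    Nat.mul_le_mul_right _ (Nat.add_le_add_right (len_le_size _) 1)
  simp only [size, snd_cons, w] at *
  omega

end

end Sched

namespace Sched

open Polynomial Data

/-! ### Recursion on an index, tables, quantifiers, counting, selection -/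

section

variable {Γ : Type} {e F G H : Γ → Data}

theorem PolyTime.un_len {N : Γ → Data} (hN : PolyTime e N) :
    PolyTime e (fun c => un (N c).len) := by
  refine PolyTime.loop (s := fun _ k => un k) hN .nil ?_
    ⟨fun c => 2 * (N c).size + 1, ((PolyBound.const 2).mul hN.bound).add (.const 1), fun c k hk => ?_⟩
  · exact PolyTime.nil.cons PolyTime.refl.snd
  · have := len_le_size (N c)
    simp only [size_un]; omega

/-- Descending recursion on an index. -/
theorem PolyTime.recDown {n : Γ → ℕ} {S : Γ → ℕ → Data} (hn : PolyTime e (fun c => un (n c)))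
    (h0 : PolyTime e (fun c => S c (n c)))
    (hs : PolyTime (fun p : (c : Γ) × Fin (n c) =>
        Data.cons (Data.cons (e p.1) (un p.2)) (S p.1 (p.2 + 1)))
      (fun p => S p.1 p.2))
    (hb : ∃ f : Γ → ℕ, PolyBound e f ∧ ∀ c, ∀ k ≤ n c, (S c k).size ≤ f c) :
    PolyTime e (fun c => S c 0) := by
  obtain ⟨f, hf, hb⟩ := hb
  have := PolyTime.loop (s := fun c k => S c (n c - k)) hn (by simpa using h0) ?_
    ⟨f, hf, fun c k _ => hb c _ (by omega)⟩
  · exact this.congr fun c => by simp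
  · refine (hs.subst (fun p : (c : Γ) × Fin (un (n c)).len =>
      ⟨p.1, ⟨n p.1 - (p.2 + 1), by have := p.2.2.trans_eq (len_un (n p.1)); omega⟩⟩) ?_).congr ?_
    · refine ((PolyTime.refl.fst.fst.cons PolyTime.refl.fst.snd.snd).cons PolyTime.refl.snd).congr ?_
      rintro ⟨c, k, hk⟩
      rw [len_un] at hk
      simp only [fst_cons, snd_cons]
      rw [← drop_succ, drop_un, show n c - (k + 1) + 1 = n c - k by omega]
    · rintro ⟨c, k, hk⟩
      rfl

/-- Iteration. -/
theorem PolyTime.iter {N : Γ → Data} {s : Γ → ℕ → Data} (hN : PolyTime e N)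
    (h0 : PolyTime e (fun c => s c 0))
    (hs : PolyTime (fun p : Γ × ℕ => Data.cons (e p.1) (s p.1 p.2)) (fun p => s p.1 (p.2 + 1)))
    (hb : ∃ f : Γ → ℕ, PolyBound e f ∧ ∀ c, ∀ k ≤ (N c).len, (s c k).size ≤ f c) :
    PolyTime e (fun c => s c (N c).len) :=
  PolyTime.loop hN h0 (hs.subst (fun p : (c : Γ) × Fin (N c).len => (p.1, (p.2 : ℕ)))
    (PolyTime.refl.fst.fst.cons PolyTime.refl.snd)) hb

theorem PolyTime.drop {L : Γ → Data} {i : Γ → ℕ} (hL : PolyTime e L)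
    (hi : PolyTime e (fun c => un (i c))) : PolyTime e (fun c => Data.drop (i c) (L c)) :=
  (PolyTime.iter (s := fun c k => Data.drop k (L c)) hi hL
    (PolyTime.refl.snd.snd.congr fun p => by rw [snd_cons, Data.drop_succ])
    ⟨_, hL.bound, fun c k _ => size_drop_le k _⟩).congr fun c => by simp

theorem PolyTime.nth {L : Γ → Data} {i : Γ → ℕ} (hL : PolyTime e L)
    (hi : PolyTime e (fun c => un (i c))) : PolyTime e (fun c => Data.nth (i c) (L c)) :=
  (hL.drop hi).fst

/-- The code of a situation with an additional index. -/
def ext (e : Γ → Data) (n : Γ → ℕ) (p : (c : Γ) × Fin (n c)) : Data := Data.cons (e p.1) (un p.2)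

section ext

variable {n : Γ → ℕ}

theorem PolyTime.idx : PolyTime (ext e n) (fun p => un p.2) := PolyTime.refl.snd

theorem PolyTime.base : PolyTime (ext e n) (fun p => e p.1) := PolyTime.refl.fst

/-- Weakening: a function of the situation ignores the additional index. -/
theorem PolyTime.weak (h : PolyTime e F) : PolyTime (ext e n) (fun p => F p.1) :=
  h.subst Sigma.fst PolyTime.base

/-- Substitution of an index. -/
theorem PolyTime.un_bound (hn : PolyTime e (fun c => un (n c))) : PolyBound e n :=
  hn.bound.mono fun c => by rw [size_un]; omega

/-- A bound for the values on all indices. -/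
theorem PolyBound.ext {f : (c : Γ) × Fin (n c) → ℕ} (hf : PolyBound (ext e n) f)
    (hn : PolyTime e (fun c => un (n c))) :
    ∃ g : Γ → ℕ, PolyBound e g ∧ ∀ c i, f ⟨c, i⟩ ≤ g c := by
  obtain ⟨q, hq⟩ := hf
  obtain ⟨r, hr⟩ := (PolyBound.size.add ((PolyBound.const 2).mul hn.un_bound)).add (.const 2)
  refine ⟨fun c => q.eval (r.eval (e c).size), ⟨q.comp r, fun c => by rw [eval_comp]⟩, fun c i => ?_⟩
  refine (hq _).trans (eval_mono q (le_trans ?_ (hr c)))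
  simp only [Sched.ext, Data.size, size_un]
  have := i.2
  omega

theorem PolyTime.tab {g : (c : Γ) → Fin (n c) → Data} (hn : PolyTime e (fun c => un (n c)))
    (hg : PolyTime (ext e n) (fun p => g p.1 p.2)) : PolyTime e (fun c => Data.tab (g c)) := by
  obtain ⟨b, hb, hb'⟩ := hg.bound.ext hn
  refine (PolyTime.recDown (S := fun c k => ofList ((List.ofFn (g c)).drop k)) hn
    (PolyTime.nil.congr fun c => ?_) ?_ ⟨fun c => n c * (b c + 1) + 1,
      (hn.un_bound.mul (hb.add (.const 1))).add (.const 1), fun c k _ => ?_⟩).congr ?_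
  · rw [List.drop_of_length_le (by simp)]; rfl
  · refine ((hg.lift).cons PolyTime.refl.snd).congr ?_
    rintro ⟨c, i⟩
    simp only [snd_cons]
    rw [List.drop_eq_getElem_cons (by simp : (i : ℕ) < (List.ofFn (g c)).length)]
    simp [ofList]
  · refine (size_ofList_le _ (b c) ?_).trans ?_
    · intro a ha
      have := List.mem_of_mem_drop ha
      rw [List.mem_ofFn] at this
      obtain ⟨i, rfl⟩ := this
      exact hb' c i
    · have : ((List.ofFn (g c)).drop k).length ≤ n c := by simp
      exact Nat.add_le_add_right (Nat.mul_le_mul_right _ this) 1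
  · intro c
    simp [Data.tab]

/-- A quantifier over indices is a loop over a unary range. Hence every formula with such
quantifiers over polynomial-time relations is decided in polynomial time, which is how all
predicates of the algorithm are treated. -/
theorem PolyTime.ex {p : (c : Γ) → Fin (n c) → Prop} (hn : PolyTime e (fun c => un (n c)))
    (hp : PolyTime (ext e n) (fun x => bit (p x.1 x.2))) :
    PolyTime e (fun c => bit (∃ i, p c i)) := by
  refine (PolyTime.recDown (S := fun c k => bit (∃ i : Fin (n c), k ≤ i ∧ p c i)) hn
    (PolyTime.nil.congr fun c => ?_) ?_ ⟨fun _ => 3, .const 3, fun c k _ => size_bit_le _⟩).congr ?_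
  · symm
    rw [bit_eq_nil]
    rintro ⟨i, hi, _⟩
    exact absurd i.2 (by omega)
  · refine PolyTime.bit_iff ((hp.lift).or
      (q := fun x => ∃ i : Fin (n x.1), (x.2 : ℕ) + 1 ≤ i ∧ p x.1 i) PolyTime.refl.snd) ?_
    rintro ⟨c, i⟩
    dsimp only
    constructor
    · rintro (h | ⟨j, hj, h⟩)
      · exact ⟨i, le_rfl, h⟩
      · exact ⟨j, by omega, h⟩
    · rintro ⟨j, hj, h⟩
      rcases eq_or_lt_of_le hj with h1 | h1
      · left; rwa [Fin.ext h1]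
      · right; exact ⟨j, h1, h⟩
  · intro c
    simp

theorem PolyTime.all {p : (c : Γ) → Fin (n c) → Prop} (hn : PolyTime e (fun c => un (n c)))
    (hp : PolyTime (ext e n) (fun x => bit (p x.1 x.2))) :
    PolyTime e (fun c => bit (∀ i, p c i)) :=
  (PolyTime.ex (p := fun c i => ¬ p c i) hn hp.not).not.bit_iff fun c => by simp

open Classical in
theorem PolyTime.card {p : (c : Γ) → Fin (n c) → Prop} (hn : PolyTime e (fun c => un (n c)))
    (hp : PolyTime (ext e n) (fun x => bit (p x.1 x.2))) :
    PolyTime e (fun c => un (Finset.univ.filter (p c)).card) := by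
  refine (PolyTime.recDown
    (S := fun c k => un (Finset.univ.filter fun i : Fin (n c) => k ≤ i ∧ p c i).card) hn
    (PolyTime.nil.congr fun c => ?_) ?_ ⟨fun c => 2 * n c + 1,
      ((PolyBound.const 2).mul hn.un_bound).add (.const 1), fun c k _ => ?_⟩).congr ?_
  · rw [Finset.card_eq_zero.2]; · rfl
    ext i
    have := i.2
    simp
  · refine ((hp.lift).ite (PolyTime.nil.cons PolyTime.refl.snd)
      PolyTime.refl.snd).congr ?_
    rintro ⟨c, i⟩
    simp only [snd_cons]
    split_ifs with h
    · have : (Finset.univ.filter fun j : Fin (n c) => (i : ℕ) ≤ j ∧ p c j) =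
          insert i (Finset.univ.filter fun j : Fin (n c) => (i : ℕ) + 1 ≤ j ∧ p c j) := by
        ext j
        simp only [Finset.mem_filter, Finset.mem_univ, true_and, Finset.mem_insert]
        constructor
        · rintro ⟨h1, h2⟩
          rcases eq_or_lt_of_le h1 with h3 | h3
          · left; exact (Fin.ext h3).symm
          · right; exact ⟨h3, h2⟩
        · rintro (rfl | ⟨h1, h2⟩)
          · exact ⟨le_rfl, h⟩
          · exact ⟨by omega, h2⟩
      rw [this, Finset.card_insert_of_notMem (by simp)]
      rfl
    · congr 2
      ext j
      simp only [Finset.mem_filter, Finset.mem_univ, true_and]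
      constructor
      · rintro ⟨h1, h2⟩
        exact ⟨by omega, h2⟩
      · rintro ⟨h1, h2⟩
        refine ⟨lt_of_le_of_ne h1 fun h3 => h ?_, h2⟩
        rwa [Fin.ext h3]
  · rw [size_un]
    have := (Finset.univ.filter fun i : Fin (n c) => k ≤ i ∧ p c i).card_le_univ
    simp only [Fintype.card_fin] at this
    show 2 * _ + 1 ≤ 2 * n c + 1
    omega
  · intro c
    simp

open Classical in
/-- Selection of the value at the first index with a given property. -/
theorem PolyTime.sel {p : (c : Γ) → Fin (n c) → Prop} {g : (c : Γ) → Fin (n c) → Data}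
    (hn : PolyTime e (fun c => un (n c)))
    (hp : PolyTime (ext e n) (fun x => bit (p x.1 x.2)))
    (hg : PolyTime (ext e n) (fun x => g x.1 x.2)) (hex : ∀ c, ∃ i, p c i) :
    ∃ i : (c : Γ) → Fin (n c), (∀ c, p c (i c)) ∧ PolyTime e (fun c => g c (i c)) := by
  obtain ⟨b, hb, hb'⟩ := hg.bound.ext hn
  -- The recursion keeps the value at the first solution that is at least `k`; going down, a
  -- solution at `k` overwrites it.
  let P : (c : Γ) → ℕ → ℕ → Prop := fun c k j => k ≤ j ∧ ∃ h : j < n c, p c ⟨j, h⟩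
  let S : Γ → ℕ → Data := fun c k => if h : ∃ j, P c k j then g c ⟨Nat.find h, (Nat.find_spec h).2.1⟩
    else Data.nil
  have hex' : ∀ c, ∃ j, P c 0 j := fun c => by
    obtain ⟨i, hi⟩ := hex c
    exact ⟨i, by simp, i.2, hi⟩
  refine ⟨fun c => ⟨Nat.find (hex' c), (Nat.find_spec (hex' c)).2.1⟩,
    fun c => (Nat.find_spec (hex' c)).2.2, ?_⟩
  refine (PolyTime.recDown (S := S) hn (PolyTime.nil.congr fun c => ?_) ?_
    ⟨fun c => b c + 1, hb.add (.const 1), fun c k _ => ?_⟩).congr fun c => ?_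
  · symm
    apply dif_neg
    rintro ⟨j, h1, h2, _⟩
    omega
  · refine ((hp.lift).ite (hg.lift)
      PolyTime.refl.snd).congr ?_
    rintro ⟨c, i⟩
    simp only [snd_cons]
    split_ifs with h
    · have h1 : ∃ j, P c i j := ⟨i, le_rfl, i.2, h⟩
      have h2 : Nat.find h1 = i := (Nat.find_eq_iff h1).2
        ⟨⟨le_rfl, i.2, h⟩, fun j hj hP => absurd hP.1 (by omega)⟩
      simp only [S, dif_pos h1]
      congr 1
      exact Fin.ext h2.symm
    · have h2 : P c (i + 1) = P c i := by
        funext j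
        refine propext ⟨fun ⟨h1, h3⟩ => ⟨by omega, h3⟩, fun ⟨h1, h3⟩ => ⟨?_, h3⟩⟩
        refine lt_of_le_of_ne h1 ?_
        rintro rfl
        exact h h3.2
      have h3 : (∃ j, P c (i + 1) j) ↔ ∃ j, P c i j := by rw [h2]
      simp only [S]
      by_cases h4 : ∃ j, P c i j
      · rw [dif_pos h4, dif_pos (h3.2 h4)]
        congr 1
        apply Fin.ext
        apply le_antisymm <;> apply Nat.find_mono <;> intro j hj
        · rwa [h2]
        · rwa [← h2]
      · rw [dif_neg h4, dif_neg (mt h3.1 h4)]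
  · simp only [S]
    split_ifs with h
    · exact (hb' c _).trans (by omega)
    · simp [size]
  · simp only [S, dif_pos (hex' c)]

end ext

end

end Sched

namespace Sched

open Polynomial Data

/-! ## Binary arithmetic -/

namespace Data

/-- Binary numerals without leading zeros. -/
noncomputable def bin (n : ℕ) : Data :=
  if h : n = 0 then nil else cons (bit (n % 2 = 1)) (bin (n / 2))
decreasing_by omega

@[simp] theorem bin_zero : bin 0 = nil := by rw [bin]; simp

theorem bin_pos {n : ℕ} (h : n ≠ 0) : bin n = cons (bit (n % 2 = 1)) (bin (n / 2)) := by
  rw [bin, dif_neg h]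

theorem snd_bin (n : ℕ) : (bin n).snd = bin (n / 2) := by
  rcases eq_or_ne n 0 with rfl | h
  · simp [snd]
  · rw [bin_pos h, snd_cons]

theorem fst_bin (n : ℕ) : (bin n).fst = bit (n % 2 = 1) := by
  rcases eq_or_ne n 0 with rfl | h
  · simp [fst, bit]
  · rw [bin_pos h, fst_cons]

theorem drop_bin (k n : ℕ) : drop k (bin n) = bin (n / 2 ^ k) := by
  induction k with
  | zero => simp
  | succ k ih => rw [drop_succ, ih, snd_bin, Nat.div_div_eq_div_mul, pow_succ]

theorem nth_bin (k n : ℕ) : nth k (bin n) = bit (n / 2 ^ k % 2 = 1) := by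
  rw [nth, drop_bin, fst_bin]

theorem toNat_bin (n : ℕ) : (bin n).toNat = n := by
  induction n using Nat.strong_induction_on with
  | _ n ih =>
    rcases eq_or_ne n 0 with rfl | h
    · simp [toNat]
    · rw [bin_pos h, toNat, ih _ (by omega)]
      simp only [bit_eq_nil]
      split_ifs <;> omega

theorem bin_eq_nil {n : ℕ} : bin n = nil ↔ n = 0 := by
  constructor
  · intro h
    rw [← toNat_bin n, h, toNat]
  · rintro rfl; simp

theorem lt_pow_len_bin (n : ℕ) : n < 2 ^ (bin n).len := by
  induction n using Nat.strong_induction_on with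
  | _ n ih =>
    rcases eq_or_ne n 0 with rfl | h
    · simp
    · rw [bin_pos h, len_cons, pow_succ]
      have := ih (n / 2) (by omega)
      omega

theorem len_bin_le {n k : ℕ} (h : n < 2 ^ k) : (bin n).len ≤ k := by
  induction k generalizing n with
  | zero =>
    have : n = 0 := by simpa using h
    simp [this]
  | succ k ih =>
    rcases eq_or_ne n 0 with rfl | h0
    · simp
    · rw [bin_pos h0, len_cons]
      have := @ih (n / 2) (by rw [pow_succ] at h; omega)
      omega

theorem size_bin_le (n : ℕ) : (bin n).size ≤ 4 * (bin n).len + 1 := by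
  induction n using Nat.strong_induction_on with
  | _ n ih =>
    rcases eq_or_ne n 0 with rfl | h
    · simp [size]
    · rw [bin_pos h, len_cons, size]
      have := ih (n / 2) (by omega)
      have := size_bit_le (n % 2 = 1)
      omega

theorem size_bin_le_of_lt {n k : ℕ} (h : n < 2 ^ k) : (bin n).size ≤ 4 * k + 1 := by
  have := size_bin_le n
  have := len_bin_le h
  omega

theorem toNat_lt (x : Data) : x.toNat < 2 ^ x.len := by
  induction x with
  | nil => simp [toNat]
  | cons a b _ ih =>
    rw [toNat, len_cons, pow_succ]
    split_ifs <;> omega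

end Data

section

variable {Γ : Type} {e F G : Γ → Data}

/-- Ascending recursion on an index. -/
theorem PolyTime.recUp {n : Γ → ℕ} {s : Γ → ℕ → Data} (hn : PolyTime e (fun c => un (n c)))
    (h0 : PolyTime e (fun c => s c 0))
    (hs : PolyTime (fun p : Γ × ℕ => Data.cons (Data.cons (e p.1) (un p.2)) (s p.1 p.2))
      (fun p => s p.1 (p.2 + 1)))
    (hb : ∃ f : Γ → ℕ, PolyBound e f ∧ ∀ c, ∀ k ≤ n c, (s c k).size ≤ f c) :
    PolyTime e (fun c => s c (n c)) := by
  obtain ⟨f, hf, hb⟩ := hb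
  have := PolyTime.iter (s := fun c k => Data.cons (un k) (s c k)) hn (PolyTime.nil.cons h0) ?_
    ⟨fun c => 2 * n c + 1 + f c + 1,
      ((((PolyBound.const 2).mul hn.un_bound).add (.const 1)).add hf).add (.const 1),
      fun c k hk => ?_⟩
  · exact this.snd.congr fun c => by simp
  · exact (PolyTime.nil.cons PolyTime.refl.snd.fst).cons
      (hs.subst id ((PolyTime.refl.fst.cons PolyTime.refl.snd.fst).cons PolyTime.refl.snd.snd))
  · rw [len_un] at hk
    have := hb c k hk
    simp only [Data.size, size_un]
    omega

theorem PolyTime.un_add {a b : Γ → ℕ} (ha : PolyTime e (fun c => un (a c)))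
    (hb : PolyTime e (fun c => un (b c))) : PolyTime e (fun c => un (a c + b c)) := by
  refine (PolyTime.iter (s := fun c k => un (a c + k)) hb ha (PolyTime.nil.cons PolyTime.refl.snd)
    ⟨fun c => 2 * (a c + b c) + 1,
      ((PolyBound.const 2).mul (ha.un_bound.add hb.un_bound)).add (.const 1), fun c k hk => ?_⟩).congr
    fun c => by simp
  rw [len_un] at hk
  simp only [size_un]
  omega

theorem PolyTime.bin_len {a : Γ → ℕ} (ha : PolyTime e (fun c => bin (a c))) :
    PolyBound e (fun c => (bin (a c)).len) :=
  ha.bound.mono fun _ => len_le_size _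

-- Pushing the digit `0` onto the number `0` must give the atom again, otherwise the numeral would
-- have a leading zero.
open Classical in
theorem PolyTime.bin_push {p : Γ → Prop} {a : Γ → ℕ} (hp : PolyTime e (fun c => bit (p c)))
    (ha : PolyTime e (fun c => bin (a c))) :
    PolyTime e (fun c => bin ((if p c then 1 else 0) + 2 * a c)) := by
  refine ((hp.or ha.bit_ne_nil).ite (hp.cons ha) .nil).congr fun c => ?_
  simp only [Ne, bin_eq_nil]
  by_cases h : p c
  · rw [if_pos (Or.inl h), if_pos h, bin_pos (n := 1 + 2 * a c) (by omega)]
    rw [show (1 + 2 * a c) / 2 = a c by omega]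
    congr 2
    simp [h]
  · by_cases h' : a c = 0
    · simp [h, h']
    · rw [if_pos (Or.inr h'), if_neg h, bin_pos (n := 0 + 2 * a c) (by omega)]
      rw [show (0 + 2 * a c) / 2 = a c by omega]
      congr 2
      simp [h]

/-- Input numerals may have leading zeros and arbitrary trees as the digit one. They are rebuilt in
canonical form, from the most significant digit down. -/
theorem PolyTime.toNat (hF : PolyTime e F) : PolyTime e (fun c => bin (F c).toNat) := by
  refine PolyTime.recDown (n := fun c => (F c).len) (S := fun c k => bin (Data.drop k (F c)).toNat)
    hF.un_len (PolyTime.nil.congr fun c => ?_) ?_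
    ⟨fun c => 4 * (F c).size + 1, ((PolyBound.const 4).mul hF.bound).add (.const 1),
      fun c k hk => ?_⟩
  · rw [eq_nil_iff_len.2 (by rw [len_drop]; omega : (Data.drop (F c).len (F c)).len = 0)]
    simp [Data.toNat]
  · have h1 := ((hF.weak (n := fun c => (F c).len)).nth PolyTime.idx).bit_ne_nil
    refine (PolyTime.bin_push (h1.lift)
      (a := fun p => (Data.drop (p.2 + 1) (F p.1)).toNat) PolyTime.refl.snd).congr ?_
    rintro ⟨c, i⟩
    have h2 := len_drop i (F c)
    simp only [drop_succ]
    obtain ⟨a, b, h3⟩ : ∃ a b, Data.drop i (F c) = Data.cons a b := by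
      cases h3 : Data.drop i (F c) with
      | nil => rw [h3] at h2; have := i.2; simp at h2; omega
      | cons a b => exact ⟨a, b, rfl⟩
    have h4 : Data.nth i (F c) = a := by rw [Data.nth, h3, fst_cons]
    rw [h3, snd_cons]
    split_ifs with h <;> rw [h4] at h
    · simp [Data.toNat, h]
    · simp [Data.toNat, not_not.1 h]
  · have h1 := len_drop k (F c)
    have h2 := len_le_size (F c)
    have := size_bin_le_of_lt (toNat_lt (Data.drop k (F c)))
    show _ ≤ 4 * _ + 1
    omega

/-- The carry into position `k` is the truth value of `2 ^ k ≤ a % 2 ^ k + b % 2 ^ k`; the next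
carry is the majority of two digits and this carry. -/
theorem carry_step (a b k : ℕ) :
    2 ^ (k + 1) ≤ a % 2 ^ (k + 1) + b % 2 ^ (k + 1) ↔
      (a / 2 ^ k % 2 = 1 ∧ b / 2 ^ k % 2 = 1) ∨
      ((a / 2 ^ k % 2 = 1 ∨ b / 2 ^ k % 2 = 1) ∧ 2 ^ k ≤ a % 2 ^ k + b % 2 ^ k) := by
  rw [Nat.mod_pow_succ, Nat.mod_pow_succ, pow_succ]
  have h1 := Nat.mod_lt a (show 0 < 2 ^ k by positivity)
  have h2 := Nat.mod_lt b (show 0 < 2 ^ k by positivity)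
  rcases Nat.mod_two_eq_zero_or_one (a / 2 ^ k) with h3 | h3 <;>
  rcases Nat.mod_two_eq_zero_or_one (b / 2 ^ k) with h4 | h4 <;>
  rw [h3, h4] <;> simp <;> omega

theorem PolyTime.bin_carry {a b j : Γ → ℕ} (ha : PolyTime e (fun c => bin (a c)))
    (hb : PolyTime e (fun c => bin (b c))) (hj : PolyTime e (fun c => un (j c))) :
    PolyTime e (fun c => bit (2 ^ j c ≤ a c % 2 ^ j c + b c % 2 ^ j c)) := by
  refine PolyTime.recUp (s := fun c k => bit (2 ^ k ≤ a c % 2 ^ k + b c % 2 ^ k)) hj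
    (PolyTime.nil.congr fun c => ?_) ?_ ⟨_, .const 3, fun c k _ => size_bit_le _⟩
  · symm; rw [bit_eq_nil]; simp [Nat.mod_one]
  · have hA := (((ha.subst Prod.fst PolyTime.refl.fst.fst).nth
      (i := Prod.snd) PolyTime.refl.fst.snd).congr fun c => nth_bin _ _ :
      PolyTime (fun p : Γ × ℕ => Data.cons (Data.cons (e p.1) (un p.2))
        (bit (2 ^ p.2 ≤ a p.1 % 2 ^ p.2 + b p.1 % 2 ^ p.2))) _)
    have hB := (((hb.subst Prod.fst PolyTime.refl.fst.fst).nth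
      (i := Prod.snd) PolyTime.refl.fst.snd).congr fun c => nth_bin _ _ :
      PolyTime (fun p : Γ × ℕ => Data.cons (Data.cons (e p.1) (un p.2))
        (bit (2 ^ p.2 ≤ a p.1 % 2 ^ p.2 + b p.1 % 2 ^ p.2))) _)
    exact ((hA.and hB).or ((hA.or hB).and PolyTime.refl.snd)).bit_iff fun p =>
      (carry_step _ _ _).symm

-- The digit of the sum is the parity of two digits and the carry, spelled out as "all three, or
-- exactly one".
open Classical in
theorem add_step (a b k : ℕ) :
    (if ((a / 2 ^ k % 2 = 1 ∧ b / 2 ^ k % 2 = 1) ∧ 2 ^ k ≤ a % 2 ^ k + b % 2 ^ k) ∨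
      (¬ (a / 2 ^ k % 2 = 1 ∧ b / 2 ^ k % 2 = 1) ∧
        ¬ ((a / 2 ^ k % 2 = 1 ∨ b / 2 ^ k % 2 = 1) ∧ 2 ^ k ≤ a % 2 ^ k + b % 2 ^ k) ∧
        ((a / 2 ^ k % 2 = 1 ∨ b / 2 ^ k % 2 = 1) ∨ 2 ^ k ≤ a % 2 ^ k + b % 2 ^ k)) then 1 else 0) +
      2 * ((a + b) / 2 ^ (k + 1)) = (a + b) / 2 ^ k := by
  have h0 : (0 : ℕ) < 2 ^ k := by positivity
  rw [pow_succ, ← Nat.div_div_eq_div_mul, Nat.add_div h0]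
  rcases Nat.mod_two_eq_zero_or_one (a / 2 ^ k) with h3 | h3 <;>
  rcases Nat.mod_two_eq_zero_or_one (b / 2 ^ k) with h4 | h4 <;>
  by_cases h5 : 2 ^ k ≤ a % 2 ^ k + b % 2 ^ k <;>
  simp only [h3, h4, h5] <;> simp <;> omega

theorem PolyTime.bin_add {a b : Γ → ℕ} (ha : PolyTime e (fun c => bin (a c)))
    (hb : PolyTime e (fun c => bin (b c))) : PolyTime e (fun c => bin (a c + b c)) := by
  let n : Γ → ℕ := fun c => (bin (a c)).len + (bin (b c)).len + 1
  have hlt : ∀ c, a c + b c < 2 ^ n c := fun c => by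
    have h1 := lt_pow_len_bin (a c)
    have h2 := lt_pow_len_bin (b c)
    have h3 : 2 ^ (bin (a c)).len ≤ 2 ^ ((bin (a c)).len + (bin (b c)).len) :=
      Nat.pow_le_pow_right (by norm_num) (by omega)
    have h4 : 2 ^ (bin (b c)).len ≤ 2 ^ ((bin (a c)).len + (bin (b c)).len) :=
      Nat.pow_le_pow_right (by norm_num) (by omega)
    simp only [n, pow_succ]
    omega
  have hn : PolyTime e (fun c => un (n c)) := (ha.un_len.un_add hb.un_len).un_add (.const (un 1))
  refine (PolyTime.recDown (S := fun c k => bin ((a c + b c) / 2 ^ k)) hn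
    (PolyTime.nil.congr fun c => ?_) ?_ ⟨fun c => 4 * n c + 1,
      ((PolyBound.const 4).mul hn.un_bound).add (.const 1), fun c k _ => ?_⟩).congr fun c => by simp
  · rw [Nat.div_eq_of_lt (hlt c)]; simp
  · have hA := (((ha.weak (n := n)).nth PolyTime.idx).congr fun c => nth_bin _ _)
    have hB := (((hb.weak (n := n)).nth PolyTime.idx).congr fun c => nth_bin _ _)
    have hC := (ha.weak (n := n)).bin_carry hb.weak PolyTime.idx
    refine (PolyTime.bin_push ((((hA.and hB).and hC).or ((hA.and hB).not.and
      (((hA.or hB).and hC).not.and ((hA.or hB).or hC)))).lift)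
      (a := fun p => (a p.1 + b p.1) / 2 ^ ((p.2 : ℕ) + 1)) PolyTime.refl.snd).congr ?_
    rintro ⟨c, i⟩
    exact congrArg bin (by convert add_step (a c) (b c) i)
  · exact size_bin_le_of_lt ((Nat.div_le_self _ _).trans_lt (hlt c))

theorem PolyTime.bin_mul {a b : Γ → ℕ} (ha : PolyTime e (fun c => bin (a c)))
    (hb : PolyTime e (fun c => bin (b c))) : PolyTime e (fun c => bin (a c * b c)) := by
  classical
  -- Horner's scheme in the digits of `b`: double the product, and add `a` if the digit is one.
  refine (PolyTime.recDown (S := fun c k => bin (a c * (b c / 2 ^ k))) hb.un_len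
    (PolyTime.nil.congr fun c => ?_) ?_
    ⟨fun c => 4 * ((bin (a c)).len + (bin (b c)).len) + 1,
      ((PolyBound.const 4).mul (ha.bin_len.add hb.bin_len)).add (.const 1), fun c k _ => ?_⟩).congr
    fun c => by simp
  · rw [Nat.div_eq_of_lt (lt_pow_len_bin _)]; simp
  · have hB := (((hb.weak (n := fun c => (bin (b c)).len)).nth PolyTime.idx).congr
      fun c => nth_bin _ _)
    have h1 := PolyTime.bin_push (p := fun _ => False)
      (a := fun p : (c : Γ) × Fin (bin (b c)).len => a p.1 * (b p.1 / 2 ^ ((p.2 : ℕ) + 1)))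
      (e := fun p => Data.cons (ext e (fun c => (bin (b c)).len) p)
        (bin (a p.1 * (b p.1 / 2 ^ ((p.2 : ℕ) + 1)))))
      (PolyTime.nil.congr fun _ => (bit_eq_nil.2 id).symm) PolyTime.refl.snd
    have h2 := (hB.lift).ite (h1.bin_add (ha.weak.lift))
      h1
    refine h2.congr ?_
    rintro ⟨c, i⟩
    simp only [if_false, zero_add]
    rw [pow_succ, ← Nat.div_div_eq_div_mul]
    set y := b c / 2 ^ (i : ℕ)
    split_ifs with h
    · congr 1
      obtain ⟨z, hz⟩ : ∃ z, y = 2 * z + 1 := ⟨y / 2, by omega⟩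
      rw [hz, show (2 * z + 1) / 2 = z by omega]
      ring
    · congr 1
      obtain ⟨z, hz⟩ : ∃ z, y = 2 * z := ⟨y / 2, by omega⟩
      rw [hz, show (2 * z) / 2 = z by omega]
      ring
  · refine size_bin_le_of_lt ?_
    rw [pow_add]
    exact Nat.mul_lt_mul'' (lt_pow_len_bin _) ((Nat.div_le_self _ _).trans_lt (lt_pow_len_bin _))

/-- The leading digit decides a comparison unless it is the same on both sides. -/
theorem le_step (a b k : ℕ) :
    a % 2 ^ (k + 1) ≤ b % 2 ^ (k + 1) ↔
      (¬ a / 2 ^ k % 2 = 1 ∧ b / 2 ^ k % 2 = 1) ∨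
      ((¬ a / 2 ^ k % 2 = 1 ∨ b / 2 ^ k % 2 = 1) ∧ a % 2 ^ k ≤ b % 2 ^ k) := by
  rw [Nat.mod_pow_succ, Nat.mod_pow_succ]
  have h1 := Nat.mod_lt a (show 0 < 2 ^ k by positivity)
  have h2 := Nat.mod_lt b (show 0 < 2 ^ k by positivity)
  rcases Nat.mod_two_eq_zero_or_one (a / 2 ^ k) with h3 | h3 <;>
  rcases Nat.mod_two_eq_zero_or_one (b / 2 ^ k) with h4 | h4 <;>
  rw [h3, h4] <;> simp <;> omega

theorem PolyTime.bin_le {a b : Γ → ℕ} (ha : PolyTime e (fun c => bin (a c)))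
    (hb : PolyTime e (fun c => bin (b c))) : PolyTime e (fun c => bit (a c ≤ b c)) := by
  refine (PolyTime.recUp (s := fun c k => bit (a c % 2 ^ k ≤ b c % 2 ^ k))
    (ha.un_len.un_add hb.un_len) ((PolyTime.const (bit True)).bit_iff fun c => by simp [Nat.mod_one])
    ?_ ⟨_, .const 3, fun c k _ => size_bit_le _⟩).bit_iff fun c => ?_
  · have hA := (((ha.subst Prod.fst PolyTime.refl.fst.fst).nth
      (i := Prod.snd) PolyTime.refl.fst.snd).congr fun c => nth_bin _ _ :
      PolyTime (fun p : Γ × ℕ => Data.cons (Data.cons (e p.1) (un p.2))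
        (bit (a p.1 % 2 ^ p.2 ≤ b p.1 % 2 ^ p.2))) _)
    have hB := (((hb.subst Prod.fst PolyTime.refl.fst.fst).nth
      (i := Prod.snd) PolyTime.refl.fst.snd).congr fun c => nth_bin _ _ :
      PolyTime (fun p : Γ × ℕ => Data.cons (Data.cons (e p.1) (un p.2))
        (bit (a p.1 % 2 ^ p.2 ≤ b p.1 % 2 ^ p.2))) _)
    exact ((hA.not.and hB).or ((hA.not.or hB).and PolyTime.refl.snd)).bit_iff fun p =>
      (le_step _ _ _).symm
  · have h1 := lt_pow_len_bin (a c)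
    have h2 := lt_pow_len_bin (b c)
    rw [Nat.mod_eq_of_lt (h1.trans_le (Nat.pow_le_pow_right (by norm_num) (by omega))),
      Nat.mod_eq_of_lt (h2.trans_le (Nat.pow_le_pow_right (by norm_num) (by omega)))]

theorem PolyTime.bin_un {a : Γ → ℕ} (ha : PolyTime e (fun c => un (a c))) :
    PolyTime e (fun c => bin (a c)) := by
  refine (PolyTime.iter (s := fun _ k => bin k) ha (PolyTime.nil.congr fun c => by simp)
    (PolyTime.refl.snd.bin_add (a := fun p : Γ × ℕ => p.2) (b := fun _ => 1) (.const (bin 1)))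
    ⟨fun c => 4 * a c + 1, ((PolyBound.const 4).mul ha.un_bound).add (.const 1),
      fun c k hk => ?_⟩).congr fun c => by simp
  rw [len_un] at hk
  have := size_bin_le_of_lt (Nat.lt_two_pow_self (n := k))
  show _ ≤ 4 * _ + 1
  omega

theorem PolyTime.un_le {a b : Γ → ℕ} (ha : PolyTime e (fun c => un (a c)))
    (hb : PolyTime e (fun c => un (b c))) : PolyTime e (fun c => bit (a c ≤ b c)) :=
  ha.bin_un.bin_le hb.bin_un

theorem PolyTime.un_lt {a b : Γ → ℕ} (ha : PolyTime e (fun c => un (a c)))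
    (hb : PolyTime e (fun c => un (b c))) : PolyTime e (fun c => bit (a c < b c)) :=
  (hb.un_le ha).not.bit_iff fun _ => not_le

theorem PolyTime.un_eq {a b : Γ → ℕ} (ha : PolyTime e (fun c => un (a c)))
    (hb : PolyTime e (fun c => un (b c))) : PolyTime e (fun c => bit (a c = b c)) :=
  ((ha.un_le hb).and (hb.un_le ha)).bit_iff fun _ => le_antisymm_iff.symm

theorem PolyTime.bin_two_pow {a : Γ → ℕ} (ha : PolyTime e (fun c => un (a c))) :
    PolyTime e (fun c => bin (2 ^ a c)) := by
  refine (PolyTime.iter (s := fun _ k => bin (2 ^ k)) ha (.const (bin 1))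
    ((PolyTime.refl.snd.bin_mul (a := fun p : Γ × ℕ => 2 ^ p.2) (b := fun _ => 2) (.const (bin 2))).congr
      fun p => by rw [pow_succ])
    ⟨fun c => 4 * (a c + 1) + 1,
      ((PolyBound.const 4).mul (ha.un_bound.add (.const 1))).add (.const 1),
      fun c k hk => ?_⟩).congr fun c => by simp
  rw [len_un] at hk
  exact size_bin_le_of_lt (Nat.pow_lt_pow_right (by norm_num) (by omega))

/-! ## Rational arithmetic -/

/-- A fraction in binary. -/
noncomputable def frac (a b : ℕ) : Data := Data.cons (Data.cons Data.nil (bin a)) (bin b)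

/-- Some fraction with the value `q` is computed in polynomial time. -/
def PolyTimeRat (e : Γ → Data) (q : Γ → ℚ) : Prop :=
  ∃ a b : Γ → ℕ, (∀ c, b c ≠ 0) ∧ (∀ c, q c = (a c : ℚ) / (b c : ℚ)) ∧
    PolyTime e (fun c => frac (a c) (b c))

theorem PolyTimeRat.mk {q : Γ → ℚ} {a b : Γ → ℕ} (ha : PolyTime e (fun c => bin (a c)))
    (hb : PolyTime e (fun c => bin (b c))) (h0 : ∀ c, b c ≠ 0)
    (hq : ∀ c, q c = (a c : ℚ) / (b c : ℚ)) : PolyTimeRat e q :=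
  ⟨a, b, h0, hq, (PolyTime.nil.cons ha).cons hb⟩

theorem PolyTimeRat.subst {Γ' : Type} {e' : Γ' → Data} {q : Γ → ℚ} (h : PolyTimeRat e q)
    (π : Γ' → Γ) (hπ : PolyTime e' (fun g => e (π g))) : PolyTimeRat e' (fun g => q (π g)) := by
  obtain ⟨a, b, h0, hq, h⟩ := h
  exact ⟨_, _, fun g => h0 (π g), fun g => hq (π g), h.subst π hπ⟩

theorem PolyTimeRat.congr {q r : Γ → ℚ} (h : PolyTimeRat e q) (hr : ∀ c, q c = r c) :
    PolyTimeRat e r := by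
  rwa [← funext hr]

theorem PolyTimeRat.weak {n : Γ → ℕ} {q : Γ → ℚ} (h : PolyTimeRat e q) :
    PolyTimeRat (ext e n) (fun p => q p.1) :=
  h.subst Sigma.fst PolyTime.base

theorem PolyTimeRat.parts {q : Γ → ℚ} (h : PolyTimeRat e q) : ∃ a b : Γ → ℕ, (∀ c, b c ≠ 0) ∧
    (∀ c, q c = (a c : ℚ) / (b c : ℚ)) ∧ PolyTime e (fun c => bin (a c)) ∧
    PolyTime e (fun c => bin (b c)) := by
  obtain ⟨a, b, h0, hq, h⟩ := h
  exact ⟨a, b, h0, hq, h.fst.snd, h.snd⟩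

theorem PolyTimeRat.nat {a : Γ → ℕ} (ha : PolyTime e (fun c => un (a c))) :
    PolyTimeRat e (fun c => (a c : ℚ)) :=
  .mk ha.bin_un (.const (bin 1)) (b := fun _ => 1) (by simp) (by simp)

theorem PolyTimeRat.add {q r : Γ → ℚ} (hq : PolyTimeRat e q) (hr : PolyTimeRat e r) :
    PolyTimeRat e (fun c => q c + r c) := by
  obtain ⟨a, b, h0, h1, ha, hb⟩ := hq.parts
  obtain ⟨a', b', h0', h1', ha', hb'⟩ := hr.parts
  refine .mk ((ha.bin_mul hb').bin_add (hb.bin_mul ha')) (hb.bin_mul hb')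
    (fun c => mul_ne_zero (h0 c) (h0' c)) fun c => ?_
  have := h0 c
  have := h0' c
  rw [h1, h1']
  push_cast
  field_simp

theorem PolyTimeRat.mul {q r : Γ → ℚ} (hq : PolyTimeRat e q) (hr : PolyTimeRat e r) :
    PolyTimeRat e (fun c => q c * r c) := by
  obtain ⟨a, b, h0, h1, ha, hb⟩ := hq.parts
  obtain ⟨a', b', h0', h1', ha', hb'⟩ := hr.parts
  refine .mk (ha.bin_mul ha') (hb.bin_mul hb') (fun c => mul_ne_zero (h0 c) (h0' c)) fun c => ?_
  have := h0 c
  have := h0' c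
  rw [h1, h1']
  push_cast
  field_simp

theorem PolyTimeRat.div {q r : Γ → ℚ} (hq : PolyTimeRat e q) (hr : PolyTimeRat e r)
    (hr0 : ∀ c, r c ≠ 0) : PolyTimeRat e (fun c => q c / r c) := by
  obtain ⟨a, b, h0, h1, ha, hb⟩ := hq.parts
  obtain ⟨a', b', h0', h1', ha', hb'⟩ := hr.parts
  have ha0 : ∀ c, a' c ≠ 0 := fun c h => hr0 c (by rw [h1', h]; simp)
  refine .mk (ha.bin_mul hb') (hb.bin_mul ha') (fun c => mul_ne_zero (h0 c) (ha0 c)) fun c => ?_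
  have := h0 c
  have := h0' c
  have := ha0 c
  rw [h1, h1']
  push_cast
  field_simp

theorem PolyTimeRat.le {q r : Γ → ℚ} (hq : PolyTimeRat e q) (hr : PolyTimeRat e r) :
    PolyTime e (fun c => bit (q c ≤ r c)) := by
  obtain ⟨a, b, h0, h1, ha, hb⟩ := hq.parts
  obtain ⟨a', b', h0', h1', ha', hb'⟩ := hr.parts
  refine ((ha.bin_mul hb').bin_le (ha'.bin_mul hb)).bit_iff fun c => ?_
  have h2 : (0 : ℚ) < b c := by exact_mod_cast Nat.pos_of_ne_zero (h0 c)
  have h3 : (0 : ℚ) < b' c := by exact_mod_cast Nat.pos_of_ne_zero (h0' c)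
  rw [h1, h1', div_le_div_iff₀ h2 h3]
  norm_cast

theorem PolyTimeRat.lt {q r : Γ → ℚ} (hq : PolyTimeRat e q) (hr : PolyTimeRat e r) :
    PolyTime e (fun c => bit (q c < r c)) :=
  (hr.le hq).not.bit_iff fun _ => not_le

theorem PolyTimeRat.eq {q r : Γ → ℚ} (hq : PolyTimeRat e q) (hr : PolyTimeRat e r) :
    PolyTime e (fun c => bit (q c = r c)) :=
  ((hq.le hr).and (hr.le hq)).bit_iff fun _ => le_antisymm_iff.symm

open Classical in
theorem PolyTimeRat.ite {p : Γ → Prop} {q r : Γ → ℚ} (hp : PolyTime e (fun c => bit (p c)))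
    (hq : PolyTimeRat e q) (hr : PolyTimeRat e r) :
    PolyTimeRat e (fun c => if p c then q c else r c) := by
  obtain ⟨a, b, h0, h1, h⟩ := hq
  obtain ⟨a', b', h0', h1', h'⟩ := hr
  refine ⟨fun c => if p c then a c else a' c, fun c => if p c then b c else b' c, fun c => ?_,
    fun c => ?_, (hp.ite h h').congr fun c => ?_⟩
  · dsimp only; split_ifs; exacts [h0 c, h0' c]
  · dsimp only; split_ifs; exacts [h1 c, h1' c]
  · dsimp only; split_ifs <;> rfl

theorem PolyTimeRat.min {q r : Γ → ℚ} (hq : PolyTimeRat e q) (hr : PolyTimeRat e r) :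
    PolyTimeRat e (fun c => min (q c) (r c)) :=
  (PolyTimeRat.ite (hq.le hr) hq hr).congr fun c => by rw [min_def]; congr

/-- Selection of a rational value that is determined by a property of an index. -/
theorem PolyTimeRat.sel {n : Γ → ℕ} {p : (c : Γ) → Fin (n c) → Prop} {r : (c : Γ) → Fin (n c) → ℚ}
    {q : Γ → ℚ} (hn : PolyTime e (fun c => un (n c)))
    (hp : PolyTime (ext e n) (fun x => bit (p x.1 x.2)))
    (hr : PolyTimeRat (ext e n) (fun x => r x.1 x.2)) (hex : ∀ c, ∃ i, p c i)
    (hq : ∀ c i, p c i → q c = r c i) : PolyTimeRat e q := by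
  obtain ⟨a, b, h0, h1, h⟩ := hr
  obtain ⟨i, hi, hF⟩ := PolyTime.sel (g := fun c i => frac (a ⟨c, i⟩) (b ⟨c, i⟩)) hn hp h hex
  exact ⟨fun c => a ⟨c, i c⟩, fun c => b ⟨c, i c⟩, fun c => h0 _,
    fun c => (hq c _ (hi c)).trans (h1 ⟨c, i c⟩), hF⟩

end

end Sched

namespace Sched

/-! ## Clustering of jobs

Every job `v` comes with a set `M v` of machines, and the sets shrink along an order on the jobs.
The jobs are assigned to machines in rounds, such that a job never depends on a job that runs on
another machine in the same round. -/

namespace Clustering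

open Classical in
/-- The number of elements with a given property. -/
noncomputable def num {n : ℕ} (p : Fin n → Prop) : ℕ := (Finset.univ.filter p).card

theorem num_eq {n : ℕ} (p : Fin n → Prop) [DecidablePred p] :
    num p = (Finset.univ.filter p).card := by
  unfold num; congr

theorem num_mono {n : ℕ} {p q : Fin n → Prop} (h : ∀ v, p v → q v) : num p ≤ num q := by
  classical
  exact Finset.card_le_card fun v => by simpa using h v

theorem num_pos {n : ℕ} {p : Fin n → Prop} : 0 < num p ↔ ∃ v, p v := by
  classical
  simp [num, Finset.card_pos, Finset.Nonempty]

theorem num_le {n : ℕ} (p : Fin n → Prop) : num p ≤ n := by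
  classical
  simpa [num_eq] using Finset.card_le_univ (Finset.univ.filter p)

theorem num_or_le {n : ℕ} (p q : Fin n → Prop) : num (fun v => p v ∨ q v) ≤ num p + num q := by
  classical
  simp only [num_eq]
  rw [Finset.filter_or]
  exact Finset.card_union_le _ _

theorem num_add_num {n : ℕ} {p q : Fin n → Prop} (h : ∀ v, p v → ¬ q v) :
    num p + num q = num (fun v => p v ∨ q v) := by
  classical
  simp only [num_eq]
  rw [Finset.filter_or, Finset.card_union_of_disjoint]
  rw [Finset.disjoint_filter]
  exact fun v _ => h v

section defs

variable {n m : ℕ} (lt : Fin n → Fin n → Prop) (M : Fin n → Fin m → Prop)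

/-- The reflexive closure. -/
def le (u v : Fin n) : Prop := u = v ∨ lt u v

/-- Balls for the relation "has a common lower bound in `Q`". -/
def ball (Q : Fin n → Prop) (u : Fin n) : ℕ → Fin n → Prop
  | 0 => fun v => v = u
  | k + 1 => fun w => Q w ∧ ∃ x, ball Q u k x ∧ ∃ a, Q a ∧ le lt a x ∧ le lt a w

/-- The jobs below the part of a ball that may run on machine `i`. -/
def cluster (Q : Fin n → Prop) (u : Fin n) (k : ℕ) (i : Fin m) (w : Fin n) : Prop :=
  Q w ∧ ∃ v, (ball lt Q u k v ∧ M v i) ∧ le lt w v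

/-- The jobs above a cluster. -/
def blocked (Q : Fin n → Prop) (u : Fin n) (k : ℕ) (i : Fin m) (w : Fin n) : Prop :=
  Q w ∧ ∃ s, cluster lt M Q u k i s ∧ le lt s w

/-- The cluster is a constant fraction of the jobs that it blocks. -/
def good (Q : Fin n → Prop) (u : Fin n) (k : Fin n) (i : Fin m) : Prop :=
  (∃ w, cluster lt M Q u k i w) ∧
    num (blocked lt M Q u k i) ≤ 4 * num (cluster lt M Q u k i)

/-- The first good triple. -/
def pick (Q : Fin n → Prop) (u : Fin n) (k : Fin n) (i : Fin m) : Prop :=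
  good lt M Q u k i ∧ (∀ u', (∃ k' i', good lt M Q u' k' i') → u ≤ u') ∧
    (∀ k', (∃ i', good lt M Q u k' i') → k ≤ k') ∧ ∀ i', good lt M Q u k i' → i ≤ i'

/-- The number of doublings below `n`, twice. -/
noncomputable def scale (n : ℕ) : ℕ := num (fun k : Fin n => 2 ^ (k : ℕ) ≤ n) +
  num (fun k : Fin n => 2 ^ (k : ℕ) ≤ n)

/-- The number of machines for `v` is close to `μ`. -/
def wide (μ : ℕ) (v : Fin n) : Prop := μ * scale n ≤ num (M v) * scale n + μ

/-- States of the clustering algorithm. -/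
structure State (n m : ℕ) where
  active : Fin n → Prop
  home : Fin n → Fin m → Prop
  round : Fin n → ℕ
  width : ℕ
  rounds : ℕ

namespace State

variable (s : State n m)

/-- The job has not been assigned to a machine. -/
def Free (v : Fin n) : Prop := ∀ i, ¬ s.home v i

open Classical in
/-- The width of the next round. -/
noncomputable def nextWidth : ℕ :=
  if ∃ v, s.Free v ∧ wide M s.width v then s.width
  else num fun k : Fin m => ∃ v, s.Free v ∧ (k : ℕ) < num (M v)

open Classical in
/-- A new round begins if no job is active. -/
noncomputable def refresh : State n m where
  active v := ((∃ w, s.active w) ∧ s.active v) ∨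
    ((¬ ∃ w, s.active w) ∧ s.Free v ∧ wide M (s.nextWidth M) v)
  home := s.home
  round := s.round
  width := if ∃ w, s.active w then s.width else s.nextWidth M
  rounds := if ∃ w, s.active w then s.rounds else s.rounds + 1

open Classical in
/-- A good cluster is assigned to its machine. -/
noncomputable def assign : State n m where
  active v := s.active v ∧ ¬ ∃ u k i, pick lt M s.active u k i ∧ blocked lt M s.active u k i v
  home v i := s.home v i ∨ ∃ u k, pick lt M s.active u k i ∧ cluster lt M s.active u k i v
  round v := if ∃ u k i, pick lt M s.active u k i ∧ cluster lt M s.active u k i v then s.rounds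
    else s.round v
  width := s.width
  rounds := s.rounds

open Classical in
/-- One step of the clustering algorithm. -/
noncomputable def step : State n m :=
  if ∃ v, s.Free v then (s.refresh M).assign lt M else s

/-- The initial state. -/
def init (n m : ℕ) : State n m where
  active _ := False
  home _ _ := False
  round _ := 0
  width := m
  rounds := 0

end State

end defs

/-! ### Region growing: existence and choice of a good cluster -/

section good

variable {n m : ℕ} {lt : Fin n → Fin n → Prop} {M : Fin n → Fin m → Prop}

theorem le_trans (htr : ∀ u v w, lt u v → lt v w → lt u w) {u v w : Fin n} (h1 : le lt u v)
    (h2 : le lt v w) : le lt u w := by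
  rcases h1 with rfl | h1
  · exact h2
  · rcases h2 with rfl | h2
    · exact Or.inr h1
    · exact Or.inr (htr _ _ _ h1 h2)

theorem le_mono (hM : ∀ u v i, lt u v → M v i → M u i) {u v : Fin n} {i : Fin m}
    (h : le lt u v) (hv : M v i) : M u i := by
  rcases h with rfl | h
  · exact hv
  · exact hM _ _ _ h hv

theorem ball_sub {Q : Fin n → Prop} {u : Fin n} (hu : Q u) {k : ℕ} {v : Fin n}
    (h : ball lt Q u k v) : Q v := by
  cases k with
  | zero => rw [h]; exact hu
  | succ k => exact h.1

theorem center_mem_ball {Q : Fin n → Prop} {u : Fin n} (hu : Q u) (k : ℕ) : ball lt Q u k u := by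
  induction k with
  | zero => rfl
  | succ k ih => exact ⟨hu, u, ih, u, hu, Or.inl rfl, Or.inl rfl⟩

/-- If every ball of admissible radius more than doubled, the balls would have at least `2 ^ k`
elements for all `k`, which is more than `n` when `k = n`. -/
theorem exists_slow_growth (Q : Fin n → Prop) (u : Fin n) :
    ∃ k : Fin n, 2 ^ (k : ℕ) ≤ n ∧ num (ball lt Q u (k + 1)) ≤ 2 * num (ball lt Q u k) := by
  by_contra! h
  have key : ∀ k : ℕ, 2 ^ k ≤ num (ball lt Q u k) := by
    intro k
    induction k with
    | zero => exact num_pos.2 ⟨u, rfl⟩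
    | succ k ih =>
      have h1 := ih.trans (num_le _)
      have := h ⟨k, Nat.lt_two_pow_self.trans_le h1⟩ h1
      dsimp only at this
      rw [pow_succ]
      omega
  exact absurd ((key n).trans (num_le _)) (by simpa using Nat.lt_two_pow_self)

/-- The number of admissible radii is half of `scale n`; the radius is below it by at least one, and
the estimate in `exists_good` needs this one. -/
theorem succ_le_num_two_pow {k : Fin n} (hk : 2 ^ (k : ℕ) ≤ n) :
    (k : ℕ) + 1 ≤ num (fun k : Fin n => 2 ^ (k : ℕ) ≤ n) := by
  classical
  have : (Finset.Iic k).card ≤ num (fun k : Fin n => 2 ^ (k : ℕ) ≤ n) := by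
    refine Finset.card_le_card fun j hj => ?_
    simp only [Finset.mem_Iic] at hj
    simp only [Finset.mem_filter, Finset.mem_univ, true_and]
    exact (Nat.pow_le_pow_right (by norm_num) hj).trans hk
  simpa using this

/-- One hop of the ball loses at most `μ / scale n` machines: both ends `x`, `y` lie above some `a`
in `Q`, so `M x` and `M y` are contained in `M a`, which has at most `μ` elements, while `M x` has
at least `μ * (1 - 1 / scale n)`. The inequality is multiplied by `scale n` to stay in `ℕ`. -/
theorem overlap (hM : ∀ u v i, lt u v → M v i → M u i) {Q : Fin n → Prop} {μ : ℕ}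
    (hμ : ∀ v, Q v → num (M v) ≤ μ) (hw : ∀ v, Q v → wide M μ v) {u : Fin n} (k : ℕ)
    {x : Fin n} (hx : ball lt Q u k x) :
    scale n * num (M u) ≤ scale n * num (fun i => M u i ∧ M x i) + k * μ := by
  classical
  induction k generalizing x with
  | zero => rw [show x = u from hx]; simp
  | succ k ih =>
    obtain ⟨hQx, y, hy, a, ha, hay, hax⟩ := hx
    have h1 := ih hy
    have h2 : num (fun i => M u i ∧ M y i) ≤
        num (fun i => M u i ∧ M x i) + num (fun i => M y i ∧ ¬ M x i) :=
      (num_mono fun i hi => by tauto).trans (num_or_le _ _)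
    have h3 : num (fun i => M y i ∧ ¬ M x i) + num (M x) ≤ μ := by
      rw [num_add_num (fun v h => h.2)]
      refine (num_mono fun i hi => ?_).trans (hμ a ha)
      rcases hi with hi | hi
      · exact le_mono hM hay hi.1
      · exact le_mono hM hax hi
    have h4 := hw x hQx
    unfold wide at h4
    have h5 := Nat.mul_le_mul_left (scale n) h2
    have h6 := Nat.mul_le_mul_left (scale n) h3
    rw [mul_add] at h5 h6
    rw [mul_comm μ, mul_comm (num _)] at h4
    rw [add_mul]
    omega

/-- Slow growth controls the blocked jobs, which lie in the ball of the next radius; the overlap of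
machine sets gives a machine that serves half of the ball. The two factors of two give the four in
`good`. -/
theorem exists_good
    (hM : ∀ u v i, lt u v → M v i → M u i) (hne : ∀ v, ∃ i, M v i) {Q : Fin n → Prop} {μ : ℕ}
    (hμ : ∀ v, Q v → num (M v) ≤ μ) (hw : ∀ v, Q v → wide M μ v) (hQ : ∃ u, Q u) :
    ∃ u k i, good lt M Q u k i := by
  classical
  obtain ⟨u, hu⟩ := hQ
  obtain ⟨k, hk, hgrow⟩ := exists_slow_growth (lt := lt) Q u
  have hhalf : ∀ x, ball lt Q u k x → num (M u) ≤ 2 * num (fun i => M u i ∧ M x i) := by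
    intro x hx
    have h1 := overlap hM hμ hw k hx
    have h2 := succ_le_num_two_pow hk
    have h3 := hw u hu
    unfold wide at h3
    unfold scale at h1 h3
    set K := num (fun k : Fin n => 2 ^ (k : ℕ) ≤ n)
    set a := num (M u)
    set b := num (fun i => M u i ∧ M x i)
    by_contra! h
    have h4 : (k : ℕ) * μ + μ ≤ K * μ := by
      calc (k : ℕ) * μ + μ = (k + 1) * μ := by ring
        _ ≤ K * μ := Nat.mul_le_mul_right _ h2
    have h5 : K * (2 * b + 1) ≤ K * a := Nat.mul_le_mul_left _ h
    nlinarith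
  -- Double counting of the pairs (machine of `u`, job of the ball that may run on it): some machine
  -- reaches the average.
  obtain ⟨i, hi, hcount⟩ : ∃ i, M u i ∧
      num (ball lt Q u k) ≤ 2 * num (fun x => ball lt Q u k x ∧ M x i) := by
    have h1 : ∑ i ∈ Finset.univ.filter (M u), num (ball lt Q u k) ≤
        ∑ i ∈ Finset.univ.filter (M u), 2 * num (fun x => ball lt Q u k x ∧ M x i) := by
      have h2 : ∑ i ∈ Finset.univ.filter (M u), num (fun x => ball lt Q u k x ∧ M x i) =
          ∑ x ∈ Finset.univ.filter (ball lt Q u k), num (fun i => M u i ∧ M x i) := by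
        simp only [num_eq, ← Finset.filter_filter]
        exact Finset.sum_card_bipartiteAbove_eq_sum_card_bipartiteBelow (fun i x => M x i)
      rw [← Finset.mul_sum, h2, Finset.mul_sum, Finset.sum_const, smul_eq_mul, mul_comm]
      calc num (ball lt Q u k) * num (M u)
          = ∑ x ∈ Finset.univ.filter (ball lt Q u k), num (M u) := by
            rw [Finset.sum_const, smul_eq_mul]; rfl
        _ ≤ _ := Finset.sum_le_sum fun x hx => hhalf x (by simpa using hx)
    obtain ⟨j, hj⟩ := hne u
    obtain ⟨i, hi, h⟩ := Finset.exists_le_of_sum_le ⟨j, by simpa using hj⟩ h1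
    exact ⟨i, by simpa using hi, h⟩
  refine ⟨u, k, i, ⟨u, hu, u, ⟨center_mem_ball hu k, hi⟩, Or.inl rfl⟩, ?_⟩
  have h1 : num (blocked lt M Q u k i) ≤ num (ball lt Q u (k + 1)) := by
    refine num_mono fun w hw => ?_
    obtain ⟨hQw, s, ⟨hs, v, hv, hsv⟩, hsw⟩ := hw
    exact ⟨hQw, v, hv.1, s, hs, hsv, hsw⟩
  have h2 : num (fun x => ball lt Q u k x ∧ M x i) ≤ num (cluster lt M Q u k i) :=
    num_mono fun x hx => ⟨ball_sub hu hx.1, x, hx, Or.inl rfl⟩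
  omega

theorem exists_pick {Q : Fin n → Prop} (h : ∃ u k i, good lt M Q u k i) :
    ∃ u k i, pick lt M Q u k i := by
  classical
  have least : ∀ {N : ℕ} {p : Fin N → Prop}, (∃ j, p j) → ∃ j, p j ∧ ∀ j', p j' → j ≤ j' := by
    intro N p ⟨j, hj⟩
    obtain ⟨j, h1, h2⟩ := WellFounded.has_min (wellFounded_lt (α := Fin N)) {j | p j} ⟨j, hj⟩
    exact ⟨j, h1, fun j' hj' => not_lt.1 (h2 j' hj')⟩
  obtain ⟨u, hu, hu'⟩ := least h
  obtain ⟨k, hk, hk'⟩ := least hu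
  obtain ⟨i, hi, hi'⟩ := least hk
  exact ⟨u, k, i, hi, hu', hk', hi'⟩

theorem pick_unique {Q : Fin n → Prop} {u u' k k' : Fin n} {i i' : Fin m}
    (h : pick lt M Q u k i) (h' : pick lt M Q u' k' i') : u' = u ∧ k' = k ∧ i' = i := by
  have h1 : u' = u := le_antisymm (h'.2.1 _ ⟨_, _, h.1⟩) (h.2.1 _ ⟨_, _, h'.1⟩)
  subst h1
  have h2 : k' = k := le_antisymm (h'.2.2.1 _ ⟨_, h.1⟩) (h.2.2.1 _ ⟨_, h'.1⟩)
  subst h2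
  exact ⟨rfl, rfl, le_antisymm (h'.2.2.2 _ h.1) (h.2.2.2 _ h'.1)⟩

end good

end Clustering

end Sched

namespace Sched

namespace Clustering

/-! ### Invariant of the clustering and the number of rounds -/

section invariant

variable {n m : ℕ} (lt : Fin n → Fin n → Prop) (M : Fin n → Fin m → Prop)

/-- The invariant of the clustering algorithm. -/
structure State.Inv (s : State n m) : Prop where
  mem : ∀ v i, s.home v i → M v i
  unique : ∀ v i j, s.home v i → s.home v j → i = j
  order : ∀ u v i, lt u v → s.home v i →
    ∃ j, s.home u j ∧ (s.round u < s.round v ∨ (j = i ∧ s.round u ≤ s.round v))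
  round_le : ∀ v i, s.home v i → s.round v ≤ s.rounds
  free : ∀ v, s.active v → s.Free v
  down : ∀ u v, s.active v → lt u v → s.Free u → s.active u
  early : ∀ u v i, s.active v → lt u v → s.home u i → s.round u < s.rounds
  num_le : ∀ v, s.Free v → num (M v) ≤ s.width
  wide : ∀ v, s.active v → wide M s.width v
  width_pos : 1 ≤ s.width

/-- The bound on the number of rounds that is maintained: `j` counts the changes of the width, and
`l` the rounds since the last change. -/
def State.Pot (B : ℝ) (s : State n m) : Prop :=
  ∃ (j l : ℕ) (e : ℝ), (s.rounds : ℝ) ≤ j * B + l ∧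
    (s.width : ℝ) ≤ m * Real.exp (-(j / scale n)) ∧ e ≤ 2 * n * (3 / 4) ^ l ∧ 1 ≤ e ∧
    e ≤ num s.active + 4 * (e - num fun v => s.Free v ∧ Clustering.wide M s.width v)

variable {lt M}

theorem num_lt {a : ℕ} (h : a ≤ m) : num (fun k : Fin m => (k : ℕ) < a) = a := by
  classical
  rw [num_eq]
  simp [Fin.card_filter_val_lt, h]

theorem wide_mono {μ : ℕ} {u v : Fin n} (h : num (M v) ≤ num (M u)) (hv : wide M μ v) :
    wide M μ u := by
  unfold wide at *
  have := Nat.mul_le_mul_right (scale n) h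
  omega

theorem scale_pos (hn : 1 ≤ n) : 0 < scale n := by
  have := (num_pos (p := fun k : Fin n => 2 ^ (k : ℕ) ≤ n)).2 ⟨⟨0, hn⟩, by simpa using hn⟩
  unfold scale
  omega

theorem State.refresh_of_active {s : State n m} (h : ∃ v, s.active v) : s.refresh M = s := by
  cases s
  simp only [State.refresh, if_true, not_true_eq_false, false_and, or_false, h, true_and]

theorem State.refresh_of_not_active {s : State n m} (h : ¬ ∃ v, s.active v) :
    s.refresh M =
      { active := fun v => s.Free v ∧ Clustering.wide M (s.nextWidth M) v
        home := s.home
        round := s.round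
        width := s.nextWidth M
        rounds := s.rounds + 1 } := by
  simp only [State.refresh, if_false, not_false_eq_true, true_and, h, false_and, false_or]

/-- The width of a round is attained if it is new. -/
theorem State.nextWidth_eq {s : State n m} (hfree : ∃ v, s.Free v)
    (h : ¬ ∃ v, s.Free v ∧ Clustering.wide M s.width v) :
    ∃ v, s.Free v ∧ s.nextWidth M = num (M v) ∧ ∀ w, s.Free w → num (M w) ≤ num (M v) := by
  classical
  obtain ⟨v, hv, hmax⟩ := Finset.exists_max_image (Finset.univ.filter s.Free) (fun v => num (M v))
    (by obtain ⟨v, hv⟩ := hfree; exact ⟨v, by simpa using hv⟩)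
  simp only [Finset.mem_filter, Finset.mem_univ, true_and] at hv hmax
  refine ⟨v, hv, ?_, hmax⟩
  -- The maximum is encoded as the number of `k` that lie below some value, so that it is computed
  -- by counting.
  rw [State.nextWidth, if_neg h, ← num_lt (num_le (M v))]
  apply le_antisymm <;> apply num_mono
  · rintro k ⟨w, hw, hk⟩
    exact hk.trans_le (hmax w hw)
  · intro k hk
    exact ⟨v, hv, hk⟩

theorem State.Inv.nextWidth {s : State n m} (hs : s.Inv lt M) (hne : ∀ v, ∃ i, M v i)
    (hfree : ∃ v, s.Free v) : (∀ v, s.Free v → Clustering.num (M v) ≤ s.nextWidth M) ∧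
      1 ≤ s.nextWidth M ∧ ∃ v, s.Free v ∧ Clustering.wide M (s.nextWidth M) v := by
  by_cases h : ∃ v, s.Free v ∧ Clustering.wide M s.width v
  · have : s.nextWidth M = s.width := by rw [State.nextWidth, if_pos h]
    rw [this]
    exact ⟨hs.num_le, hs.width_pos, h⟩
  · obtain ⟨v, hv, h1, h2⟩ := State.nextWidth_eq hfree h
    rw [h1]
    exact ⟨h2, num_pos.2 (hne v), v, hv, by unfold Clustering.wide; omega⟩

/-- The active set of a new round is closed downwards among the free jobs because predecessors have
at least as many machines; everything assigned so far belongs to a strictly earlier round. -/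
theorem State.Inv.refresh {s : State n m} (hs : s.Inv lt M)
    (hM : ∀ u v i, lt u v → M v i → M u i) (hne : ∀ v, ∃ i, M v i) (hfree : ∃ v, s.Free v) :
    (s.refresh M).Inv lt M ∧ ∃ v, (s.refresh M).active v := by
  by_cases h : ∃ v, s.active v
  · rw [State.refresh_of_active h]
    exact ⟨hs, h⟩
  · obtain ⟨h1, h2, h3⟩ := hs.nextWidth hne hfree
    rw [State.refresh_of_not_active h]
    refine ⟨⟨hs.mem, hs.unique, hs.order, fun v i hv => (hs.round_le v i hv).trans (Nat.le_succ _),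
      fun v hv => hv.1, fun u v hv huv hu => ⟨hu, wide_mono (num_mono (hM u v · huv)) hv.2⟩,
      fun u v i _ _ hu => Nat.lt_succ_of_le (hs.round_le u i hu), h1, fun v hv => hv.2, h2⟩, h3⟩

/-- When no job is active, the last inequality of `Pot` says that at most `3 / 4 * e` wide jobs are
left. If some are left, `l` increases and `e` is reset to their number. Otherwise the new maximum is
at most `1 - 1 / scale n ≤ exp (-(1 / scale n))` times the old width, so `j` increases, and its
share `B` pays for the `l` rounds done and the new one. -/
theorem State.Pot.refresh {s : State n m} {B : ℝ} (hs : s.Inv lt M) (hp : s.Pot M B)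
    (hn : 1 ≤ n) (hne : ∀ v, ∃ i, M v i) (hfree : ∃ v, s.Free v)
    (hB : ∀ l : ℕ, (1 : ℝ) ≤ 2 * n * (3 / 4) ^ l → (l : ℝ) + 1 ≤ B) : (s.refresh M).Pot M B := by
  by_cases h : ∃ v, s.active v
  · rwa [State.refresh_of_active h]
  · obtain ⟨h1, h2, h3⟩ := hs.nextWidth hne hfree
    have hpos := num_pos.2 h3
    obtain ⟨j, l, e, hd, hw, he, he1, hQ⟩ := hp
    have hact : num s.active = 0 := by
      by_contra h0
      exact h (num_pos.1 (Nat.pos_of_ne_zero h0))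
    rw [State.refresh_of_not_active h]
    set E : ℕ := num fun v => s.Free v ∧ Clustering.wide M (s.nextWidth M) v with hE
    have hE1 : (1 : ℝ) ≤ E := by exact_mod_cast hpos
    by_cases h' : ∃ v, s.Free v ∧ Clustering.wide M s.width v
    · have hnw : s.nextWidth M = s.width := by rw [State.nextWidth, if_pos h']
      refine ⟨j, l + 1, E, ?_, ?_, ?_, hE1, ?_⟩
      · push_cast; linarith
      · simpa [hnw] using hw
      · rw [← hnw, ← hE, hact] at hQ
        rw [pow_succ]
        push_cast at hQ
        linarith
      · show (E : ℝ) ≤ E + 4 * (E - E)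
        linarith
    · refine ⟨j + 1, 0, E, ?_, ?_, ?_, hE1, ?_⟩
      · have := hB l (he1.trans he)
        push_cast; linarith
      · obtain ⟨v, hv, h4, -⟩ := State.nextWidth_eq hfree h'
        have h5 : ¬ Clustering.wide M s.width v := fun hh => h' ⟨v, hv, hh⟩
        unfold Clustering.wide at h5
        rw [← h4] at h5
        have h6 : (s.nextWidth M : ℝ) * scale n + s.width ≤ s.width * scale n := by
          exact_mod_cast (not_le.1 h5).le
        have hS : (0 : ℝ) < scale n := by exact_mod_cast scale_pos hn
        have h7 : (s.nextWidth M : ℝ) ≤ s.width * (-(1 / scale n) + 1) := by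
          have : (s.width : ℝ) * (-(1 / scale n) + 1) = (s.width * scale n - s.width) / scale n := by
            field_simp; ring
          rw [this, le_div_iff₀ hS]
          linarith
        show (s.nextWidth M : ℝ) ≤ _
        calc (s.nextWidth M : ℝ) ≤ s.width * (-(1 / scale n) + 1) := h7
          _ ≤ s.width * Real.exp (-(1 / scale n)) := by
            gcongr; exact Real.add_one_le_exp _
          _ ≤ (m * Real.exp (-(j / scale n))) * Real.exp (-(1 / scale n)) := by gcongr
          _ = m * Real.exp (-((j + 1 : ℕ) / scale n)) := by
            rw [mul_assoc, ← Real.exp_add]; congr 2; push_cast; ring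
      · have : (E : ℝ) ≤ n := by exact_mod_cast num_le _
        have : (0 : ℝ) ≤ n := by positivity
        simp only [pow_zero]
        linarith
      · show (E : ℝ) ≤ E + 4 * (E - E)
        linarith

open Classical in
theorem State.assign_eq {s : State n m} {u k : Fin n} {i : Fin m}
    (h : pick lt M s.active u k i) : s.assign lt M =
      { active := fun v => s.active v ∧ ¬ blocked lt M s.active u k i v
        home := fun v j => s.home v j ∨ (j = i ∧ cluster lt M s.active u k i v)
        round := fun v => if cluster lt M s.active u k i v then s.rounds else s.round v
        width := s.width
        rounds := s.rounds } := by
  have h1 : ∀ p : Fin n → Fin n → Fin m → Prop,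
      (∃ u' k' i', pick lt M s.active u' k' i' ∧ p u' k' i') ↔ p u k i := by
    intro p
    constructor
    · rintro ⟨u', k', i', h', hp⟩
      obtain ⟨rfl, rfl, rfl⟩ := pick_unique h h'
      exact hp
    · exact fun hp => ⟨u, k, i, h, hp⟩
  have h2 : ∀ v j, (∃ u' k', pick lt M s.active u' k' j ∧ cluster lt M s.active u' k' j v) ↔
      (j = i ∧ cluster lt M s.active u k i v) := by
    intro v j
    constructor
    · rintro ⟨u', k', h', hp⟩
      obtain ⟨rfl, rfl, rfl⟩ := pick_unique h h'
      exact ⟨rfl, hp⟩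
    · rintro ⟨rfl, hp⟩
      exact ⟨u, k, h, hp⟩
  simp only [State.assign, h1 fun u k i => blocked lt M s.active u k i _,
    h1 fun u k i => cluster lt M s.active u k i _, h2]

/-- The cluster is closed downwards among the active jobs, so a predecessor of a clustered job joins
it or was assigned in an earlier round. The blocked set is closed upwards, so no job that stays
active depends on the cluster. The potential survives because the active set loses at most four
times as many jobs as are assigned. -/
theorem State.Inv.assign {s : State n m} {B : ℝ} (hs : s.Inv lt M) (hp : s.Pot M B)
    (htr : ∀ u v w, lt u v → lt v w → lt u w)
    (hM : ∀ u v i, lt u v → M v i → M u i) (hne : ∀ v, ∃ i, M v i) (hact : ∃ v, s.active v) :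
    (s.assign lt M).Inv lt M ∧ (s.assign lt M).Pot M B ∧
      Clustering.num (s.assign lt M).Free < Clustering.num s.Free := by
  classical
  obtain ⟨u, k, i, h⟩ := exists_pick (exists_good (lt := lt) hM hne
    (fun v hv => hs.num_le v (hs.free v hv)) hs.wide hact)
  rw [State.assign_eq h]
  set S := cluster lt M s.active u k i with hS
  set D := blocked lt M s.active u k i with hD
  have hSactive : ∀ v, S v → s.active v := fun v hv => hv.1
  have hSfree : ∀ v, S v → s.Free v := fun v hv => hs.free v (hSactive v hv)
  have hSM : ∀ v, S v → M v i := by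
    rintro v ⟨_, w, hw, hvw⟩
    exact le_mono hM hvw hw.2
  have hSD : ∀ v, S v → D v := fun v hv => ⟨hv.1, v, hv, Or.inl rfl⟩
  have hhome : ∀ {v j}, s.home v j → ¬ S v := fun hv hSv => hSfree _ hSv _ hv
  have hdown : ∀ {v w}, lt v w → S w → s.active v → S v := by
    rintro v w hvw ⟨_, x, hx, hwx⟩ hv
    exact ⟨hv, x, hx, le_trans htr (Or.inr hvw) hwx⟩
  have hup : ∀ {v w}, lt v w → D v → s.active w → D w := by
    rintro v w hvw ⟨_, x, hx, hxv⟩ hw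
    exact ⟨hw, x, hx, le_trans htr hxv (Or.inr hvw)⟩
  have hfree' : ∀ v, (∀ j, ¬ (s.home v j ∨ (j = i ∧ S v))) ↔ s.Free v ∧ ¬ S v := by
    intro v
    constructor
    · intro hv
      exact ⟨fun j hj => hv j (Or.inl hj), fun hSv => hv i (Or.inr ⟨rfl, hSv⟩)⟩
    · rintro ⟨h1, h2⟩ j (hj | hj)
      · exact h1 j hj
      · exact h2 hj.2
  refine ⟨⟨?_, ?_, ?_, ?_, ?_, ?_, ?_, ?_, ?_, hs.width_pos⟩, ?_, ?_⟩
  · rintro v j (hv | ⟨rfl, hv⟩)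
    · exact hs.mem v j hv
    · exact hSM v hv
  · rintro v j j' (hv | ⟨rfl, hv⟩) (hv' | ⟨rfl, hv'⟩)
    · exact hs.unique v j j' hv hv'
    · exact absurd hv' (hhome hv)
    · exact absurd hv (hhome hv')
    · rfl
  · rintro v w j hvw (hw | ⟨rfl, hw⟩)
    · obtain ⟨j', hj', hr⟩ := hs.order v w j hvw hw
      refine ⟨j', Or.inl hj', ?_⟩
      simpa only [if_neg (hhome hw), if_neg (hhome hj')] using hr
    · by_cases hv : s.Free v
      · have := hdown hvw hw (hs.down v w (hSactive w hw) hvw hv)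
        refine ⟨j, Or.inr ⟨rfl, this⟩, Or.inr ⟨rfl, ?_⟩⟩
        simp only [if_pos this, if_pos hw, le_refl]
      · unfold State.Free at hv
        push Not at hv
        obtain ⟨j', hj'⟩ := hv
        refine ⟨j', Or.inl hj', Or.inl ?_⟩
        simp only [if_neg (hhome hj'), if_pos hw]
        exact hs.early v w j' (hSactive w hw) hvw hj'
  · rintro v j hv
    dsimp only
    split_ifs with hSv
    · exact le_rfl
    · rcases hv with hv | hv
      · exact hs.round_le v j hv
      · exact absurd hv.2 hSv
  · rintro v ⟨hv, hDv⟩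
    exact (hfree' v).2 ⟨hs.free v hv, fun hSv => hDv (hSD v hSv)⟩
  · rintro v w ⟨hw, hDw⟩ hvw hv
    have := hs.down v w hw hvw ((hfree' v).1 hv).1
    exact ⟨this, fun hDv => hDw (hup hvw hDv hw)⟩
  · rintro v w j ⟨hw, hDw⟩ hvw (hv | ⟨rfl, hv⟩)
    · simp only [if_neg (hhome hv)]
      exact hs.early v w j hw hvw hv
    · exact absurd (hup hvw (hSD v hv) hw) hDw
  · intro v hv
    exact hs.num_le v ((hfree' v).1 hv).1
  · intro v hv
    exact hs.wide v hv.1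
  · obtain ⟨j, l, e, hd, hw, he, he1, hQ⟩ := hp
    refine ⟨j, l, e, hd, hw, he, he1, hQ.trans ?_⟩
    have h1 : num s.active ≤ num (fun v => s.active v ∧ ¬ D v) + num D :=
      (num_mono fun v hv => by tauto).trans (num_or_le _ _)
    have h2 : num (fun v => (∀ j, ¬ (s.home v j ∨ (j = i ∧ S v))) ∧ Clustering.wide M s.width v) +
        num S ≤ num fun v => s.Free v ∧ Clustering.wide M s.width v := by
      rw [num_add_num fun v hv => ((hfree' v).1 hv.1).2]
      refine num_mono fun v hv => ?_
      rcases hv with hv | hv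
      · exact ⟨((hfree' v).1 hv.1).1, hv.2⟩
      · exact ⟨hSfree v hv, hs.wide v (hSactive v hv)⟩
    have h3 : num D ≤ 4 * num S := h.1.2
    have h1' : (num s.active : ℝ) ≤ num (fun v => s.active v ∧ ¬ D v) + num D := by
      exact_mod_cast h1
    have h2' : (num (fun v => (∀ j, ¬ (s.home v j ∨ (j = i ∧ S v))) ∧
        Clustering.wide M s.width v) : ℝ) + num S ≤
        num fun v => s.Free v ∧ Clustering.wide M s.width v := by exact_mod_cast h2
    have h3' : (num D : ℝ) ≤ 4 * num S := by exact_mod_cast h3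
    simp only [State.Free] at *
    linarith
  · have h1 := num_pos.2 h.1.1
    have h2 : num (fun v => ∀ j, ¬ (s.home v j ∨ (j = i ∧ S v))) + num S ≤ num s.Free := by
      rw [num_add_num fun v hv => ((hfree' v).1 hv).2]
      refine num_mono fun v hv => ?_
      rcases hv with hv | hv
      · exact ((hfree' v).1 hv).1
      · exact hSfree v hv
    have h3 : 0 < num S := h1
    show num (fun v => ∀ j, ¬ (s.home v j ∨ (j = i ∧ S v))) < num s.Free
    omega

theorem step_spec {s : State n m} {B : ℝ} (hs : s.Inv lt M) (hp : s.Pot M B)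
    (htr : ∀ u v w, lt u v → lt v w → lt u w) (hn : 1 ≤ n)
    (hM : ∀ u v i, lt u v → M v i → M u i) (hne : ∀ v, ∃ i, M v i)
    (hB : ∀ l : ℕ, (1 : ℝ) ≤ 2 * n * (3 / 4) ^ l → (l : ℝ) + 1 ≤ B) :
    (s.step lt M).Inv lt M ∧ (s.step lt M).Pot M B ∧ num (s.step lt M).Free ≤ num s.Free - 1 := by
  by_cases h : ∃ v, s.Free v
  · rw [State.step, if_pos h]
    obtain ⟨h1, h2⟩ := hs.refresh hM hne h
    obtain ⟨h3, h4, h5⟩ := h1.assign (hp.refresh hs hn hne h hB) htr hM hne h2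
    refine ⟨h3, h4, ?_⟩
    have : (s.refresh M).Free = s.Free := rfl
    rw [this] at h5
    omega
  · rw [State.step, if_neg h]
    refine ⟨hs, hp, ?_⟩
    have : num s.Free = 0 := by
      by_contra h0
      exact h (num_pos.1 (Nat.pos_of_ne_zero h0))
    omega

variable (lt M) in
/-- The result of the clustering algorithm. -/
noncomputable def result : State n m := (State.step lt M)^[n] (State.init n m)

/-- Every step assigns at least one free job, so `n` steps leave none. -/
theorem result_spec (htr : ∀ u v w, lt u v → lt v w → lt u w) (hn : 1 ≤ n) (hm : 1 ≤ m)
    (hM : ∀ u v i, lt u v → M v i → M u i) (hne : ∀ v, ∃ i, M v i) {B : ℝ}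
    (hB : ∀ l : ℕ, (1 : ℝ) ≤ 2 * n * (3 / 4) ^ l → (l : ℝ) + 1 ≤ B) :
    (result lt M).Inv lt M ∧ (result lt M).Pot M B ∧ ∀ v, ¬ (result lt M).Free v := by
  have hn' : (1 : ℝ) ≤ n := by exact_mod_cast hn
  have key : ∀ k, ((State.step lt M)^[k] (State.init n m)).Inv lt M ∧
      ((State.step lt M)^[k] (State.init n m)).Pot M B ∧
      num ((State.step lt M)^[k] (State.init n m)).Free ≤ n - k := by
    intro k
    induction k with
    | zero =>
      refine ⟨⟨?_, ?_, ?_, ?_, ?_, ?_, ?_, ?_, ?_, ?_⟩, ?_, num_le _⟩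
      · exact fun _ _ h => h.elim
      · exact fun _ _ _ h => h.elim
      · exact fun _ _ _ _ h => h.elim
      · exact fun _ _ h => h.elim
      · exact fun _ h => h.elim
      · exact fun _ _ h => h.elim
      · exact fun _ _ _ h => h.elim
      · exact fun v _ => num_le _
      · exact fun _ h => h.elim
      · exact hm
      -- Before the first round there is no active set to count. The value `2 * n` exceeds `4 / 3`
      -- of any number of jobs, which is all that the last inequality asks when nothing is active;
      -- hence the factor `2` in `Pot`.
      · refine ⟨0, 0, 2 * n, by simp [State.init], by simp [State.init], by simp, by linarith, ?_⟩
        have h1 := num_le fun v => (State.init n m).Free v ∧ Clustering.wide M (State.init n m).width v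
        have h2 : ((num fun v => (State.init n m).Free v ∧
          Clustering.wide M (State.init n m).width v : ℕ) : ℝ) ≤ n := by exact_mod_cast h1
        have h3 : (0 : ℝ) ≤ num (State.init n m).active := by positivity
        simp only [Function.iterate_zero, id]
        linarith
    | succ k ih =>
      rw [Function.iterate_succ_apply']
      obtain ⟨h1, h2, h3⟩ := step_spec ih.1 ih.2.1 htr hn hM hne hB
      exact ⟨h1, h2, by have := ih.2.2; omega⟩
  refine ⟨(key n).1, (key n).2.1, fun v hv => ?_⟩
  have h1 := num_pos.2 ⟨v, hv⟩
  have := (key n).2.2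
  simp only [result] at h1
  omega

theorem scale_le_logb (hn : 2 ≤ n) : (scale n : ℝ) ≤ 4 * Real.logb 2 n := by
  have h1 : num (fun k : Fin n => 2 ^ (k : ℕ) ≤ n) ≤ Nat.log 2 n + 1 := by
    rw [← num_lt (m := n) (a := Nat.log 2 n + 1) (Nat.log_lt_self 2 (by omega))]
    refine num_mono fun k hk => ?_
    exact Nat.lt_succ_of_le (Nat.le_log_of_pow_le (by norm_num) hk)
  have h2 : (1 : ℝ) ≤ Real.logb 2 n := by
    rw [Real.le_logb_iff_rpow_le (by norm_num) (by positivity)]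
    simpa using (by exact_mod_cast hn : (2 : ℝ) ≤ n)
  have h3 : (Nat.log 2 n : ℝ) ≤ Real.logb 2 n := by exact_mod_cast Real.natLog_le_logb n 2
  have h4 : (scale n : ℝ) ≤ 2 * (Nat.log 2 n + 1) := by
    unfold scale
    exact_mod_cast (by omega)
  linarith

/-- The number of rounds is polylogarithmic. -/
theorem result_rounds_le (htr : ∀ u v w, lt u v → lt v w → lt u w) (hn : 2 ≤ n) (hm : 2 ≤ m)
    (hM : ∀ u v i, lt u v → M v i → M u i) (hne : ∀ v, ∃ i, M v i) :
    ((result lt M).rounds : ℝ) ≤ 45 * (Real.logb 2 n ^ 2 * Real.logb 2 m) := by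
  have hn0 : (2 : ℝ) ≤ n := by exact_mod_cast hn
  have hm0 : (2 : ℝ) ≤ m := by exact_mod_cast hm
  have hL : (1 : ℝ) ≤ Real.logb 2 n := by
    rw [Real.le_logb_iff_rpow_le (by norm_num) (by positivity)]; simpa using hn0
  have hL' : (1 : ℝ) ≤ Real.logb 2 m := by
    rw [Real.le_logb_iff_rpow_le (by norm_num) (by positivity)]; simpa using hm0
  -- A width lasts only while `e ≥ 1`, and `3 / 4 ≤ exp (-(1 / 4))`.
  have hround : ∀ l : ℕ, (1 : ℝ) ≤ 2 * n * (3 / 4) ^ l → (l : ℝ) ≤ 4 * Real.log (2 * n) := by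
    intro l hl
    have h1 : (3 / 4 : ℝ) ^ l ≤ Real.exp (-(l / 4)) := by
      have h2 : (3 / 4 : ℝ) ≤ Real.exp (-(1 / 4)) := by
        have := Real.add_one_le_exp (-(1 / 4) : ℝ)
        linarith
      calc (3 / 4 : ℝ) ^ l ≤ Real.exp (-(1 / 4)) ^ l := by gcongr
        _ = Real.exp (-(l / 4)) := by rw [← Real.exp_nat_mul]; congr 1; ring
    have h3 : Real.exp (l / 4) ≤ 2 * n := by
      have h4 : (1 : ℝ) ≤ 2 * n * Real.exp (-(l / 4)) := hl.trans (by gcongr)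
      rw [Real.exp_neg, ← div_eq_mul_inv, le_div_iff₀ (Real.exp_pos _)] at h4
      linarith
    have := (Real.le_log_iff_exp_le (by positivity)).2 h3
    linarith
  obtain ⟨h1, ⟨j, l, e, hd, hw, he, he1, -⟩, -⟩ := result_spec (B := 4 * Real.log (2 * n) + 1) htr
    (by omega) (by omega) hM hne (fun l hl => by have := hround l hl; linarith)
  have hl := hround l (he1.trans he)
  have hS : (0 : ℝ) < scale n := by exact_mod_cast scale_pos (by omega : 1 ≤ n)
  -- The width never falls below one, which limits the number of drops.
  have hj : (j : ℝ) ≤ scale n * Real.log m := by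
    have h2 : (1 : ℝ) ≤ (result lt M).width := by exact_mod_cast h1.width_pos
    have h3 := h2.trans hw
    rw [Real.exp_neg, ← div_eq_mul_inv, le_div_iff₀ (Real.exp_pos _), one_mul,
      ← Real.le_log_iff_exp_le (by positivity), div_le_iff₀ hS] at h3
    linarith
  have hlog2 : Real.log 2 ≤ 1 := by have := Real.log_two_lt_d9; linarith
  have hlog2' : 0 < Real.log 2 := Real.log_pos (by norm_num)
  have hlm : Real.log m ≤ Real.logb 2 m := by
    rw [Real.logb, le_div_iff₀ hlog2']
    nlinarith [Real.log_nonneg (by linarith : (1 : ℝ) ≤ m)]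
  have hln : Real.log (2 * n) ≤ 2 * Real.logb 2 n := by
    have : Real.log (2 * n) = Real.log 2 * (1 + Real.logb 2 n) := by
      rw [Real.log_mul (by norm_num) (by positivity), Real.logb]; field_simp
    rw [this]
    nlinarith
  have hsc := scale_le_logb hn
  set x := Real.logb 2 n
  set y := Real.logb 2 m
  have hj' : (j : ℝ) ≤ 4 * x * y := hj.trans (mul_le_mul hsc hlm (Real.log_nonneg (by linarith))
    (by positivity))
  have h0 : 0 ≤ Real.log (2 * n) := Real.log_nonneg (by linarith)
  calc ((result lt M).rounds : ℝ) ≤ j * (4 * Real.log (2 * n) + 1) + l := hd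
    _ ≤ (4 * x * y) * (8 * x + 1) + 8 * x := by
      gcongr ?_ * ?_ + ?_ <;> linarith
    _ ≤ 45 * (x ^ 2 * y) := by
      have h5 : 0 ≤ (x - 1) * (x * y) := by
        apply mul_nonneg <;> nlinarith
      have h6 : x ≤ x ^ 2 * y := by nlinarith
      nlinarith

end invariant

end Clustering

end Sched

namespace Sched

set_option linter.unusedSectionVars false

/-! ## Windows -/

section windows

variable {𝕜 : Type} [Field 𝕜] [LinearOrder 𝕜] {n : ℕ} (c : Fin n → 𝕜) (ρ : 𝕜)

/-- The window of length `ρ` of some leader contains `c v`. -/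
def Covered (Λ : Fin n → Prop) (v : Fin n) : Prop := ∃ a, Λ a ∧ c a ≤ c v ∧ c v ≤ c a + ρ

/-- The first jobs outside of the windows become leaders. -/
def addLeaders (Λ : Fin n → Prop) (v : Fin n) : Prop :=
  Λ v ∨ (¬ Covered c ρ Λ v ∧ ∀ w, ¬ Covered c ρ Λ w → c v ≤ c w)

/-- The leaders of the windows. -/
def leaders : Fin n → Prop := (addLeaders c ρ)^[n] fun _ => False

open Classical in
/-- The beginning of the window of a job. -/
noncomputable def windowStart (v : Fin n) : 𝕜 :=
  if h : Covered c ρ (leaders c ρ) v then c h.choose else 0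

variable [IsStrictOrderedRing 𝕜] {c ρ}

/-- A new leader is a leftmost uncovered job, so it lies beyond all earlier windows. Each stage
covers at least one more job, so `n` stages suffice. Several jobs with the same value may become
leaders together, whence the alternative `c a = c b`. -/
theorem leaders_spec (hρ : 0 ≤ ρ) : (∀ v, Covered c ρ (leaders c ρ) v) ∧
    ∀ a b, leaders c ρ a → leaders c ρ b → c a = c b ∨ c a + ρ < c b ∨ c b + ρ < c a := by
  have key : ∀ k, let Λ := (addLeaders c ρ)^[k] fun _ => False;
      (∀ a b, Λ a → Λ b → c a = c b ∨ c a + ρ < c b ∨ c b + ρ < c a) ∧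
      (∀ a v, Λ a → ¬ Covered c ρ Λ v → c a + ρ < c v) ∧
      Clustering.num (fun v => ¬ Covered c ρ Λ v) ≤ n - k := by
    intro k
    induction k with
    | zero => exact ⟨fun _ _ h => h.elim, fun _ _ h => h.elim, Clustering.num_le _⟩
    | succ k ih =>
      simp only [Function.iterate_succ_apply']
      set Λ := (addLeaders c ρ)^[k] fun _ => False
      obtain ⟨h1, h2, h3⟩ := ih
      have hcov : ∀ v, Covered c ρ Λ v → Covered c ρ (addLeaders c ρ Λ) v :=
        fun v ⟨a, ha, h⟩ => ⟨a, Or.inl ha, h⟩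
      refine ⟨?_, ?_, ?_⟩
      · rintro a b (ha | ha) (hb | hb)
        · exact h1 a b ha hb
        · exact Or.inr (Or.inl (h2 a b ha hb.1))
        · exact Or.inr (Or.inr (h2 b a hb ha.1))
        · exact Or.inl (le_antisymm (ha.2 b hb.1) (hb.2 a ha.1))
      · intro a v ha hv
        have hv' : ¬ Covered c ρ Λ v := fun h => hv (hcov v h)
        rcases ha with ha | ha
        · exact h2 a v ha hv'
        · by_contra! hlt
          exact hv ⟨a, Or.inr ha, ha.2 v hv', hlt⟩
      · by_cases hex : ∃ v, ¬ Covered c ρ Λ v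
        · classical
          obtain ⟨v, hv, hmin⟩ := Finset.exists_min_image
            (Finset.univ.filter fun v => ¬ Covered c ρ Λ v) c
            (by obtain ⟨v, hv⟩ := hex; exact ⟨v, by simpa using hv⟩)
          simp only [Finset.mem_filter, Finset.mem_univ, true_and] at hv hmin
          have hlead : addLeaders c ρ Λ v := Or.inr ⟨hv, hmin⟩
          have h4 : Covered c ρ (addLeaders c ρ Λ) v :=
            ⟨v, hlead, le_rfl, by linarith⟩
          have h5 : Clustering.num (fun w => ¬ Covered c ρ (addLeaders c ρ Λ) w) +
              Clustering.num (fun w => w = v) ≤ Clustering.num fun w => ¬ Covered c ρ Λ w := by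
            rw [Clustering.num_add_num]
            · refine Clustering.num_mono fun w hw => ?_
              rcases hw with hw | rfl
              · exact fun h => hw (hcov w h)
              · exact hv
            · rintro w hw rfl
              exact hw h4
          have h6 : 0 < Clustering.num fun w => w = v := Clustering.num_pos.2 ⟨v, rfl⟩
          omega
        · have : Clustering.num (fun w => ¬ Covered c ρ (addLeaders c ρ Λ) w) = 0 := by
            by_contra h0
            obtain ⟨v, hv⟩ := Clustering.num_pos.1 (Nat.pos_of_ne_zero h0)
            exact hex ⟨v, fun h => hv (hcov v h)⟩
          omega
  refine ⟨fun v => ?_, (key n).1⟩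
  by_contra h
  have h1 := (Clustering.num_pos (p := fun v => ¬ Covered c ρ (leaders c ρ) v)).2 ⟨v, h⟩
  have h2 := (key n).2.2
  simp only [leaders] at h1
  omega

/-- All leaders whose windows contain `c v` have the same value, so the choice in `windowStart` does
not matter; the algorithm may use any of them. -/
theorem windowStart_eq (hρ : 0 ≤ ρ) {v a : Fin n} (ha : leaders c ρ a) (h1 : c a ≤ c v)
    (h2 : c v ≤ c a + ρ) : windowStart c ρ v = c a := by
  have h : Covered c ρ (leaders c ρ) v := ⟨a, ha, h1, h2⟩
  rw [windowStart, dif_pos h]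
  obtain ⟨h3, h4, h5⟩ := h.choose_spec
  rcases (leaders_spec hρ).2 _ _ h3 ha with h6 | h6 | h6
  · exact h6
  · linarith
  · linarith

theorem windowStart_spec (hρ : 0 ≤ ρ) (v : Fin n) :
    windowStart c ρ v ≤ c v ∧ c v ≤ windowStart c ρ v + ρ ∧ ∃ a, windowStart c ρ v = c a := by
  obtain ⟨a, ha, h1, h2⟩ := (leaders_spec hρ).1 v
  rw [windowStart_eq hρ ha h1 h2]
  exact ⟨h1, h2, a, rfl⟩

theorem windowStart_gap (hρ : 0 ≤ ρ) {u v : Fin n} (h : windowStart c ρ u < windowStart c ρ v) :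
    windowStart c ρ u + ρ < windowStart c ρ v := by
  obtain ⟨a, ha, h1, h2⟩ := (leaders_spec hρ).1 u
  obtain ⟨b, hb, h3, h4⟩ := (leaders_spec hρ).1 v
  rw [windowStart_eq hρ ha h1 h2, windowStart_eq hρ hb h3 h4] at *
  rcases (leaders_spec hρ).2 _ _ ha hb with h6 | h6 | h6
  · exact absurd h6 h.ne
  · exact h6
  · linarith

end windows

/-! ## Removing the duplicates -/

namespace Instance

variable {𝕜 : Type} [Field 𝕜] [LinearOrder 𝕜] {n m : ℕ}
  (I : Instance 𝕜 n m) (σ : Assignment 𝕜 n m)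

/-- The start time of a copy. -/
def start (v : Fin n) (i : Fin m) : 𝕜 := (σ v i).getD 0

/-- The completion time of a copy. -/
def finish (v : Fin n) (i : Fin m) : 𝕜 := start σ v i + I.runTime v i

/-- The copy of `v` on `i` is the first one to be completed. -/
def IsFirst (v : Fin n) (i : Fin m) : Prop :=
  σ v i ≠ none ∧ ∀ j, σ v j ≠ none → I.finish σ v i ≤ I.finish σ v j

open Classical in
/-- The earliest completion time of a copy. -/
noncomputable def earliest (v : Fin n) : 𝕜 :=
  if h : ∃ i, I.IsFirst σ v i then I.finish σ v h.choose else 0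

/-- The beginning of the window in which a job is first completed. -/
noncomputable def window (v : Fin n) : 𝕜 := windowStart (I.earliest σ) I.delay v

/-- Some copy that is completed in the window starts before the window. -/
def Crossing (v : Fin n) : Prop := ∃ i, σ v i ≠ none ∧ start σ v i < I.window σ v ∧
  I.finish σ v i ≤ I.window σ v + I.delay

/-- The copies that may be kept. -/
def Usable (v : Fin n) (i : Fin m) : Prop := σ v i ≠ none ∧
  I.finish σ v i ≤ I.window σ v + I.delay ∧ (I.Crossing σ v → start σ v i < I.window σ v)

/-- On every machine on which `v` may be kept, `u` is completed before in the same window. -/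
def Before (u v : Fin n) : Prop := I.window σ u = I.window σ v ∧ ¬ I.Crossing σ u ∧
  ¬ I.Crossing σ v ∧ ∀ i, I.Usable σ v i → I.Usable σ u i ∧ I.finish σ u i ≤ start σ v i

/-- The assignment of jobs to machines and rounds. -/
noncomputable def plan : Clustering.State n m := Clustering.result (I.Before σ) (I.Usable σ)

open Classical in
/-- The start time of the copy that is kept. -/
noncomputable def newStart (v : Fin n) (i : Fin m) : 𝕜 :=
  if I.Crossing σ v then
    min (((2 * (I.plan σ).rounds + 6 : ℕ) : 𝕜) * (start σ v i + I.delay))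
      (((2 * (I.plan σ).rounds + 6 : ℕ) : 𝕜) * I.window σ v) +
      ((2 * (I.plan σ).rounds + 3 : ℕ) : 𝕜) * I.delay
  else ((2 * (I.plan σ).rounds + 5 : ℕ) : 𝕜) * I.window σ v +
    ((2 * (I.plan σ).round v : ℕ) : 𝕜) * I.delay + start σ v i +
    ((2 * (I.plan σ).rounds + 6 : ℕ) : 𝕜) * I.delay

open Classical in
/-- The schedule without duplicates. -/
noncomputable def unduplicated : Assignment 𝕜 n m := fun v i =>
  if (I.plan σ).home v i then some (I.newStart σ v i) else none

variable [IsStrictOrderedRing 𝕜] {I σ}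

theorem runTime_pos (v : Fin n) (i : Fin m) : 0 < I.runTime v i :=
  div_pos (I.size_pos v) (I.speed_pos i)

theorem eq_some_start {v : Fin n} {i : Fin m} (h : σ v i ≠ none) :
    σ v i = some (start σ v i) := by
  obtain ⟨t, ht⟩ := Option.ne_none_iff_exists'.1 h
  simp [start, ht]

theorem start_lt_finish (v : Fin n) (i : Fin m) : start σ v i < I.finish σ v i :=
  lt_add_of_pos_right _ (runTime_pos v i)

/-! ### Validity and makespan of the schedule without duplicates -/

section

variable (hσ : I.IsSchedule σ)

include hσ

theorem exists_isFirst (v : Fin n) : ∃ i, I.IsFirst σ v i := by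
  classical
  obtain ⟨i, t, hi⟩ := hσ.scheduled v
  obtain ⟨j, hj, hmin⟩ := Finset.exists_min_image (Finset.univ.filter fun i => σ v i ≠ none)
    (I.finish σ v) ⟨i, by simp [hi]⟩
  exact ⟨j, by simpa using hj, fun j' hj' => hmin j' (by simpa using hj')⟩

theorem earliest_eq {v : Fin n} {i : Fin m} (h : I.IsFirst σ v i) :
    I.earliest σ v = I.finish σ v i := by
  have h' := exists_isFirst hσ v
  rw [earliest, dif_pos h']
  exact le_antisymm (h'.choose_spec.2 i h.1) (h.2 _ h'.choose_spec.1)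

theorem earliest_le {v : Fin n} {i : Fin m} (h : σ v i ≠ none) :
    I.earliest σ v ≤ I.finish σ v i := by
  obtain ⟨j, hj⟩ := exists_isFirst hσ v
  rw [earliest_eq hσ hj]
  exact hj.2 i h

theorem start_nonneg' {v : Fin n} {i : Fin m} (h : σ v i ≠ none) : 0 ≤ start σ v i :=
  hσ.start_nonneg v i _ (eq_some_start h)

theorem earliest_pos (v : Fin n) : 0 < I.earliest σ v := by
  obtain ⟨j, hj⟩ := exists_isFirst hσ v
  rw [earliest_eq hσ hj]
  exact (start_nonneg' hσ hj.1).trans_lt (start_lt_finish v j)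

theorem window_pos (v : Fin n) : 0 < I.window σ v := by
  obtain ⟨-, -, a, ha⟩ := windowStart_spec (c := I.earliest σ) I.delay_nonneg v
  rw [window, ha]
  exact earliest_pos hσ a

theorem window_le_finish {v : Fin n} {i : Fin m} (h : σ v i ≠ none) :
    I.window σ v ≤ I.finish σ v i :=
  (windowStart_spec (c := I.earliest σ) I.delay_nonneg v).1.trans (earliest_le hσ h)

theorem exists_usable (v : Fin n) : ∃ i, I.Usable σ v i := by
  by_cases h : I.Crossing σ v
  · obtain ⟨i, h1, h2, h3⟩ := h
    exact ⟨i, h1, h3, fun _ => h2⟩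
  · obtain ⟨i, hi⟩ := exists_isFirst hσ v
    refine ⟨i, hi.1, ?_, fun h' => absurd h' h⟩
    rw [← earliest_eq hσ hi]
    exact (windowStart_spec (c := I.earliest σ) I.delay_nonneg v).2.1

omit hσ in
theorem before_trans (u v w : Fin n) (h1 : I.Before σ u v) (h2 : I.Before σ v w) :
    I.Before σ u w := by
  refine ⟨h1.1.trans h2.1, h1.2.1, h2.2.2.1, fun i hi => ?_⟩
  obtain ⟨h3, h4⟩ := h2.2.2.2 i hi
  obtain ⟨h5, h6⟩ := h1.2.2.2 i h3
  exact ⟨h5, h6.trans ((start_lt_finish v i).le.trans h4)⟩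

omit hσ in
theorem usable_of_before (u v : Fin n) (i : Fin m) (h : I.Before σ u v) (hv : I.Usable σ v i) :
    I.Usable σ u i := (h.2.2.2 i hv).1

/-- The clustering applies to all windows at once, since `Before` only relates jobs of the same
window. Any `B` serves here, as only the invariant is used; the quantitative choice is made in
`result_rounds_le`. -/
theorem plan_spec (hn : 2 ≤ n) (hm : 2 ≤ m) : (I.plan σ).Inv (I.Before σ) (I.Usable σ) ∧
    ∀ v, ∃ i, (I.plan σ).home v i := by
  have hB : ∃ B : ℝ, ∀ l : ℕ, (1 : ℝ) ≤ 2 * n * (3 / 4) ^ l → (l : ℝ) + 1 ≤ B := by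
    obtain ⟨N, hN⟩ := exists_pow_lt_of_lt_one (show (0 : ℝ) < 1 / (2 * n) by positivity)
      (show (3 / 4 : ℝ) < 1 by norm_num)
    refine ⟨N + 1, fun l hl => ?_⟩
    by_contra! h
    have h1 : N ≤ l := by
      have : (N : ℝ) < l := by linarith
      exact_mod_cast this.le
    have h2 : (3 / 4 : ℝ) ^ l ≤ (3 / 4) ^ N := pow_le_pow_of_le_one (by norm_num) (by norm_num) h1
    have h3 : (0 : ℝ) < 2 * n := by positivity
    have h4 := h2.trans_lt hN
    rw [lt_div_iff₀ h3] at h4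
    linarith
  obtain ⟨B, hB⟩ := hB
  obtain ⟨h1, -, h2⟩ := Clustering.result_spec before_trans (by omega) (by omega)
    usable_of_before (exists_usable hσ) hB
  refine ⟨h1, fun v => ?_⟩
  have := h2 v
  unfold Clustering.State.Free at this
  push Not at this
  exact this

/-- Bounds for the copies that are kept. -/
theorem newStart_bounds (hn : 2 ≤ n) (hm : 2 ≤ m) {v : Fin n} {i : Fin m}
    (h : (I.plan σ).home v i) :
    (I.Crossing σ v → I.newStart σ v i + I.runTime v i + I.delay ≤
      ((2 * (I.plan σ).rounds + 6 : ℕ) : 𝕜) * (I.window σ v + I.delay)) ∧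
    (¬ I.Crossing σ v → I.window σ v ≤ start σ v i ∧
      I.newStart σ v i = ((2 * (I.plan σ).rounds + 6 : ℕ) : 𝕜) * (I.window σ v + I.delay) +
        2 * (I.plan σ).round v * I.delay + (start σ v i - I.window σ v)) ∧
    0 ≤ I.newStart σ v i ∧
    I.newStart σ v i + I.runTime v i + I.delay ≤
      ((2 * (I.plan σ).rounds + 6 : ℕ) : 𝕜) * (I.window σ v + I.delay) +
        (2 * (I.plan σ).rounds + 3) * I.delay - I.delay + I.delay := by
  obtain ⟨hinv, -⟩ := plan_spec hσ hn hm
  obtain ⟨h1, h2, h3⟩ := hinv.mem v i h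
  have hround : ((I.plan σ).round v : 𝕜) ≤ (I.plan σ).rounds := by
    exact_mod_cast hinv.round_le v i h
  have hr0 : (0 : 𝕜) ≤ (I.plan σ).rounds := Nat.cast_nonneg _
  have hd0 : (0 : 𝕜) ≤ (I.plan σ).round v := Nat.cast_nonneg _
  have hρ := I.delay_nonneg
  have hs := start_nonneg' hσ h1
  have hT := window_pos hσ v
  have hp := runTime_pos (I := I) v i
  have hmul := mul_nonneg hr0 hρ
  by_cases hc : I.Crossing σ v
  · have hlt := h3 hc
    have hb : I.newStart σ v i + I.runTime v i + I.delay ≤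
      ((2 * (I.plan σ).rounds + 6 : ℕ) : 𝕜) * (I.window σ v + I.delay) := by
      rw [newStart, if_pos hc]
      unfold finish at h2
      push_cast
      set T := I.window σ v
      set ρ := I.delay
      set s := start σ v i
      set r : 𝕜 := ((I.plan σ).rounds : 𝕜)
      -- The run time is at most `T + ρ - s`. If `s + ρ ≤ T`, the slack is at least `(2 * r + 5) *
      -- (T - s - ρ)`. Otherwise the run time is at most `2 * ρ`, and `2 * r + 3` delays for the
      -- offset, two for running and one for communication make up the `2 * r + 6`.
      rcases le_total (s + ρ) T with h4 | h4
      · have h5 := min_le_left ((2 * r + 6) * (s + ρ)) ((2 * r + 6) * T)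
        have h6 : 0 ≤ r * (T - s - ρ) := mul_nonneg hr0 (by linarith)
        nlinarith
      · have h5 := min_le_right ((2 * r + 6) * (s + ρ)) ((2 * r + 6) * T)
        nlinarith
    refine ⟨fun _ => hb, fun h => absurd hc h, ?_, by nlinarith⟩
    rw [newStart, if_pos hc]
    refine add_nonneg (le_min ?_ ?_) ?_ <;> positivity
  · have hle : I.window σ v ≤ start σ v i := by
      by_contra! hlt
      exact hc ⟨i, h1, hlt, h2⟩
    have he : I.newStart σ v i = ((2 * (I.plan σ).rounds + 6 : ℕ) : 𝕜) *
        (I.window σ v + I.delay) + 2 * (I.plan σ).round v * I.delay +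
        (start σ v i - I.window σ v) := by
      rw [newStart, if_neg hc]; push_cast; ring
    refine ⟨fun h => absurd h hc, fun _ => ⟨hle, he⟩, ?_, ?_⟩
    · rw [newStart, if_neg hc]; positivity
    · unfold finish at h2
      rw [he]
      have := mul_le_mul_of_nonneg_right hround hρ
      linarith

/-- A window with start `T` ends its last round, including communication, by `(2 * r + 6) * (T + ρ)
+ (2 * r + 3) * ρ`. A crossing copy of a later window starts no earlier: the two arguments of the
minimum in `newStart` are handled by the hypothesis on the old start time and by the gap between
windows. For a noncrossing copy the gap suffices. -/
theorem finish_add_delay_le (hn : 2 ≤ n) (hm : 2 ≤ m) {u v : Fin n} {i j : Fin m}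
    (hu : (I.plan σ).home u j) (hv : (I.plan σ).home v i) (hT : I.window σ u < I.window σ v)
    (hs : I.window σ u ≤ start σ v i) :
    I.newStart σ u j + I.runTime u j + I.delay ≤ I.newStart σ v i := by
  obtain ⟨-, -, -, h1⟩ := newStart_bounds hσ hn hm hu
  obtain ⟨-, h3, -, -⟩ := newStart_bounds hσ hn hm hv
  have hgap : I.window σ u + I.delay < I.window σ v := windowStart_gap I.delay_nonneg hT
  have hr0 : (0 : 𝕜) ≤ (I.plan σ).rounds := Nat.cast_nonneg _
  have hd0 : (0 : 𝕜) ≤ (I.plan σ).round v := Nat.cast_nonneg _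
  have hρ := I.delay_nonneg
  refine h1.trans ?_
  by_cases hc : I.Crossing σ v
  · rw [newStart, if_pos hc]
    push_cast
    have h4 : (2 * ((I.plan σ).rounds : 𝕜) + 6) * (I.window σ u + I.delay) ≤
        min ((2 * ((I.plan σ).rounds : 𝕜) + 6) * (start σ v i + I.delay))
          ((2 * ((I.plan σ).rounds : 𝕜) + 6) * I.window σ v) := by
      refine le_min ?_ ?_ <;> gcongr
    linarith
  · obtain ⟨h4, h5⟩ := h3 hc
    rw [h5]
    push_cast
    have h6 := mul_nonneg hd0 hρ
    have h7 : (2 * ((I.plan σ).rounds : 𝕜) + 6) * (I.window σ u + I.delay + I.delay) ≤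
      (2 * ((I.plan σ).rounds : 𝕜) + 6) * (I.window σ v + I.delay) := by gcongr
    linarith

/-- Different windows keep their original order. In one window a machine has at most one crossing
copy, because such copies all run across the window start, and it ends before all noncrossing ones;
these are separated by their rounds, and in the same round they keep their original timing. -/
theorem exclusive_aux (hn : 2 ≤ n) (hm : 2 ≤ m) {u v : Fin n} {i : Fin m} (huv : u ≠ v)
    (hu : (I.plan σ).home u i) (hv : (I.plan σ).home v i) (hT : I.window σ u ≤ I.window σ v) :
    I.newStart σ u i + I.runTime u i ≤ I.newStart σ v i ∨
      I.newStart σ v i + I.runTime v i ≤ I.newStart σ u i := by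
  obtain ⟨hinv, -⟩ := plan_spec hσ hn hm
  obtain ⟨hu1, hu2, hu3⟩ := hinv.mem u i hu
  obtain ⟨hv1, hv2, hv3⟩ := hinv.mem v i hv
  have hex := hσ.exclusive i u v _ _ huv (eq_some_start hu1) (eq_some_start hv1)
  obtain ⟨hbu1, hbu2, -, -⟩ := newStart_bounds hσ hn hm hu
  obtain ⟨hbv1, hbv2, -, -⟩ := newStart_bounds hσ hn hm hv
  have hwu := window_le_finish hσ hu1
  have hwv := window_le_finish hσ hv1
  have hsu := start_lt_finish (I := I) (σ := σ) u i
  have hsv := start_lt_finish (I := I) (σ := σ) v i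
  have hρ := I.delay_nonneg
  have hdu0 : (0 : 𝕜) ≤ (I.plan σ).round u := Nat.cast_nonneg _
  have hdv0 : (0 : 𝕜) ≤ (I.plan σ).round v := Nat.cast_nonneg _
  have hmu := mul_nonneg hdu0 hρ
  have hmv := mul_nonneg hdv0 hρ
  change I.finish σ u i ≤ _ ∨ I.finish σ v i ≤ _ at hex
  rcases hT.lt_or_eq with hT | hT
  · have hgap : I.window σ u + I.delay < I.window σ v := windowStart_gap I.delay_nonneg hT
    rcases hex with hex | hex
    · left
      have := finish_add_delay_le hσ hn hm hu hv hT (by linarith)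
      linarith
    · linarith
  · rw [hT] at hbu1 hbu2 hwu hu2 hu3
    by_cases hcu : I.Crossing σ u <;> by_cases hcv : I.Crossing σ v
    · have := hu3 hcu
      have := hv3 hcv
      rcases hex with hex | hex <;> linarith
    · left
      have := hbu1 hcu
      obtain ⟨h5, h6⟩ := hbv2 hcv
      linarith
    · right
      have := hbv1 hcv
      obtain ⟨h5, h6⟩ := hbu2 hcu
      linarith
    · obtain ⟨h5, h6⟩ := hbu2 hcu
      obtain ⟨h7, h8⟩ := hbv2 hcv
      unfold finish at *
      rw [h6, h8]
      rcases lt_trichotomy ((I.plan σ).round u) ((I.plan σ).round v) with h | h | h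
      · left
        have : ((I.plan σ).round u : 𝕜) + 1 ≤ (I.plan σ).round v := by exact_mod_cast h
        have := mul_le_mul_of_nonneg_right this hρ
        linarith
      · rw [h]
        rcases hex with hex | hex
        · left; linarith
        · right; linarith
      · right
        have : ((I.plan σ).round v : 𝕜) + 1 ≤ (I.plan σ).round u := by exact_mod_cast h
        have := mul_le_mul_of_nonneg_right this hρ
        linarith

/-- A predecessor never has a later window. In the same window `v` is not crossing, since `u` is not
completed before the window; if `u` is crossing, it ends early enough for a message; if not,
`Before` holds and the rounds decide. -/
theorem precedence_aux (hn : 2 ≤ n) (hm : 2 ≤ m) {u v : Fin n} {i j : Fin m} (huv : I.Pred u v)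
    (hu : (I.plan σ).home u j) (hv : (I.plan σ).home v i) :
    I.newStart σ u j + I.runTime u j + I.delay ≤ I.newStart σ v i ∨
      (j = i ∧ I.newStart σ u j + I.runTime u j ≤ I.newStart σ v i) := by
  obtain ⟨hinv, -⟩ := plan_spec hσ hn hm
  have hρ := I.delay_nonneg
  have hprec : ∀ i, I.Usable σ v i → (σ u i ≠ none ∧ I.finish σ u i ≤ start σ v i) ∨
      I.earliest σ u ≤ start σ v i - I.delay := by
    intro i hi
    rcases hσ.precedence u v i _ huv (eq_some_start hi.1) with ⟨s, h1, h2⟩ | ⟨j, s, -, h1, h2⟩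
    · left
      have h3 : start σ u i = s := by simp [start, h1]
      exact ⟨by simp [h1], by rw [finish, h3]; exact h2⟩
    · right
      have h3 : start σ u j = s := by simp [start, h1]
      refine (earliest_le hσ (i := j) (by simp [h1])).trans ?_
      rw [finish, h3]; exact h2
  have hearly : I.earliest σ u ≤ start σ v i := by
    rcases hprec i (hinv.mem v i hv) with h | h
    · exact (earliest_le hσ h.1).trans h.2
    · linarith
  have hwu : I.window σ u ≤ I.earliest σ u :=
    (windowStart_spec (c := I.earliest σ) I.delay_nonneg u).1
  have hfv := (hinv.mem v i hv).2.1
  have hsv := start_lt_finish (I := I) (σ := σ) v i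
  rcases lt_trichotomy (I.window σ u) (I.window σ v) with hT | hT | hT
  · exact Or.inl (finish_add_delay_le hσ hn hm hu hv hT (by linarith))
  · have hsame : ∀ i, I.Usable σ v i → σ u i ≠ none ∧ I.finish σ u i ≤ start σ v i := by
      intro i hi
      rcases hprec i hi with h | h
      · exact h
      · have h1 := hi.2.1
        have h2 := start_lt_finish (I := I) (σ := σ) v i
        linarith
    have hcv : ¬ I.Crossing σ v := by
      intro hc
      have h1 := (hinv.mem v i hv).2.2 hc
      linarith
    obtain ⟨hv1, hv2⟩ := (newStart_bounds hσ hn hm hv).2.1 hcv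
    have hdv0 : (0 : 𝕜) ≤ (I.plan σ).round v := Nat.cast_nonneg _
    have hmv := mul_nonneg hdv0 hρ
    by_cases hcu : I.Crossing σ u
    · left
      have := (newStart_bounds hσ hn hm hu).1 hcu
      rw [hT] at this
      linarith
    · have hb : I.Before σ u v := by
        refine ⟨hT, hcu, hcv, fun i hi => ?_⟩
        obtain ⟨h1, h2⟩ := hsame i hi
        refine ⟨⟨h1, ?_, fun h => absurd h hcu⟩, h2⟩
        have h3 := hi.2.1
        have h4 := start_lt_finish (I := I) (σ := σ) v i
        linarith
      obtain ⟨hu1, hu2⟩ := (newStart_bounds hσ hn hm hu).2.1 hcu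
      have hfu := (hinv.mem u j hu).2.1
      rw [hT] at hu1 hu2 hfu
      unfold finish at *
      obtain ⟨j', hj', hord⟩ := hinv.order u v i hb hv
      obtain rfl := hinv.unique u j' j hj' hu
      rw [hu2, hv2]
      rcases hord with h | ⟨rfl, h⟩
      · left
        have : ((I.plan σ).round u : 𝕜) + 1 ≤ (I.plan σ).round v := by exact_mod_cast h
        have := mul_le_mul_of_nonneg_right this hρ
        linarith
      · right
        refine ⟨rfl, ?_⟩
        have h1 : ((I.plan σ).round u : 𝕜) ≤ (I.plan σ).round v := by exact_mod_cast h
        have h2 := mul_le_mul_of_nonneg_right h1 hρ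
        have h3 := (hsame j' (hinv.mem v j' hv)).2
        linarith
  · have hgap : I.window σ v + I.delay < I.window σ u := windowStart_gap I.delay_nonneg hT
    linarith

omit hσ in
theorem unduplicated_eq_some {v : Fin n} {i : Fin m} {t : 𝕜}
    (h : I.unduplicated σ v i = some t) : (I.plan σ).home v i ∧ t = I.newStart σ v i := by
  unfold unduplicated at h
  split_ifs at h with h1
  exact ⟨h1, (Option.some.inj h).symm⟩

omit hσ in
theorem unduplicated_of_home {v : Fin n} {i : Fin m} (h : (I.plan σ).home v i) :
    I.unduplicated σ v i = some (I.newStart σ v i) := by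
  simp [unduplicated, h]

theorem unduplicated_isNoDupSchedule (hn : 2 ≤ n) (hm : 2 ≤ m) :
    I.IsNoDupSchedule (I.unduplicated σ) := by
  obtain ⟨hinv, hhome⟩ := plan_spec hσ hn hm
  refine ⟨⟨fun v => ?_, fun v i t h => ?_, fun i u v s t huv hs ht => ?_, fun u v i t huv ht => ?_⟩,
    fun v => ?_⟩
  · obtain ⟨i, hi⟩ := hhome v
    exact ⟨i, _, unduplicated_of_home hi⟩
  · obtain ⟨h1, rfl⟩ := unduplicated_eq_some h
    exact (newStart_bounds hσ hn hm h1).2.2.1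
  · obtain ⟨h1, rfl⟩ := unduplicated_eq_some hs
    obtain ⟨h2, rfl⟩ := unduplicated_eq_some ht
    rcases le_total (I.window σ u) (I.window σ v) with h | h
    · exact exclusive_aux hσ hn hm huv h1 h2 h
    · exact (exclusive_aux hσ hn hm huv.symm h2 h1 h).symm
  · obtain ⟨h1, rfl⟩ := unduplicated_eq_some ht
    obtain ⟨j, hj⟩ := hhome u
    have hρ := I.delay_nonneg
    rcases precedence_aux hσ hn hm huv hj h1 with h | ⟨rfl, h⟩
    · by_cases hji : j = i
      · subst hji
        exact Or.inl ⟨_, unduplicated_of_home hj, by linarith⟩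
      · exact Or.inr ⟨j, _, hji, unduplicated_of_home hj, by linarith⟩
    · exact Or.inl ⟨_, unduplicated_of_home hj, h⟩
  · obtain ⟨i, hi⟩ := hhome v
    refine ⟨i, by simp [unduplicated_of_home hi], fun j hj => ?_⟩
    obtain ⟨h1, -⟩ := unduplicated_eq_some (eq_some_start hj)
    exact hinv.unique v j i h1 hi

/-- The makespan grows by a factor proportional to the number of rounds. -/
theorem exists_isMakespan_unduplicated (hn : 2 ≤ n) (hm : 2 ≤ m) {M : 𝕜} (hM : I.IsMakespan σ M)
    (hρM : I.delay ≤ M) : ∃ M', I.IsMakespan (I.unduplicated σ) M' ∧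
      M' ≤ ((6 * (I.plan σ).rounds + 18 : ℕ) : 𝕜) * M := by
  classical
  obtain ⟨hinv, hhome⟩ := plan_spec hσ hn hm
  obtain ⟨⟨v, i⟩, hvi, hmax⟩ := Finset.exists_max_image
    (Finset.univ.filter fun p : Fin n × Fin m => (I.plan σ).home p.1 p.2)
    (fun p => I.newStart σ p.1 p.2 + I.runTime p.1 p.2)
    (by obtain ⟨i, hi⟩ := hhome ⟨0, by omega⟩; exact ⟨(⟨0, by omega⟩, i), by simpa using hi⟩)
  simp only [Finset.mem_filter, Finset.mem_univ, true_and] at hvi hmax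
  refine ⟨_, ⟨⟨v, i, _, unduplicated_of_home hvi, rfl⟩, ?_⟩, ?_⟩
  · rintro c ⟨u, j, t, ht, rfl⟩
    obtain ⟨h1, rfl⟩ := unduplicated_eq_some ht
    exact hmax (u, j) h1
  · have h1 := (newStart_bounds hσ hn hm hvi).2.2.2
    have h2 : I.window σ v ≤ M := by
      have h3 := (hinv.mem v i hvi).1
      exact (window_le_finish hσ h3).trans (hM.2 ⟨v, i, _, eq_some_start h3, rfl⟩)
    have hr0 : (0 : 𝕜) ≤ (I.plan σ).rounds := Nat.cast_nonneg _
    have hρ := I.delay_nonneg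
    push_cast at *
    nlinarith [mul_le_mul_of_nonneg_left h2 hr0, mul_le_mul_of_nonneg_left hρM hr0]

/-- The constant is `6 * 45 + 18`; the additive `18` is absorbed because both logarithms are at
least one. -/
theorem plan_rounds_le (hn : 2 ≤ n) (hm : 2 ≤ m) :
    ((6 * (I.plan σ).rounds + 18 : ℕ) : ℝ) ≤ 288 * (Real.logb 2 n ^ 2 * Real.logb 2 m) := by
  have h1 := Clustering.result_rounds_le before_trans hn hm usable_of_before
    (exists_usable hσ)
  have hL : (1 : ℝ) ≤ Real.logb 2 n := by
    rw [Real.le_logb_iff_rpow_le (by norm_num) (by positivity)]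
    simpa using (by exact_mod_cast hn : (2 : ℝ) ≤ n)
  have hL' : (1 : ℝ) ≤ Real.logb 2 m := by
    rw [Real.le_logb_iff_rpow_le (by norm_num) (by positivity)]
    simpa using (by exact_mod_cast hm : (2 : ℝ) ≤ m)
  have h2 : (1 : ℝ) ≤ Real.logb 2 n ^ 2 * Real.logb 2 m :=
    one_le_mul_of_one_le_of_one_le (one_le_pow₀ hL) hL'
  change ((I.plan σ).rounds : ℝ) ≤ _ at h1
  push_cast
  linarith

end

end Instance

end Sched

namespace Sched

open Polynomial Data

/-! ## The clustering algorithm runs in polynomial time -/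

section rel

variable {Γ : Type} {e : Γ → Data} {n n' : Γ → ℕ}

/-- A property of an index is decided in polynomial time. -/
def PolyTimeSet (e : Γ → Data) (n : Γ → ℕ) (p : (c : Γ) → Fin (n c) → Prop) : Prop :=
  PolyTime (ext e n) (fun x => bit (p x.1 x.2))

/-- A relation between two indices is decided in polynomial time. -/
def PolyTimeRel (e : Γ → Data) (n n' : Γ → ℕ) (r : (c : Γ) → Fin (n c) → Fin (n' c) → Prop) :
    Prop :=
  PolyTime (ext (ext e n) fun x => n' x.1) (fun x => bit (r x.1.1 x.1.2 x.2))

theorem PolyTimeSet.app {p : (c : Γ) → Fin (n c) → Prop} (hp : PolyTimeSet e n p)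
    {i : (c : Γ) → Fin (n c)} (hi : PolyTime e (fun c => un (i c))) :
    PolyTime e (fun c => bit (p c (i c))) :=
  (PolyTime.refl.cons hi).trans (hp.reindex fun c => ⟨c, i c⟩)

theorem PolyTimeSet.subst {p : (c : Γ) → Fin (n c) → Prop} (hp : PolyTimeSet e n p) {Γ' : Type}
    {e' : Γ' → Data} (π : Γ' → Γ) (hπ : PolyTime e' (fun g => e (π g))) :
    PolyTimeSet e' (fun g => n (π g)) (fun g => p (π g)) :=
  PolyTime.subst hp (fun x : (g : Γ') × Fin (n (π g)) => ⟨π x.1, x.2⟩) (hπ.weak.cons PolyTime.idx)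

theorem PolyTimeSet.weak {p : (c : Γ) → Fin (n c) → Prop} (hp : PolyTimeSet e n p) :
    PolyTimeSet (ext e n') (fun x => n x.1) (fun x => p x.1) :=
  hp.subst Sigma.fst PolyTime.base

theorem PolyTimeSet.of_tab {p : (c : Γ) → Fin (n c) → Prop}
    (hp : PolyTime e (fun c => tab fun i => bit (p c i))) : PolyTimeSet e n p :=
  (hp.weak.nth PolyTime.idx).congr fun _ => nth_tab _ _

theorem PolyTimeRel.app {r : (c : Γ) → Fin (n c) → Fin (n' c) → Prop} (hr : PolyTimeRel e n n' r)
    {i : (c : Γ) → Fin (n c)} {j : (c : Γ) → Fin (n' c)} (hi : PolyTime e (fun c => un (i c)))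
    (hj : PolyTime e (fun c => un (j c))) : PolyTime e (fun c => bit (r c (i c) (j c))) :=
  ((PolyTime.refl.cons hi).cons hj).trans (hr.reindex fun c => ⟨⟨c, i c⟩, j c⟩)

theorem PolyTimeRel.subst {r : (c : Γ) → Fin (n c) → Fin (n' c) → Prop}
    (hr : PolyTimeRel e n n' r) {Γ' : Type} {e' : Γ' → Data} (π : Γ' → Γ)
    (hπ : PolyTime e' (fun g => e (π g))) :
    PolyTimeRel e' (fun g => n (π g)) (fun g => n' (π g)) (fun g => r (π g)) :=
  PolyTime.subst hr
    (fun x : (y : (g : Γ') × Fin (n (π g))) × Fin (n' (π y.1)) => ⟨⟨π x.1.1, x.1.2⟩, x.2⟩)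
    ((hπ.weak.weak.cons PolyTime.idx.weak).cons PolyTime.idx)

theorem PolyTimeRel.weak {k : Γ → ℕ} {r : (c : Γ) → Fin (n c) → Fin (n' c) → Prop}
    (hr : PolyTimeRel e n n' r) :
    PolyTimeRel (ext e k) (fun x => n x.1) (fun x => n' x.1) (fun x => r x.1) :=
  hr.subst Sigma.fst PolyTime.base

theorem PolyTimeRel.of_tab {r : (c : Γ) → Fin (n c) → Fin (n' c) → Prop}
    (hr : PolyTime e (fun c => tab fun i => tab fun j => bit (r c i j))) : PolyTimeRel e n n' r :=
  ((hr.weak.weak.nth PolyTime.idx.weak).nth PolyTime.idx).congr fun x => by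
    rw [nth_tab, nth_tab]

theorem PolyTime.num {p : (c : Γ) → Fin (n c) → Prop} (hn : PolyTime e (fun c => un (n c)))
    (hp : PolyTimeSet e n p) : PolyTime e (fun c => un (Clustering.num (p c))) :=
  PolyTime.card hn hp

theorem PolyTimeSet.ex {p : (c : Γ) → Fin (n c) → Prop} (hp : PolyTimeSet e n p)
    (hn : PolyTime e (fun c => un (n c))) : PolyTime e (fun c => bit (∃ i, p c i)) :=
  PolyTime.ex hn hp

theorem PolyTimeSet.tab {p : (c : Γ) → Fin (n c) → Prop} (hp : PolyTimeSet e n p)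
    (hn : PolyTime e (fun c => un (n c))) : PolyTime e (fun c => tab fun i => bit (p c i)) :=
  PolyTime.tab hn hp

theorem PolyTimeRel.tab {r : (c : Γ) → Fin (n c) → Fin (n' c) → Prop} (hr : PolyTimeRel e n n' r)
    (hn : PolyTime e (fun c => un (n c))) (hn' : PolyTime e (fun c => un (n' c))) :
    PolyTime e (fun c => Data.tab fun i => Data.tab fun j => bit (r c i j)) := by
  have h : PolyTime (ext e n) (fun x => Data.tab fun j => bit (r x.1 x.2 j)) :=
    PolyTime.tab hn'.weak hr
  exact PolyTime.tab hn h

theorem PolyTime.fin_le {i j : (c : Γ) → Fin (n c)} (hi : PolyTime e (fun c => un (i c)))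
    (hj : PolyTime e (fun c => un (j c))) : PolyTime e (fun c => bit (i c ≤ j c)) :=
  (hi.un_le hj).bit_iff fun _ => Fin.le_def.symm

theorem PolyTime.fin_eq {i j : (c : Γ) → Fin (n c)} (hi : PolyTime e (fun c => un (i c)))
    (hj : PolyTime e (fun c => un (j c))) : PolyTime e (fun c => bit (i c = j c)) :=
  (hi.un_eq hj).bit_iff fun _ => Fin.ext_iff.symm

end rel

namespace Clustering

section

variable {Γ : Type} {e : Γ → Data} {n m : Γ → ℕ} {lt : (c : Γ) → Fin (n c) → Fin (n c) → Prop}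
  {M : (c : Γ) → Fin (n c) → Fin (m c) → Prop} {Q : (c : Γ) → Fin (n c) → Prop}

theorem polyTime_le (hlt : PolyTimeRel e n n lt) {u v : (c : Γ) → Fin (n c)}
    (hu : PolyTime e (fun c => un (u c))) (hv : PolyTime e (fun c => un (v c))) :
    PolyTime e (fun c => bit (le (lt c) (u c) (v c))) :=
  (hu.fin_eq hv).or (hlt.app hu hv)

/-- The recursion on the radius would nest quantifiers to unbounded depth, so the whole membership
table of the ball is iterated instead. -/
theorem polyTime_ball (hn : PolyTime e (fun c => un (n c))) (hlt : PolyTimeRel e n n lt)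
    (hQ : PolyTimeSet e n Q) {u v : (c : Γ) → Fin (n c)} {k : Γ → ℕ}
    (hu : PolyTime e (fun c => un (u c))) (hk : PolyTime e (fun c => un (k c)))
    (hv : PolyTime e (fun c => un (v c))) :
    PolyTime e (fun c => bit (ball (lt c) (Q c) (u c) (k c) (v c))) := by
  have h : PolyTime e (fun c => tab fun v => bit (ball (lt c) (Q c) (u c) (un (k c)).len v)) := by
    refine PolyTime.iter (s := fun c k => tab fun v => bit (ball (lt c) (Q c) (u c) k v)) hk
      (hn.tab (PolyTime.idx.fin_eq hu.weak)) ?_ ⟨fun c => n c * 4 + 1,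
        (hn.un_bound.mul (.const 4)).add (.const 1), fun c k _ => size_tab_le _ 3 fun v => size_bit_le _⟩
    have hX := PolyTimeSet.of_tab (PolyTime.refl (e := fun p : Γ × ℕ =>
      Data.cons (e p.1) (tab fun v => bit (ball (lt p.1) (Q p.1) (u p.1) p.2 v)))).snd
    have hn' := hn.subst Prod.fst (PolyTime.refl (e := fun p : Γ × ℕ =>
      Data.cons (e p.1) (tab fun v => bit (ball (lt p.1) (Q p.1) (u p.1) p.2 v)))).fst
    have hQ' := hQ.subst Prod.fst (PolyTime.refl (e := fun p : Γ × ℕ =>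
      Data.cons (e p.1) (tab fun v => bit (ball (lt p.1) (Q p.1) (u p.1) p.2 v)))).fst
    have hlt' := hlt.subst Prod.fst (PolyTime.refl (e := fun p : Γ × ℕ =>
      Data.cons (e p.1) (tab fun v => bit (ball (lt p.1) (Q p.1) (u p.1) p.2 v)))).fst
    refine hn'.tab ?_
    refine PolyTime.and hQ' (PolyTime.ex hn'.weak (PolyTime.and ?_
      (PolyTime.ex hn'.weak.weak (PolyTime.and ?_ (PolyTime.and ?_ ?_)))))
    · exact hX.weak.weak.app PolyTime.idx
    · exact hQ'.weak.weak.weak.app PolyTime.idx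
    · exact polyTime_le hlt'.weak.weak.weak PolyTime.idx PolyTime.idx.weak
    · exact polyTime_le hlt'.weak.weak.weak PolyTime.idx PolyTime.idx.weak.weak
  exact (h.nth hv).congr fun c => by rw [nth_tab, len_un]

theorem polyTime_cluster (hn : PolyTime e (fun c => un (n c))) (hlt : PolyTimeRel e n n lt)
    (hM : PolyTimeRel e n m M) (hQ : PolyTimeSet e n Q) {u v : (c : Γ) → Fin (n c)} {k : Γ → ℕ}
    {i : (c : Γ) → Fin (m c)}
    (hu : PolyTime e (fun c => un (u c))) (hk : PolyTime e (fun c => un (k c)))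
    (hi : PolyTime e (fun c => un (i c))) (hv : PolyTime e (fun c => un (v c))) :
    PolyTime e (fun c => bit (cluster (lt c) (M c) (Q c) (u c) (k c) (i c) (v c))) :=
  (hQ.app hv).and (PolyTime.ex hn (((polyTime_ball hn.weak hlt.weak hQ.weak hu.weak hk.weak
    PolyTime.idx).and (hM.weak.app PolyTime.idx hi.weak)).and
      (polyTime_le hlt.weak hv.weak PolyTime.idx)))

theorem polyTime_blocked (hn : PolyTime e (fun c => un (n c))) (hlt : PolyTimeRel e n n lt)
    (hM : PolyTimeRel e n m M) (hQ : PolyTimeSet e n Q) {u v : (c : Γ) → Fin (n c)} {k : Γ → ℕ}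
    {i : (c : Γ) → Fin (m c)}
    (hu : PolyTime e (fun c => un (u c))) (hk : PolyTime e (fun c => un (k c)))
    (hi : PolyTime e (fun c => un (i c))) (hv : PolyTime e (fun c => un (v c))) :
    PolyTime e (fun c => bit (blocked (lt c) (M c) (Q c) (u c) (k c) (i c) (v c))) :=
  (hQ.app hv).and (PolyTime.ex hn ((polyTime_cluster hn.weak hlt.weak hM.weak hQ.weak hu.weak hk.weak
    hi.weak PolyTime.idx).and (polyTime_le hlt.weak PolyTime.idx hv.weak)))

theorem polyTime_good (hn : PolyTime e (fun c => un (n c))) (hlt : PolyTimeRel e n n lt)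
    (hM : PolyTimeRel e n m M) (hQ : PolyTimeSet e n Q) {u k : (c : Γ) → Fin (n c)}
    {i : (c : Γ) → Fin (m c)}
    (hu : PolyTime e (fun c => un (u c))) (hk : PolyTime e (fun c => un (k c)))
    (hi : PolyTime e (fun c => un (i c))) :
    PolyTime e (fun c => bit (good (lt c) (M c) (Q c) (u c) (k c) (i c))) := by
  have h1 : PolyTimeSet e n fun c => cluster (lt c) (M c) (Q c) (u c) (k c) (i c) :=
    polyTime_cluster hn.weak hlt.weak hM.weak hQ.weak hu.weak hk.weak hi.weak PolyTime.idx
  have h2 : PolyTimeSet e n fun c => blocked (lt c) (M c) (Q c) (u c) (k c) (i c) :=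
    polyTime_blocked hn.weak hlt.weak hM.weak hQ.weak hu.weak hk.weak hi.weak PolyTime.idx
  exact (h1.ex hn).and ((PolyTime.num hn h2).bin_un.bin_le
    ((PolyTime.const (bin 4)).bin_mul (PolyTime.num hn h1).bin_un))

theorem polyTime_pick (hn : PolyTime e (fun c => un (n c))) (hm : PolyTime e (fun c => un (m c)))
    (hlt : PolyTimeRel e n n lt) (hM : PolyTimeRel e n m M) (hQ : PolyTimeSet e n Q)
    {u k : (c : Γ) → Fin (n c)} {i : (c : Γ) → Fin (m c)}
    (hu : PolyTime e (fun c => un (u c))) (hk : PolyTime e (fun c => un (k c)))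
    (hi : PolyTime e (fun c => un (i c))) :
    PolyTime e (fun c => bit (pick (lt c) (M c) (Q c) (u c) (k c) (i c))) := by
  refine (polyTime_good hn hlt hM hQ hu hk hi).and (PolyTime.and (PolyTime.all hn (PolyTime.imp
    (PolyTime.ex hn.weak (PolyTime.ex hm.weak.weak ?_)) ?_)) (PolyTime.and
      (PolyTime.all hn (PolyTime.imp (PolyTime.ex hm.weak ?_) ?_))
      (PolyTime.all hm (PolyTime.imp ?_ ?_))))
  · exact polyTime_good hn.weak.weak.weak hlt.weak.weak.weak hM.weak.weak.weak hQ.weak.weak.weak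
      PolyTime.idx.weak.weak PolyTime.idx.weak PolyTime.idx
  · exact hu.weak.fin_le PolyTime.idx
  · exact polyTime_good hn.weak.weak hlt.weak.weak hM.weak.weak hQ.weak.weak
      hu.weak.weak PolyTime.idx.weak PolyTime.idx
  · exact hk.weak.fin_le PolyTime.idx
  · exact polyTime_good hn.weak hlt.weak hM.weak hQ.weak hu.weak hk.weak PolyTime.idx
  · exact hi.weak.fin_le PolyTime.idx

theorem polyTime_scale (hn : PolyTime e (fun c => un (n c))) :
    PolyTime e (fun c => un (scale (n c))) := by
  have h : PolyTime e (fun c => un (num fun k : Fin (n c) => 2 ^ (k : ℕ) ≤ n c)) :=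
    PolyTime.num hn (PolyTime.bin_le (PolyTime.idx.bin_two_pow) hn.weak.bin_un)
  exact h.un_add h

theorem polyTime_wide (hn : PolyTime e (fun c => un (n c))) (hm : PolyTime e (fun c => un (m c)))
    (hM : PolyTimeRel e n m M) {μ : Γ → ℕ} {v : (c : Γ) → Fin (n c)}
    (hμ : PolyTime e (fun c => un (μ c))) (hv : PolyTime e (fun c => un (v c))) :
    PolyTime e (fun c => bit (wide (M c) (μ c) (v c))) := by
  have h : PolyTimeSet e m fun c => M c (v c) := hM.weak.app hv.weak PolyTime.idx
  exact (hμ.bin_un.bin_mul (polyTime_scale hn).bin_un).bin_le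
    (((PolyTime.num hm h).bin_un.bin_mul
      (polyTime_scale hn).bin_un).bin_add hμ.bin_un)

/-- The components of a state are computed in polynomial time. -/
structure PolyTimeState (e : Γ → Data) (s : (c : Γ) → State (n c) (m c)) : Prop where
  active : PolyTimeSet e n fun c => (s c).active
  home : PolyTimeRel e n m fun c => (s c).home
  round : PolyTime (ext e n) fun x => un ((s x.1).round x.2)
  width : PolyTime e fun c => un (s c).width
  rounds : PolyTime e fun c => un (s c).rounds

/-- The code of a state. -/
noncomputable def State.code {n m : ℕ} (s : State n m) : Data :=
  Data.cons (tab fun v => bit (s.active v)) (Data.cons (tab fun v => tab fun i => bit (s.home v i))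
    (Data.cons (tab fun v => un (s.round v)) (Data.cons (un s.width) (un s.rounds))))

variable {s t : (c : Γ) → State (n c) (m c)}

theorem PolyTimeState.code (hn : PolyTime e (fun c => un (n c)))
    (hm : PolyTime e (fun c => un (m c))) (hs : PolyTimeState e s) :
    PolyTime e fun c => (s c).code :=
  (hs.active.tab hn).cons ((hs.home.tab hn hm).cons
    ((hn.tab hs.round).cons (hs.width.cons hs.rounds)))

theorem PolyTimeState.of_code (hs : PolyTime e fun c => (s c).code) : PolyTimeState e s :=
  ⟨.of_tab hs.fst, .of_tab hs.snd.fst,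
    (hs.snd.snd.fst.weak.nth PolyTime.idx).congr fun _ => nth_tab _ _,
    hs.snd.snd.snd.fst, hs.snd.snd.snd.snd⟩

theorem PolyTimeState.free (hm : PolyTime e (fun c => un (m c))) (hs : PolyTimeState e s) :
    PolyTimeSet e n fun c => (s c).Free :=
  PolyTime.all hm.weak hs.home.not

open Classical in
theorem _root_.Sched.PolyTime.un_ite {p : Γ → Prop} {a b : Γ → ℕ}
    (hp : PolyTime e fun c => bit (p c))
    (ha : PolyTime e fun c => un (a c)) (hb : PolyTime e fun c => un (b c)) :
    PolyTime e fun c => un (if p c then a c else b c) :=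
  (hp.ite ha hb).congr fun c => by split_ifs <;> rfl

theorem PolyTimeState.nextWidth (hn : PolyTime e (fun c => un (n c)))
    (hm : PolyTime e (fun c => un (m c))) (hM : PolyTimeRel e n m M) (hs : PolyTimeState e s) :
    PolyTime e fun c => un ((s c).nextWidth (M c)) := by
  have hfree := hs.free hm
  have h1 : PolyTimeSet e n fun c v => (s c).Free v ∧ wide (M c) (s c).width v :=
    PolyTime.and hfree (polyTime_wide hn.weak hm.weak hM.weak hs.width.weak PolyTime.idx)
  have h2 : PolyTimeSet (ext (ext e m) fun x => n x.1) (fun x => m x.1.1)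
      fun x => M x.1.1 x.2 := hM.weak.weak.weak.app PolyTime.idx.weak PolyTime.idx
  have h3 : PolyTimeSet e m fun c j => ∃ v, (s c).Free v ∧ (j : ℕ) < num (M c v) :=
    PolyTime.ex hn.weak (PolyTime.and ((hfree.weak (n' := m)).weak.app PolyTime.idx)
      (PolyTime.un_lt PolyTime.idx.weak (PolyTime.num hm.weak.weak h2)))
  refine ((h1.ex hn).un_ite hs.width (PolyTime.num hm h3)).congr fun c => ?_
  unfold State.nextWidth
  split_ifs <;> rfl

theorem PolyTimeState.refresh (hn : PolyTime e (fun c => un (n c)))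
    (hm : PolyTime e (fun c => un (m c))) (hM : PolyTimeRel e n m M) (hs : PolyTimeState e s) :
    PolyTimeState e fun c => (s c).refresh (M c) := by
  have hex : PolyTime e fun c => bit (∃ w, (s c).active w) := hs.active.ex hn
  have hw := hs.nextWidth hn hm hM
  have h1 : PolyTime e fun c => un ((s c).rounds + 1) := PolyTime.nil.cons hs.rounds
  exact ⟨(hex.weak.and hs.active).or (hex.weak.not.and (PolyTime.and (hs.free hm)
      (polyTime_wide hn.weak hm.weak hM.weak hw.weak PolyTime.idx))), hs.home, hs.round,
    (hex.un_ite hs.width hw).congr fun c => by unfold State.refresh; split_ifs <;> rfl,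
    (hex.un_ite hs.rounds h1).congr fun c => by unfold State.refresh; split_ifs <;> rfl⟩

theorem PolyTimeState.assign (hn : PolyTime e (fun c => un (n c)))
    (hm : PolyTime e (fun c => un (m c))) (hlt : PolyTimeRel e n n lt) (hM : PolyTimeRel e n m M)
    (hs : PolyTimeState e s) : PolyTimeState e fun c => (s c).assign (lt c) (M c) := by
  have hround : PolyTime (ext e n) fun x => bit (∃ u k i,
      pick (lt x.1) (M x.1) (s x.1).active u k i ∧
        cluster (lt x.1) (M x.1) (s x.1).active u k i x.2) := by
    refine PolyTime.ex hn.weak (PolyTime.ex hn.weak.weak (PolyTime.ex hm.weak.weak.weak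
      (PolyTime.and ?_ ?_)))
    · exact polyTime_pick hn.weak.weak.weak.weak hm.weak.weak.weak.weak hlt.weak.weak.weak.weak
        hM.weak.weak.weak.weak hs.active.weak.weak.weak.weak PolyTime.idx.weak.weak
        PolyTime.idx.weak PolyTime.idx
    · exact polyTime_cluster hn.weak.weak.weak.weak hlt.weak.weak.weak.weak
        hM.weak.weak.weak.weak hs.active.weak.weak.weak.weak PolyTime.idx.weak.weak
        PolyTime.idx.weak PolyTime.idx PolyTime.idx.weak.weak.weak
  refine ⟨PolyTime.and hs.active (PolyTime.not (PolyTime.ex hn.weak (PolyTime.ex hn.weak.weak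
      (PolyTime.ex hm.weak.weak.weak (PolyTime.and ?_ ?_))))),
    PolyTime.or hs.home (PolyTime.ex hn.weak.weak (PolyTime.ex hn.weak.weak.weak
      (PolyTime.and ?_ ?_))),
    (hround.un_ite hs.rounds.weak hs.round).congr fun c => by
      simp only [State.assign]; split_ifs <;> rfl, hs.width, hs.rounds⟩
  · exact polyTime_pick hn.weak.weak.weak.weak hm.weak.weak.weak.weak hlt.weak.weak.weak.weak
      hM.weak.weak.weak.weak hs.active.weak.weak.weak.weak PolyTime.idx.weak.weak PolyTime.idx.weak
      PolyTime.idx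
  · exact polyTime_blocked hn.weak.weak.weak.weak hlt.weak.weak.weak.weak
      hM.weak.weak.weak.weak hs.active.weak.weak.weak.weak PolyTime.idx.weak.weak PolyTime.idx.weak
      PolyTime.idx PolyTime.idx.weak.weak.weak
  · exact polyTime_pick hn.weak.weak.weak.weak hm.weak.weak.weak.weak hlt.weak.weak.weak.weak
      hM.weak.weak.weak.weak hs.active.weak.weak.weak.weak PolyTime.idx.weak PolyTime.idx
      PolyTime.idx.weak.weak
  · exact polyTime_cluster hn.weak.weak.weak.weak hlt.weak.weak.weak.weak
      hM.weak.weak.weak.weak hs.active.weak.weak.weak.weak PolyTime.idx.weak PolyTime.idx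
      PolyTime.idx.weak.weak PolyTime.idx.weak.weak.weak

theorem PolyTimeState.step (hn : PolyTime e (fun c => un (n c)))
    (hm : PolyTime e (fun c => un (m c))) (hlt : PolyTimeRel e n n lt) (hM : PolyTimeRel e n m M)
    (hs : PolyTimeState e s) : PolyTimeState e fun c => (s c).step (lt c) (M c) := by
  classical
  refine .of_code ((((hs.free hm).ex hn).ite
    (((hs.refresh hn hm hM).assign hn hm hlt hM).code hn hm) (hs.code hn hm)).congr fun c => ?_)
  unfold State.step
  split_ifs <;> rfl

/-- These bounds keep the codes of all intermediate states polynomial in size, as iteration of a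
polynomial-time step requires. -/
theorem State.iterate_bound {n m : ℕ} (lt : Fin n → Fin n → Prop) (M : Fin n → Fin m → Prop)
    (k : ℕ) : ((State.step lt M)^[k] (State.init n m)).width ≤ m ∧
      ((State.step lt M)^[k] (State.init n m)).rounds ≤ k ∧
      ∀ v, ((State.step lt M)^[k] (State.init n m)).round v ≤ k := by
  induction k with
  | zero => exact ⟨le_rfl, le_rfl, fun v => le_rfl⟩
  | succ k ih =>
    rw [Function.iterate_succ_apply']
    set s := (State.step lt M)^[k] (State.init n m)
    obtain ⟨h1, h2, h3⟩ := ih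
    have hw : s.nextWidth M ≤ m := by
      unfold State.nextWidth
      split_ifs
      · exact h1
      · exact Clustering.num_le _
    have hr : (s.refresh M).rounds ≤ k + 1 := by
      simp only [State.refresh]
      split_ifs <;> omega
    unfold State.step
    split_ifs
    · refine ⟨?_, hr, fun v => ?_⟩
      · simp only [State.assign, State.refresh]
        split_ifs
        · exact h1
        · exact hw
      · simp only [State.assign]
        split_ifs
        · exact hr
        · exact (h3 v).trans (Nat.le_succ k)
    · exact ⟨h1, h2.trans (Nat.le_succ k), fun v => (h3 v).trans (Nat.le_succ k)⟩

theorem State.size_code_le {n m k : ℕ} {s : State n m} (h1 : s.width ≤ m) (h2 : s.rounds ≤ k)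
    (h3 : ∀ v, s.round v ≤ k) : s.code.size ≤
      (n * 4 + 1) + (n * ((m * 4 + 1) + 1) + 1) + (n * ((2 * k + 1) + 1) + 1) + (2 * m + 1) +
        (2 * k + 1) + 4 := by
  have hA : (tab fun v => bit (s.active v)).size ≤ n * 4 + 1 :=
    size_tab_le _ 3 fun v => size_bit_le _
  have hB : (tab fun v => tab fun i => bit (s.home v i)).size ≤ n * ((m * 4 + 1) + 1) + 1 :=
    size_tab_le _ _ fun v => size_tab_le _ 3 fun i => size_bit_le _
  have hC : (tab fun v => un (s.round v)).size ≤ n * ((2 * k + 1) + 1) + 1 :=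
    size_tab_le _ _ fun v => by rw [size_un]; have := h3 v; omega
  simp only [State.code, Data.size, size_un]
  omega

theorem polyTime_result (hn : PolyTime e (fun c => un (n c)))
    (hm : PolyTime e (fun c => un (m c))) (hlt : PolyTimeRel e n n lt)
    (hM : PolyTimeRel e n m M) : PolyTimeState e fun c => result (lt c) (M c) := by
  have hinit : PolyTimeState e fun c => State.init (n c) (m c) :=
    ⟨PolyTime.nil.congr fun _ => (bit_eq_nil.2 id).symm,
      PolyTime.nil.congr fun _ => (bit_eq_nil.2 id).symm, PolyTime.nil, hm, PolyTime.nil⟩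
  refine .of_code ((PolyTime.iter
    (s := fun c k => ((State.step (lt c) (M c))^[k] (State.init (n c) (m c))).code) hn
    (hinit.code hn hm) ?_ ⟨fun c => (n c * 4 + 1) + (n c * ((m c * 4 + 1) + 1) + 1) +
      (n c * ((2 * n c + 1) + 1) + 1) + (2 * m c + 1) + (2 * n c + 1) + 4, ?_, ?_⟩).congr
      fun c => by rw [len_un]; rfl)
  · have hs := PolyTimeState.of_code (PolyTime.refl (e := fun p : Γ × ℕ =>
      Data.cons (e p.1) ((State.step (lt p.1) (M p.1))^[p.2] (State.init (n p.1) (m p.1))).code)).snd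
    have h0 := (PolyTime.refl (e := fun p : Γ × ℕ =>
      Data.cons (e p.1) ((State.step (lt p.1) (M p.1))^[p.2] (State.init (n p.1) (m p.1))).code)).fst
    have hn' := hn.subst Prod.fst h0
    have hm' := hm.subst Prod.fst h0
    exact ((hs.step hn' hm' (hlt.subst Prod.fst h0) (hM.subst Prod.fst h0)).code hn' hm').congr
      fun p => by rw [Function.iterate_succ_apply']
  · have hN := hn.un_bound
    have hM' := hm.un_bound
    exact ((((((hN.mul (.const 4)).add (.const 1)).add ((hN.mul (((hM'.mul (.const 4)).add
      (.const 1)).add (.const 1))).add (.const 1))).add ((hN.mul ((((PolyBound.const 2).mul hN).add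
      (.const 1)).add (.const 1))).add (.const 1))).add (((PolyBound.const 2).mul hM').add
      (.const 1))).add (((PolyBound.const 2).mul hN).add (.const 1))).add (.const 4)
  · intro c k hk
    rw [len_un] at hk
    obtain ⟨h1, h2, h3⟩ := State.iterate_bound (lt c) (M c) k
    exact State.size_code_le h1 (h2.trans hk) fun v => (h3 v).trans hk

end

end Clustering

end Sched

namespace Sched

open Polynomial Data

/-! ## The schedule without duplicates is computed in polynomial time -/

section rat

variable {Γ : Type} {e : Γ → Data} {n n' : Γ → ℕ}

/-- A rational function of an index is computed in polynomial time. -/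
def PolyTimeFun (e : Γ → Data) (n : Γ → ℕ) (q : (c : Γ) → Fin (n c) → ℚ) : Prop :=
  PolyTimeRat (ext e n) (fun x => q x.1 x.2)

/-- A rational matrix is computed in polynomial time. -/
def PolyTimeMatrix (e : Γ → Data) (n n' : Γ → ℕ) (q : (c : Γ) → Fin (n c) → Fin (n' c) → ℚ) :
    Prop :=
  PolyTimeRat (ext (ext e n) fun x => n' x.1) (fun x => q x.1.1 x.1.2 x.2)

theorem PolyTimeFun.app {q : (c : Γ) → Fin (n c) → ℚ} (hq : PolyTimeFun e n q)
    {i : (c : Γ) → Fin (n c)} (hi : PolyTime e (fun c => un (i c))) :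
    PolyTimeRat e (fun c => q c (i c)) :=
  PolyTimeRat.subst hq (fun c => ⟨c, i c⟩) (PolyTime.refl.cons hi)

theorem PolyTimeFun.subst {q : (c : Γ) → Fin (n c) → ℚ} (hq : PolyTimeFun e n q) {Γ' : Type}
    {e' : Γ' → Data} (π : Γ' → Γ) (hπ : PolyTime e' (fun g => e (π g))) :
    PolyTimeFun e' (fun g => n (π g)) (fun g => q (π g)) :=
  PolyTimeRat.subst hq (fun x : (g : Γ') × Fin (n (π g)) => ⟨π x.1, x.2⟩)
    (hπ.weak.cons PolyTime.idx)

theorem PolyTimeFun.weak {q : (c : Γ) → Fin (n c) → ℚ} (hq : PolyTimeFun e n q) :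
    PolyTimeFun (ext e n') (fun x => n x.1) (fun x => q x.1) :=
  hq.subst Sigma.fst PolyTime.base

theorem PolyTimeMatrix.app {q : (c : Γ) → Fin (n c) → Fin (n' c) → ℚ}
    (hq : PolyTimeMatrix e n n' q) {i : (c : Γ) → Fin (n c)} {j : (c : Γ) → Fin (n' c)}
    (hi : PolyTime e (fun c => un (i c))) (hj : PolyTime e (fun c => un (j c))) :
    PolyTimeRat e (fun c => q c (i c) (j c)) :=
  PolyTimeRat.subst hq (fun c => ⟨⟨c, i c⟩, j c⟩) ((PolyTime.refl.cons hi).cons hj)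

theorem PolyTimeMatrix.subst {q : (c : Γ) → Fin (n c) → Fin (n' c) → ℚ}
    (hq : PolyTimeMatrix e n n' q) {Γ' : Type} {e' : Γ' → Data} (π : Γ' → Γ)
    (hπ : PolyTime e' (fun g => e (π g))) :
    PolyTimeMatrix e' (fun g => n (π g)) (fun g => n' (π g)) (fun g => q (π g)) :=
  PolyTimeRat.subst hq
    (fun x : (y : (g : Γ') × Fin (n (π g))) × Fin (n' (π y.1)) => ⟨⟨π x.1.1, x.1.2⟩, x.2⟩)
    ((hπ.weak.weak.cons PolyTime.idx.weak).cons PolyTime.idx)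

theorem PolyTimeMatrix.weak {k : Γ → ℕ} {q : (c : Γ) → Fin (n c) → Fin (n' c) → ℚ}
    (hq : PolyTimeMatrix e n n' q) :
    PolyTimeMatrix (ext e k) (fun x => n x.1) (fun x => n' x.1) (fun x => q x.1) :=
  hq.subst Sigma.fst PolyTime.base

variable {q : (c : Γ) → Fin (n c) → ℚ} {ρ : Γ → ℚ}

theorem polyTime_covered (hn : PolyTime e (fun c => un (n c))) (hq : PolyTimeFun e n q)
    (hρ : PolyTimeRat e ρ) {Λ : (c : Γ) → Fin (n c) → Prop} (hΛ : PolyTimeSet e n Λ)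
    {v : (c : Γ) → Fin (n c)} (hv : PolyTime e (fun c => un (v c))) :
    PolyTime e fun c => bit (Covered (q c) (ρ c) (Λ c) (v c)) :=
  PolyTime.ex hn (PolyTime.and hΛ (((hq.weak.app PolyTime.idx).le (hq.weak.app hv.weak)).and
    ((hq.weak.app hv.weak).le ((hq.weak.app PolyTime.idx).add hρ.weak))))

theorem polyTime_leaders (hn : PolyTime e (fun c => un (n c))) (hq : PolyTimeFun e n q)
    (hρ : PolyTimeRat e ρ) : PolyTimeSet e n fun c => leaders (q c) (ρ c) := by
  have h : PolyTime e (fun c => tab fun v =>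
      bit ((addLeaders (q c) (ρ c))^[(un (n c)).len] (fun _ => False) v)) := by
    refine PolyTime.iter
      (s := fun c k => tab fun v => bit ((addLeaders (q c) (ρ c))^[k] (fun _ => False) v)) hn
      (hn.tab (PolyTime.nil.congr fun _ => (bit_eq_nil.2 id).symm)) ?_ ⟨fun c => n c * 4 + 1,
        (hn.un_bound.mul (.const 4)).add (.const 1), fun c k _ =>
          size_tab_le _ 3 fun v => size_bit_le _⟩
    have h := PolyTime.refl (e := fun p : Γ × ℕ => Data.cons (e p.1)
      (tab fun v => bit ((addLeaders (q p.1) (ρ p.1))^[p.2] (fun _ => False) v)))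
    have hΛ := PolyTimeSet.of_tab h.snd
    have hn' := hn.subst Prod.fst h.fst
    have hq' := hq.subst Prod.fst h.fst
    have hρ' := hρ.subst Prod.fst h.fst
    have hstep : PolyTimeSet _ _ fun p : Γ × ℕ => addLeaders (q p.1) (ρ p.1)
        ((addLeaders (q p.1) (ρ p.1))^[p.2] (fun _ => False)) :=
      PolyTime.or hΛ ((polyTime_covered hn'.weak hq'.weak hρ'.weak hΛ.weak PolyTime.idx).not.and
        (PolyTime.all hn'.weak (PolyTime.imp
          (polyTime_covered hn'.weak.weak hq'.weak.weak hρ'.weak.weak hΛ.weak.weak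
            PolyTime.idx).not
          ((hq'.weak.weak.app PolyTime.idx.weak).le (hq'.weak.weak.app PolyTime.idx)))))
    exact (hstep.tab hn').congr fun p => by rw [Function.iterate_succ_apply']
  exact .of_tab (h.congr fun c => by rw [len_un]; rfl)

/-- A search for some leader replaces the noncomputable choice; the value found is the right one by
`windowStart_eq`. -/
theorem polyTime_windowStart (hn : PolyTime e (fun c => un (n c))) (hq : PolyTimeFun e n q)
    (hρ : PolyTimeRat e ρ) (h0 : ∀ c, 0 ≤ ρ c) :
    PolyTimeFun e n fun c => windowStart (q c) (ρ c) := by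
  refine PolyTimeRat.sel (n := fun x : (c : Γ) × Fin (n c) => n x.1)
    (p := fun x a => leaders (q x.1) (ρ x.1) a ∧ q x.1 a ≤ q x.1 x.2 ∧
      q x.1 x.2 ≤ q x.1 a + ρ x.1) (r := fun x a => q x.1 a) hn.weak ?_ hq.weak
    (fun x => (leaders_spec (h0 x.1)).1 x.2) fun x a ha => windowStart_eq (h0 x.1) ha.1 ha.2.1 ha.2.2
  exact PolyTime.and (polyTime_leaders hn hq hρ).weak
    (((hq.weak.weak.app PolyTime.idx).le (hq.weak.weak.app PolyTime.idx.weak)).and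
      ((hq.weak.weak.app PolyTime.idx.weak).le
        ((hq.weak.weak.app PolyTime.idx).add hρ.weak.weak)))

theorem codesRat_frac {a b : ℕ} (hb : b ≠ 0) {q : ℚ} (hq : q = (a : ℚ) / (b : ℚ)) :
    (frac a b).CodesRat q :=
  ⟨Data.nil, bin a, bin b, rfl, by rwa [toNat_bin], Or.inl ⟨rfl, by rw [toNat_bin, toNat_bin, hq]⟩⟩

theorem codesTime_ne_nil {x : Data} {t : Option ℚ} (h : x.CodesTime t) :
    x ≠ Data.nil ↔ t ≠ none := by
  cases t with
  | none => exact ⟨fun hx => absurd h hx, fun ht => absurd rfl ht⟩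
  | some q =>
    obtain ⟨_, _, _, rfl, _⟩ := h
    simp

/-- The sign may be dropped: a nonnegative number coded with a minus sign is zero. -/
theorem PolyTimeRat.of_code {x : Γ → Data} {q : Γ → ℚ} (hx : PolyTime e x)
    (h : ∀ c, (x c).CodesRat (q c)) (h0 : ∀ c, 0 ≤ q c) : PolyTimeRat e q := by
  refine .mk hx.fst.snd.toNat hx.snd.toNat (fun c => ?_) fun c => ?_
  · obtain ⟨_, _, _, hc, hb, _⟩ := h c
    rw [hc]
    exact hb
  · obtain ⟨_, a, b, hc, hb, ⟨_, hq⟩ | ⟨_, hq⟩⟩ := h c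
    · rw [hc]
      exact hq
    · rw [hc]
      have h1 : (0 : ℚ) ≤ (a.toNat : ℚ) / (b.toNat : ℚ) := by positivity
      have h2 := h0 c
      have h3 : q c = (a.toNat : ℚ) / (b.toNat : ℚ) := by linarith
      exact h3

theorem _root_.Sched.Data.CodesFun.len_eq {α : Type} {R : Data → α → Prop} {k : ℕ} {x : Data}
    {f : Fin k → α} (h : CodesFun R x f) : x.len = k :=
  (List.Forall₂.length_eq h).trans List.length_ofFn

theorem _root_.Sched.Data.CodesFun.nth {α : Type} {R : Data → α → Prop} {k : ℕ} {x : Data}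
    {f : Fin k → α} (h : CodesFun R x f) (i : Fin k) : R (Data.nth i x) (f i) := by
  have h1 : (i : ℕ) < x.toList.length := h.len_eq.symm ▸ i.2
  have h2 := List.Forall₂.get h h1 (by rw [List.length_ofFn]; exact i.2)
  rw [nth_eq_getElem h1]
  simpa using h2

theorem codesFun_tab {α : Type} {R : Data → α → Prop} {k : ℕ} {g : Fin k → Data} {f : Fin k → α}
    (h : ∀ i, R (g i) (f i)) : CodesFun R (Data.tab g) f := by
  unfold CodesFun
  rw [toList_tab, List.forall₂_iff_get]
  exact ⟨by simp, fun i h1 h2 => by simpa using h _⟩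

end rat

namespace Instance

variable {Γ : Type} {e : Γ → Data} {n m : Γ → ℕ} {I : (c : Γ) → Instance ℚ (n c) (m c)}
  {σ : (c : Γ) → Assignment ℚ (n c) (m c)}

/-- The data of an instance and of an assignment are computed in polynomial time. -/
structure PolyTimeInput (e : Γ → Data) (I : (c : Γ) → Instance ℚ (n c) (m c))
    (σ : (c : Γ) → Assignment ℚ (n c) (m c)) : Prop where
  jobs : PolyTime e fun c => un (n c)
  machines : PolyTime e fun c => un (m c)
  size : PolyTimeFun e n fun c => (I c).size
  speed : PolyTimeFun e m fun c => (I c).speed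
  delay : PolyTimeRat e fun c => (I c).delay
  copy : PolyTimeRel e n m fun c v i => σ c v i ≠ none
  start : PolyTimeMatrix e n m fun c => Instance.start (σ c)

namespace PolyTimeInput

variable (h : PolyTimeInput e I σ) (hσ : ∀ c, (I c).IsSchedule (σ c))

include h

theorem finish : PolyTimeMatrix e n m fun c => (I c).finish (σ c) := by
  have h1 : PolyTimeMatrix e n m fun c => (I c).runTime :=
    PolyTimeRat.div (h.size.weak.weak.app PolyTime.idx.weak) (h.speed.weak.weak.app PolyTime.idx)
      fun x => ((I x.1.1).speed_pos x.2).ne'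
  exact PolyTimeRat.add h.start h1

theorem isFirst : PolyTimeRel e n m fun c => (I c).IsFirst (σ c) :=
  PolyTime.and h.copy (PolyTime.all h.machines.weak.weak (PolyTime.imp
    (h.copy.weak.weak.weak.app PolyTime.idx.weak.weak PolyTime.idx)
    ((h.finish.weak.weak.weak.app PolyTime.idx.weak.weak PolyTime.idx.weak).le
      (h.finish.weak.weak.weak.app PolyTime.idx.weak.weak PolyTime.idx))))

include hσ

theorem earliest : PolyTimeFun e n fun c => (I c).earliest (σ c) :=
  PolyTimeRat.sel (p := fun x : (c : Γ) × Fin (n c) => (I x.1).IsFirst (σ x.1) x.2)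
    (r := fun x => (I x.1).finish (σ x.1) x.2)
    h.machines.weak h.isFirst h.finish (fun x => exists_isFirst (hσ x.1) x.2)
    fun x _ hi => earliest_eq (hσ x.1) hi

theorem window : PolyTimeFun e n fun c => (I c).window (σ c) :=
  polyTime_windowStart h.jobs (h.earliest hσ) h.delay fun c => (I c).delay_nonneg

theorem crossing : PolyTimeSet e n fun c => (I c).Crossing (σ c) :=
  PolyTime.ex h.machines.weak (PolyTime.and h.copy (PolyTime.and
    (PolyTimeRat.lt h.start (PolyTimeRat.weak (h.window hσ)))
    (PolyTimeRat.le h.finish ((PolyTimeRat.weak (h.window hσ)).add h.delay.weak.weak))))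

theorem usable : PolyTimeRel e n m fun c => (I c).Usable (σ c) :=
  PolyTime.and h.copy (PolyTime.and
    (PolyTimeRat.le h.finish ((PolyTimeRat.weak (h.window hσ)).add h.delay.weak.weak))
    (PolyTime.imp (PolyTime.weak (h.crossing hσ))
      (PolyTimeRat.lt h.start (PolyTimeRat.weak (h.window hσ)))))

/-- `Before` speaks only of times and usable copies, not of edges. So the algorithm never reads the
precedence graph, and no transitive closure has to be computed. -/
theorem before : PolyTimeRel e n n fun c => (I c).Before (σ c) :=
  PolyTime.and (((h.window hσ).weak.weak.app PolyTime.idx.weak).eq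
    ((h.window hσ).weak.weak.app PolyTime.idx)) (PolyTime.and
    ((h.crossing hσ).weak.weak.app PolyTime.idx.weak).not (PolyTime.and
    ((h.crossing hσ).weak.weak.app PolyTime.idx).not (PolyTime.all h.machines.weak.weak
    (PolyTime.imp ((h.usable hσ).weak.weak.weak.app PolyTime.idx.weak PolyTime.idx)
    (((h.usable hσ).weak.weak.weak.app PolyTime.idx.weak.weak PolyTime.idx).and
    ((h.finish.weak.weak.weak.app PolyTime.idx.weak.weak PolyTime.idx).le
      (h.start.weak.weak.weak.app PolyTime.idx.weak PolyTime.idx)))))))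

theorem plan : Clustering.PolyTimeState e fun c => (I c).plan (σ c) :=
  Clustering.polyTime_result h.jobs h.machines (h.before hσ) (h.usable hσ)

theorem newStart : PolyTimeMatrix e n m fun c => (I c).newStart (σ c) := by
  have key : ∀ {a : Γ → ℕ}, PolyTime e (fun c => un (a c)) → ∀ k : ℕ,
      PolyTimeRat e fun c => ((2 * a c + k : ℕ) : ℚ) := fun ha k =>
    PolyTimeRat.nat (((ha.un_add ha).un_add (PolyTime.const (un k))).congr fun c => by
      rw [two_mul])
  have h3 := (key (h.plan hσ).rounds 3).weak (n := n) |>.weak (n := fun x => m x.1)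
  have h5 := (key (h.plan hσ).rounds 5).weak (n := n) |>.weak (n := fun x => m x.1)
  have h6 := (key (h.plan hσ).rounds 6).weak (n := n) |>.weak (n := fun x => m x.1)
  have hr : PolyTimeRat (ext (ext e n) fun x => m x.1)
      fun x => ((2 * ((I x.1.1).plan (σ x.1.1)).round x.1.2 : ℕ) : ℚ) :=
    PolyTimeRat.nat (a := fun x : (x : (c : Γ) × Fin (n c)) × Fin (m x.1) =>
      2 * ((I x.1.1).plan (σ x.1.1)).round x.1.2)
      (((h.plan hσ).round.un_add (h.plan hσ).round).weak.congr fun c => by rw [two_mul])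
  have hw : PolyTimeRat (ext (ext e n) fun x => m x.1)
    fun x => (I x.1.1).window (σ x.1.1) x.1.2 := PolyTimeRat.weak (h.window hσ)
  have hd := h.delay.weak (n := n) |>.weak (n := fun x => m x.1)
  have hs : PolyTimeRat (ext (ext e n) fun x => m x.1)
    fun x => Instance.start (σ x.1.1) x.1.2 x.2 := h.start
  have hc : PolyTime (ext (ext e n) fun x => m x.1)
    fun x => bit ((I x.1.1).Crossing (σ x.1.1) x.1.2) := PolyTime.weak (h.crossing hσ)
  exact PolyTimeRat.congr (PolyTimeRat.ite hc (((h6.mul (hs.add hd)).min (h6.mul hw)).add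
    (h3.mul hd)) ((((h5.mul hw).add (hr.mul hd)).add hs).add (h6.mul hd))) fun x => rfl

theorem unduplicated : ∃ F : Γ → Data, PolyTime e F ∧
    ∀ c, (F c).CodesAssignment ((I c).unduplicated (σ c)) := by
  classical
  obtain ⟨a, b, h0, hq, hab⟩ := h.newStart hσ
  have h1 : PolyTime (ext e n) fun x => tab fun i => if ((I x.1).plan (σ x.1)).home x.2 i then
      frac (a ⟨x, i⟩) (b ⟨x, i⟩) else Data.nil :=
    PolyTime.tab h.machines.weak ((PolyTime.ite (h.plan hσ).home hab PolyTime.nil).congr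
      fun x => by split_ifs <;> rfl)
  refine ⟨_, PolyTime.tab (g := fun c v => tab fun i => if ((I c).plan (σ c)).home v i then
      frac (a ⟨⟨c, v⟩, i⟩) (b ⟨⟨c, v⟩, i⟩) else Data.nil) h.jobs h1, fun c =>
    codesFun_tab fun v => codesFun_tab fun i => ?_⟩
  unfold Instance.unduplicated
  split_ifs with hh
  · exact codesRat_frac (h0 _) (hq ⟨⟨c, v⟩, i⟩)
  · rfl

end PolyTimeInput

end Instance

/-! ## Reading the input -/

/-- Inputs of the algorithm. -/
structure Input where
  n : ℕ
  m : ℕ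
  inst : Instance ℚ n m
  assignment : Assignment ℚ n m
  code : Data
  isSchedule : inst.IsSchedule assignment
  codes : code.CodesInput inst assignment

theorem Input.polyTimeInput :
    Instance.PolyTimeInput Input.code Input.inst Input.assignment := by
  have hx := PolyTime.refl (e := Input.code)
  have h1 : ∀ c : Input, CodesFun CodesRat c.code.fst.snd.fst c.inst.size := by
    intro c
    obtain ⟨_, _, hc, ⟨_, _, _, _, rfl, _, h, _⟩, _⟩ := c.codes
    rw [hc]
    exact h
  have h2 : ∀ c : Input, CodesFun CodesRat c.code.fst.snd.snd.fst c.inst.speed := by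
    intro c
    obtain ⟨_, _, hc, ⟨_, _, _, _, rfl, _, _, h, _⟩, _⟩ := c.codes
    rw [hc]
    exact h
  have h3 : ∀ c : Input, CodesRat c.code.fst.snd.snd.snd c.inst.delay := by
    intro c
    obtain ⟨_, _, hc, ⟨_, _, _, _, rfl, _, _, _, h⟩, _⟩ := c.codes
    rw [hc]
    exact h
  have h4 : ∀ c : Input, CodesAssignment c.code.snd c.assignment := by
    intro c
    obtain ⟨_, _, hc, _, h⟩ := c.codes
    rw [hc]
    exact h
  have ht : PolyTime (ext (ext Input.code Input.n) fun x => x.1.m)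
      fun x => nth x.2 (nth x.1.2 x.1.1.code.snd) :=
    (hx.snd.weak.weak.nth PolyTime.idx.weak).nth PolyTime.idx
  have ht' : ∀ x : (x : (c : Input) × Fin c.n) × Fin x.1.m,
      CodesTime (nth x.2 (nth x.1.2 x.1.1.code.snd)) (x.1.1.assignment x.1.2 x.2) :=
    fun x => ((h4 x.1.1).nth x.1.2).nth x.2
  have hcopy : PolyTimeRel Input.code Input.n Input.m fun c v i => c.assignment v i ≠ none :=
    ht.bit_ne_nil.bit_iff fun x => codesTime_ne_nil (ht' x)
  refine ⟨hx.fst.snd.fst.un_len.congr fun c => by rw [(h1 c).len_eq],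
    hx.fst.snd.snd.fst.un_len.congr fun c => by rw [(h2 c).len_eq],
    .of_code (hx.fst.snd.fst.weak.nth PolyTime.idx) (fun x => (h1 x.1).nth x.2)
      fun x => (x.1.inst.size_pos _).le,
    .of_code (hx.fst.snd.snd.fst.weak.nth PolyTime.idx) (fun x => (h2 x.1).nth x.2)
      fun x => (x.1.inst.speed_pos _).le,
    .of_code hx.fst.snd.snd.snd h3 fun c => c.inst.delay_nonneg, hcopy, ?_⟩
  classical
  -- The atom is not the code of a rational; a missing copy is read as `0`, which agrees with `getD
  -- 0` in `start`.
  refine .of_code (hcopy.ite ht (PolyTime.const (frac 0 1))) (fun x => ?_) fun x => ?_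
  · have h5 := ht' x
    dsimp only [Instance.start]
    split_ifs with h
    · obtain ⟨t, h⟩ := Option.ne_none_iff_exists'.1 h
      rw [h] at h5 ⊢
      exact h5
    · rw [not_not.1 h]
      exact codesRat_frac one_ne_zero (by simp)
  · dsimp only [Instance.start]
    cases h : x.1.1.assignment x.1.2 x.2 with
    | none => exact le_rfl
    | some t => exact x.1.1.isSchedule.start_nonneg _ _ _ h

/-- The inputs of all dimensions form one type of situations, which is why a single program and a
single polynomial serve all of them. -/
theorem exists_unduplicated_program : ∃ (P : Prog) (q : ℕ[X]), ∀ c : Input, ∃ (y : Data) (t : ℕ),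
    Runs P c.code y t ∧ t ≤ q.eval c.code.size ∧
      y.CodesAssignment (c.inst.unduplicated c.assignment) := by
  obtain ⟨F, ⟨P, q, h⟩, hF⟩ := Input.polyTimeInput.unduplicated Input.isSchedule
  refine ⟨P, q, fun c => ?_⟩
  obtain ⟨t, ht, ht'⟩ := h c
  exact ⟨_, t, ht, ht', hF c⟩

end Sched

namespace Sched

/-! ## The lower bound: complete binary trees -/

/-- The number of binary digits is the depth in the tree: passing to the parent deletes the last
digit. -/
theorem size_eq_size_half {v : ℕ} (hv : v ≠ 0) : Nat.size v = Nat.size (v / 2) + 1 := by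
  refine le_antisymm ?_ ?_
  · rw [Nat.size_le, pow_succ]
    have := Nat.lt_size_self (v / 2)
    omega
  · rw [Nat.add_one_le_iff, Nat.lt_size]
    rcases h : Nat.size (v / 2) with _ | p
    · simpa using Nat.one_le_iff_ne_zero.2 hv
    · have h1 : 2 ^ p ≤ v / 2 := Nat.lt_size.1 (by omega)
      rw [pow_succ]
      omega

theorem size_eq_of_div_pow {v w k : ℕ} (hv : v ≠ 0) (h : w / 2 ^ k = v) :
    Nat.size w = Nat.size v + k := by
  induction k generalizing w with
  | zero => simp at h; rw [h]; rfl
  | succ k ih =>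
    rw [pow_succ', ← Nat.div_div_eq_div_mul] at h
    have hw : w ≠ 0 := by rintro rfl; simp at h; exact hv h.symm
    rw [size_eq_size_half hw, ih h]
    rfl

/-- A root with a complete binary tree of height `ρ` below it: the children of `u` are the jobs
`v ≠ 0` with `v / 2 = u`. -/
def binaryTree (ρ : ℕ) : Instance ℝ (2 * 2 ^ ρ) (2 ^ ρ) where
  edge u v := (v : ℕ) ≠ 0 ∧ (u : ℕ) = v / 2
  acyclic v h := by
    have key : ∀ u w : Fin (2 * 2 ^ ρ),
        Relation.TransGen (fun u v : Fin (2 * 2 ^ ρ) => (v : ℕ) ≠ 0 ∧ (u : ℕ) = v / 2) u w →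
        u < w := by
      intro u w h
      induction h with
      | single h => rw [Fin.lt_def]; omega
      | tail _ h ih => rw [Fin.lt_def] at *; omega
    exact lt_irrefl v (key v v h)
  size _ := 1
  size_pos _ := one_pos
  speed _ := 1
  speed_pos _ := one_pos
  delay := ρ
  delay_nonneg := ρ.cast_nonneg

namespace binaryTree

variable {ρ : ℕ}

@[simp] theorem runTime_eq (v : Fin (2 * 2 ^ ρ)) (i : Fin (2 ^ ρ)) :
    (binaryTree ρ).runTime v i = 1 := div_one 1

theorem size_le (v : Fin (2 * 2 ^ ρ)) : Nat.size v ≤ ρ + 1 := by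
  rw [Nat.size_le, pow_succ']
  exact v.2

theorem isBinaryOutTree : (binaryTree ρ).IsBinaryOutTree := by
  have h0 : 0 < 2 * 2 ^ ρ := by positivity
  refine ⟨⟨⟨0, h0⟩, ?_⟩, fun u u' v h h' => Fin.ext (h.2.trans h'.2.symm), fun u => ?_⟩
  · rintro ⟨v, hv⟩
    induction v using Nat.strong_induction_on with
    | _ v ih =>
      intro hne
      have hv0 : v ≠ 0 := fun h => hne (Fin.ext h)
      have he : (binaryTree ρ).edge ⟨v / 2, by omega⟩ ⟨v, hv⟩ := ⟨hv0, rfl⟩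
      by_cases h : v / 2 = 0
      · refine Relation.TransGen.single ?_
        convert he
        exact h.symm
      · exact (ih (v / 2) (by omega) (by omega) fun h' => h (congrArg Fin.val h')).tail he
  · refine (Set.ncard_le_ncard_of_injOn (t := (({2 * (u : ℕ), 2 * (u : ℕ) + 1} : Finset ℕ) : Set ℕ))
      Fin.val (fun v hv => ?_) Fin.val_injective.injOn (Finset.finite_toSet _)).trans ?_
    · have h1 := hv.2
      simp only [Finset.coe_insert, Finset.coe_singleton, Set.mem_insert_iff,
        Set.mem_singleton_iff]
      omega
    · rw [Set.ncard_coe_finset]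
      exact Finset.card_le_two

theorem pred_of_div_pow {v w : Fin (2 * 2 ^ ρ)} {k : ℕ} (hk : k ≠ 0) (hv : (v : ℕ) ≠ 0)
    (h : (w : ℕ) / 2 ^ k = v) : (binaryTree ρ).Pred v w := by
  induction k generalizing w with
  | zero => exact absurd rfl hk
  | succ k ih =>
    rw [pow_succ', ← Nat.div_div_eq_div_mul] at h
    have hw : (w : ℕ) ≠ 0 := fun h0 => hv (by rw [← h, h0]; simp)
    have he : (binaryTree ρ).edge ⟨w / 2, by omega⟩ w := ⟨hw, rfl⟩
    rcases eq_or_ne k 0 with rfl | hk'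
    · refine Relation.TransGen.single ?_
      convert he
      simpa using h.symm
    · exact (ih (w := ⟨w / 2, by omega⟩) hk' h).tail he

/-! ### The optimum with duplication -/

/-- The leaf `2 ^ ρ + i` is a descendant of `v`. -/
def Above (v : Fin (2 * 2 ^ ρ)) (i : Fin (2 ^ ρ)) : Prop :=
  (v : ℕ) = (2 ^ ρ + i) / 2 ^ (ρ + 1 - Nat.size v)

open Classical in
/-- Every machine runs the path to a leaf. -/
noncomputable def paths (ρ : ℕ) : Assignment ℝ (2 * 2 ^ ρ) (2 ^ ρ) := fun v i =>
  if Above v i then some (Nat.size v : ℝ) else none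

theorem paths_eq_some {v : Fin (2 * 2 ^ ρ)} {i : Fin (2 ^ ρ)} {t : ℝ} :
    paths ρ v i = some t ↔ Above v i ∧ (Nat.size v : ℝ) = t := by
  unfold paths
  split_ifs with h <;> simp [h]

theorem above_of_pred {u v : Fin (2 * 2 ^ ρ)} {i : Fin (2 ^ ρ)} (h : (binaryTree ρ).Pred u v)
    (hv : Above v i) : Above u i ∧ Nat.size u + 1 ≤ Nat.size v := by
  have key : ∀ {u v : Fin (2 * 2 ^ ρ)}, (binaryTree ρ).edge u v → Above v i →
      Above u i ∧ Nat.size u + 1 ≤ Nat.size v := by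
    rintro u v ⟨h0, h1⟩ h2
    have h3 := size_eq_size_half h0
    rw [← h1] at h3
    refine ⟨?_, h3.ge⟩
    have h4 := size_le v
    unfold Above at h2 ⊢
    have h5 : ρ + 1 - Nat.size u = ρ + 1 - Nat.size v + 1 := by omega
    rw [h5, pow_succ, ← Nat.div_div_eq_div_mul, ← h2, h1]
  induction h with
  | single h => exact key h hv
  | tail _ h ih =>
    obtain ⟨h1, h2⟩ := key h hv
    obtain ⟨h3, h4⟩ := ih h1
    exact ⟨h3, by omega⟩

theorem exists_above (v : Fin (2 * 2 ^ ρ)) : ∃ i, Above v i := by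
  have hv := v.2
  rcases eq_or_ne (v : ℕ) 0 with h0 | h0
  -- Job `0` has depth `0`, so all `ρ + 1` digits of a leaf are deleted, and job `0` is above every
  -- leaf.
  · refine ⟨⟨0, by positivity⟩, ?_⟩
    unfold Above
    rw [h0, Nat.size_zero, Nat.sub_zero, Nat.div_eq_of_lt]
    rw [pow_succ']
    have : 0 < 2 ^ ρ := by positivity
    simp only
    omega
  · have h1 := size_le v
    have h2 := Nat.lt_size_self (v : ℕ)
    obtain ⟨p, hp⟩ : ∃ p, Nat.size v = p + 1 := ⟨_, size_eq_size_half h0⟩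
    have h3 : 2 ^ p ≤ (v : ℕ) := Nat.lt_size.1 (by omega)
    have h4 : 2 ^ p * 2 ^ (ρ - p) = 2 ^ ρ := by rw [← pow_add]; congr 1; omega
    have h5 : 2 ^ ρ ≤ (v : ℕ) * 2 ^ (ρ - p) := h4.ge.trans (Nat.mul_le_mul_right _ h3)
    have h6 : (v : ℕ) * 2 ^ (ρ - p) < 2 * 2 ^ ρ := by
      have h7 := Nat.mul_lt_mul_of_pos_right h2 (show 0 < 2 ^ (ρ - p) by positivity)
      rw [hp, pow_succ', mul_assoc, h4] at h7
      exact h7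
    -- The leftmost leaf below `v`: its digits are those of `v` padded with zeros.
    refine ⟨⟨(v : ℕ) * 2 ^ (ρ - p) - 2 ^ ρ, by omega⟩, ?_⟩
    unfold Above
    simp only
    rw [Nat.add_sub_cancel' h5, hp, Nat.add_sub_add_right, Nat.mul_div_cancel _ (by positivity)]

theorem paths_isSchedule : (binaryTree ρ).IsSchedule (paths ρ) := by
  refine ⟨fun v => ?_, fun v i t h => ?_, fun i u v s t huv hs ht => ?_, fun u v i t huv ht => ?_⟩
  · obtain ⟨i, hi⟩ := exists_above v
    exact ⟨i, _, paths_eq_some.2 ⟨hi, rfl⟩⟩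
  · obtain ⟨-, rfl⟩ := paths_eq_some.1 h
    exact Nat.cast_nonneg _
  · obtain ⟨h1, rfl⟩ := paths_eq_some.1 hs
    obtain ⟨h2, rfl⟩ := paths_eq_some.1 ht
    simp only [runTime_eq]
    norm_cast
    by_contra! h
    have h3 : Nat.size u = Nat.size v := by omega
    refine huv (Fin.ext ?_)
    unfold Above at h1 h2
    rw [h1, h2, h3]
  · obtain ⟨h1, rfl⟩ := paths_eq_some.1 ht
    obtain ⟨h2, h3⟩ := above_of_pred huv h1
    refine Or.inl ⟨_, paths_eq_some.2 ⟨h2, rfl⟩, ?_⟩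
    rw [runTime_eq]
    exact_mod_cast h3

/-- Even with duplication a job starts at least one unit after some copy of its parent starts, so
the depth bounds the start time. -/
theorem size_le_start {σ : Assignment ℝ (2 * 2 ^ ρ) (2 ^ ρ)} (hσ : (binaryTree ρ).IsSchedule σ)
    (v : Fin (2 * 2 ^ ρ)) : ∀ (i : Fin (2 ^ ρ)) (t : ℝ), σ v i = some t → (Nat.size v : ℝ) ≤ t := by
  obtain ⟨v, hv⟩ := v
  induction v using Nat.strong_induction_on with
  | _ v ih =>
    intro i t h
    rcases eq_or_ne v 0 with rfl | h0
    · simpa using hσ.start_nonneg _ _ _ h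
    · have he : (binaryTree ρ).edge ⟨v / 2, by omega⟩ ⟨v, hv⟩ := ⟨h0, rfl⟩
      have hs := size_eq_size_half h0
      simp only
      rw [hs]
      push_cast
      rcases hσ.precedence _ _ _ _ (Relation.TransGen.single he) h with
        ⟨s, h1, h2⟩ | ⟨j, s, -, h1, h2⟩
      · have := ih (v / 2) (by omega) _ _ _ h1
        rw [runTime_eq] at h2
        simp only at this
        linarith
      · have := ih (v / 2) (by omega) _ _ _ h1
        have hd := (binaryTree ρ).delay_nonneg
        rw [runTime_eq] at h2
        simp only at this
        linarith

theorem size_two_pow : Nat.size (2 ^ ρ) = ρ + 1 := Nat.size_pow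

theorem isOptimalMakespan : (binaryTree ρ).IsOptimalMakespan (ρ + 2) := by
  have hlt : 2 ^ ρ < 2 * 2 ^ ρ := by have : 0 < 2 ^ ρ := by positivity
                                     omega
  refine ⟨⟨paths ρ, paths_isSchedule, ⟨⟨2 ^ ρ, hlt⟩, ⟨0, by positivity⟩, ρ + 1,
    paths_eq_some.2 ⟨?_, ?_⟩, ?_⟩, ?_⟩, ?_⟩
  · unfold Above
    simp [size_two_pow]
  · simp [size_two_pow]
  · rw [runTime_eq]
    ring
  · rintro _ ⟨v, i, t, h, rfl⟩
    obtain ⟨-, rfl⟩ := paths_eq_some.1 h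
    have h1 : (Nat.size v : ℝ) ≤ ρ + 1 := by exact_mod_cast size_le v
    rw [runTime_eq]
    linarith
  · rintro C ⟨σ, hσ, hC⟩
    obtain ⟨i, t, h⟩ := hσ.scheduled ⟨2 ^ ρ, hlt⟩
    have h1 := size_le_start hσ _ _ _ h
    have h2 := hC.2 ⟨_, _, _, h, rfl⟩
    simp only [size_two_pow, runTime_eq] at h1 h2
    push_cast at h1
    linarith

/-! ### Schedules without duplication -/

/-- Pigeonhole: a descendant on a machine other than that of the only copy of `v` starts at time `t
+ 1 + ρ` or later. If all `2 ^ k` descendants started before `t + ρ`, they would run on one machine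
and start in `[t + 1, t + ρ)`, which has room for `ρ - 1` unit jobs. -/
theorem exists_late_descendant {τ : Assignment ℝ (2 * 2 ^ ρ) (2 ^ ρ)}
    (hτ : (binaryTree ρ).IsNoDupSchedule τ) {k : ℕ} (hk : ρ < 2 ^ k) {v : Fin (2 * 2 ^ ρ)}
    (hv : (v : ℕ) ≠ 0) (hvk : Nat.size v + k ≤ ρ + 1) {i : Fin (2 ^ ρ)} {t : ℝ}
    (ht : τ v i = some t) : ∃ w j s, τ w j = some s ∧ (w : ℕ) ≠ 0 ∧
      Nat.size w = Nat.size v + k ∧ t + ρ ≤ s := by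
  by_contra! hcon
  -- For `k = 0` the descendant would be `v` itself, not a proper one; this forces `ρ = 0`, where
  -- the claim is trivial.
  have hk0 : k ≠ 0 ∨ ρ = 0 := by
    rcases eq_or_ne k 0 with rfl | h
    · right; simpa using hk
    · exact Or.inl h
  rcases hk0 with hk0 | rfl
  swap
  · have hk' : k = 0 := by
      have := (size_eq_size_half hv)
      omega
    subst hk'
    exact absurd (hcon v i t ht hv rfl) (by simp)
  have hlt : ∀ j : Fin (2 ^ k), (v : ℕ) * 2 ^ k + j < 2 * 2 ^ ρ := by
    intro j
    have h1 : (v : ℕ) + 1 ≤ 2 ^ Nat.size v := Nat.lt_size_self _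
    have h2 : 2 ^ (Nat.size (v : ℕ) + k) ≤ 2 ^ (ρ + 1) := Nat.pow_le_pow_right (by norm_num) hvk
    have h3 := Nat.mul_le_mul_right (2 ^ k) h1
    rw [← pow_add, add_mul] at h3
    rw [pow_succ'] at h2
    have := j.2
    omega
  let w : Fin (2 ^ k) → Fin (2 * 2 ^ ρ) := fun j => ⟨(v : ℕ) * 2 ^ k + j, hlt j⟩
  have hw : ∀ j, (w j : ℕ) / 2 ^ k = v := by
    intro j
    rw [show (w j : ℕ) = j + 2 ^ k * v by simp only [w]; ring,
      Nat.add_mul_div_left _ _ (by positivity), Nat.div_eq_of_lt j.2, zero_add]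
  have hw0 : ∀ j, (w j : ℕ) ≠ 0 := fun j h0 => hv (by rw [← hw j, h0]; simp)
  have hpos : (binaryTree ρ).delay = ρ := rfl
  have hstart : ∀ j, ∃ s, τ (w j) i = some s ∧ t + 1 ≤ s ∧ s < t + ρ := by
    intro j
    obtain ⟨i', s, hs⟩ := hτ.1.scheduled (w j)
    have h1 := hcon _ _ _ hs (hw0 j) (size_eq_of_div_pow hv (hw j))
    obtain ⟨i₀, -, huniq⟩ := hτ.2 v
    rcases hτ.1.precedence _ _ _ _ (pred_of_div_pow hk0 hv (hw j)) hs with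
      ⟨s', h2, h3⟩ | ⟨j', s', -, h2, h3⟩
    · have h4 : i' = i := (huniq i' (by simp [h2])).trans (huniq i (by simp [ht])).symm
      subst h4
      rw [ht] at h2
      obtain rfl := Option.some.inj h2
      rw [runTime_eq] at h3
      exact ⟨s, hs, h3, h1⟩
    · have h4 : j' = i := (huniq j' (by simp [h2])).trans (huniq i (by simp [ht])).symm
      subst h4
      rw [ht] at h2
      obtain rfl := Option.some.inj h2
      rw [runTime_eq, hpos] at h3
      linarith
  choose s hs h1 h2 using hstart
  -- Start times of unit jobs on one machine differ by at least one, so rounding down separates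
  -- them.
  have hfloor : ∀ j, ⌊s j - t⌋₊ ∈ Finset.Ico 1 ρ := by
    intro j
    rw [Finset.mem_Ico]
    constructor
    · exact Nat.le_floor (by push_cast; linarith [h1 j])
    · rw [Nat.floor_lt (by linarith [h1 j])]
      linarith [h2 j]
  have hinj : Function.Injective fun j => ⌊s j - t⌋₊ := by
    intro a b hab
    by_contra hne
    have hwne : w a ≠ w b := fun h => hne (Fin.ext (by simpa [w] using h))
    have ha1 := Nat.floor_le (a := s a - t) (by linarith [h1 a])
    have ha2 := Nat.lt_floor_add_one (s a - t)
    have hb1 := Nat.floor_le (a := s b - t) (by linarith [h1 b])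
    have hb2 := Nat.lt_floor_add_one (s b - t)
    simp only at hab
    rw [hab] at ha1 ha2
    rcases hτ.1.exclusive i _ _ _ _ hwne (hs a) (hs b) with h | h <;> rw [runTime_eq] at h <;>
      linarith
  have hcard := Finset.card_le_card_of_injOn (s := Finset.univ) (t := Finset.Ico 1 ρ) _
    (fun j _ => hfloor j) hinj.injOn
  rw [Finset.card_univ, Fintype.card_fin, Nat.card_Ico] at hcard
  omega

/-- Iterate the delay `ρ` along a chain of late descendants, `k` levels at a time. The chain begins
at job `1`, the root of the complete tree, because job `0` has only one child. -/
theorem le_makespan {τ : Assignment ℝ (2 * 2 ^ ρ) (2 ^ ρ)} {M : ℝ}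
    (hτ : (binaryTree ρ).IsNoDupSchedule τ) (hM : (binaryTree ρ).IsMakespan τ M) {k r : ℕ}
    (hk : ρ < 2 ^ k) (hr : r * k ≤ ρ) : (r : ℝ) * ρ ≤ M := by
  have key : ∀ r : ℕ, r * k ≤ ρ → ∃ w j s, τ w j = some s ∧ (w : ℕ) ≠ 0 ∧
      Nat.size w = 1 + r * k ∧ (r : ℝ) * ρ ≤ s := by
    intro r
    induction r with
    | zero =>
      intro _
      have h1 : 1 < 2 * 2 ^ ρ := by have : 0 < 2 ^ ρ := by positivity
                                    omega
      obtain ⟨i, t, h⟩ := hτ.1.scheduled ⟨1, h1⟩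
      exact ⟨_, i, t, h, one_ne_zero, by simp, by simpa using hτ.1.start_nonneg _ _ _ h⟩
    | succ r ih =>
      intro hr
      rw [add_mul, one_mul] at hr
      obtain ⟨v, i, t, ht, h0, hs, hle⟩ := ih (by omega)
      obtain ⟨w, j, s, h1, h2, h3, h4⟩ := exists_late_descendant hτ hk h0 (by omega) ht
      refine ⟨w, j, s, h1, h2, by rw [h3, hs]; ring, ?_⟩
      push_cast
      linarith
  obtain ⟨w, j, s, h1, -, -, h4⟩ := key r hr
  have h5 := hM.2 ⟨w, j, s, h1, rfl⟩
  rw [runTime_eq] at h5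
  linarith

theorem ratio_le_makespan (hρ : 2 ≤ ρ) {τ : Assignment ℝ (2 * 2 ^ ρ) (2 ^ ρ)} {M : ℝ}
    (hτ : (binaryTree ρ).IsNoDupSchedule τ) (hM : (binaryTree ρ).IsMakespan τ M) :
    1 / 8 * ((ρ : ℝ) / Real.logb 2 ρ) * (ρ + 2) ≤ M := by
  -- The least `k` with `ρ < 2 ^ k`. With `r = ρ / k` rounded down, `ρ / logb 2 ρ ≤ 4 * r` and `ρ +
  -- 2 ≤ 2 * ρ`, which together give the factor `8`.
  set k := Nat.log 2 ρ + 1 with hk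
  have hk1 : ρ < 2 ^ k := Nat.lt_pow_succ_log_self (by norm_num) ρ
  have hk2 : 2 ^ Nat.log 2 ρ ≤ ρ := Nat.pow_log_le_self 2 (by omega)
  have hk3 : k ≤ ρ := (Nat.lt_two_pow_self (n := Nat.log 2 ρ)).trans_le hk2
  have hr := le_makespan hτ hM hk1 (Nat.div_mul_le_self ρ k)
  set r := ρ / k
  have hr1 : 1 ≤ r := Nat.div_pos hk3 (by omega)
  have hr2 : ρ < (r + 1) * k := by
    have := Nat.lt_mul_div_succ ρ (show 0 < k by omega)
    rwa [mul_comm] at this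
  have hρ' : (2 : ℝ) ≤ ρ := by exact_mod_cast hρ
  have hL : (1 : ℝ) ≤ Real.logb 2 ρ := by
    rw [Real.le_logb_iff_rpow_le (by norm_num) (by positivity)]
    simpa using hρ'
  have hkL : (k : ℝ) ≤ 2 * Real.logb 2 ρ := by
    have h1 : (Nat.log 2 ρ : ℝ) ≤ Real.logb 2 ρ := by
      rw [Real.le_logb_iff_rpow_le (by norm_num) (by positivity)]
      exact_mod_cast hk2
    rw [hk]
    push_cast
    linarith
  have h1 : (ρ : ℝ) ≤ 4 * r * Real.logb 2 ρ := by
    have h2 : (ρ : ℝ) ≤ (r + 1) * k := by exact_mod_cast hr2.le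
    have h3 : (1 : ℝ) ≤ r := by exact_mod_cast hr1
    have h4 : ((r : ℝ) + 1) * k ≤ (2 * r) * (2 * Real.logb 2 ρ) :=
      mul_le_mul (by linarith) hkL (Nat.cast_nonneg _) (by positivity)
    linarith
  have h2 : (ρ : ℝ) / Real.logb 2 ρ ≤ 4 * r := (div_le_iff₀ (by linarith)).2 h1
  have h3 : (ρ : ℝ) / Real.logb 2 ρ * (ρ + 2) ≤ (4 * r) * (2 * ρ) :=
    mul_le_mul h2 (by linarith) (by positivity) (by positivity)
  linarith

end binaryTree

end Sched

/-! ### Both bounds combined -/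

theorem theorem3 :
    -- lower bound
    (∃ c : ℝ, 0 < c ∧ ∀ ρ : ℕ, 2 ≤ ρ →
      ∃ I : Sched.Instance ℝ (2 * 2 ^ ρ) (2 ^ ρ),
        I.delay = (ρ : ℝ) ∧ (∀ v, I.size v = 1) ∧ (∀ i, I.speed i = 1) ∧ I.IsBinaryOutTree ∧
        ∃ OPT : ℝ, I.IsOptimalMakespan OPT ∧
          ∀ (τ : Sched.Assignment ℝ (2 * 2 ^ ρ) (2 ^ ρ)) (M : ℝ),
            I.IsNoDupSchedule τ → I.IsMakespan τ M →
              c * ((ρ : ℝ) / Real.logb 2 (ρ : ℝ)) * OPT ≤ M) ∧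
    -- upper bound
    (∃ K : ℝ, 0 < K ∧
      -- arbitrary real data
      (∀ n m : ℕ, 2 ≤ n → 2 ≤ m →
        ∀ (I : Sched.Instance ℝ n m) (σ : Sched.Assignment ℝ n m) (M : ℝ),
          I.IsSchedule σ → I.IsMakespan σ M → I.delay ≤ M →
            ∃ (τ : Sched.Assignment ℝ n m) (M' : ℝ),
              I.IsNoDupSchedule τ ∧ I.IsMakespan τ M' ∧
              M' ≤ K * (M * Real.logb 2 (n : ℝ) ^ 2 * Real.logb 2 (m : ℝ))) ∧
      -- one polynomial-time algorithm for all instances with rational data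
      (∃ (P : Sched.Prog) (q : Polynomial ℕ), ∀ n m : ℕ, 2 ≤ n → 2 ≤ m →
        ∀ (I : Sched.Instance ℚ n m) (σ : Sched.Assignment ℚ n m) (M : ℚ) (x : Sched.Data),
          I.IsSchedule σ → I.IsMakespan σ M → I.delay ≤ M → x.CodesInput I σ →
            ∃ (y : Sched.Data) (t : ℕ) (τ : Sched.Assignment ℚ n m) (M' : ℚ),
              Sched.Runs P x y t ∧ t ≤ q.eval x.size ∧ y.CodesAssignment τ ∧
              I.IsNoDupSchedule τ ∧ I.IsMakespan τ M' ∧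
              (M' : ℝ) ≤ K * ((M : ℝ) * Real.logb 2 (n : ℝ) ^ 2 * Real.logb 2 (m : ℝ)))) := by
  refine ⟨⟨1 / 8, by norm_num, fun ρ hρ => ⟨Sched.binaryTree ρ, rfl, fun _ => rfl, fun _ => rfl,
    Sched.binaryTree.isBinaryOutTree, _, Sched.binaryTree.isOptimalMakespan, fun τ M hτ hM =>
      Sched.binaryTree.ratio_le_makespan hρ hτ hM⟩⟩, 288, by norm_num, ?_, ?_⟩
  · intro n m hn hm I σ M hσ hM hρ
    obtain ⟨M', hM', hle⟩ := Sched.Instance.exists_isMakespan_unduplicated hσ hn hm hM hρ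
    have h0 := I.delay_nonneg.trans hρ
    have h := mul_le_mul_of_nonneg_right
      (Sched.Instance.plan_rounds_le (I := I) (σ := σ) hσ hn hm) h0
    exact ⟨_, M', Sched.Instance.unduplicated_isNoDupSchedule hσ hn hm, hM', by linarith⟩
  · obtain ⟨P, q, hP⟩ := Sched.exists_unduplicated_program
    refine ⟨P, q, fun n m hn hm I σ M x hσ hM hρ hx => ?_⟩
    obtain ⟨y, t, hrun, ht, hy⟩ := hP ⟨n, m, I, σ, x, hσ, hx⟩
    obtain ⟨M', hM', hle⟩ := Sched.Instance.exists_isMakespan_unduplicated hσ hn hm hM hρ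
    have h0 : (0 : ℝ) ≤ M := by exact_mod_cast I.delay_nonneg.trans hρ
    have h := mul_le_mul_of_nonneg_right
      (Sched.Instance.plan_rounds_le (I := I) (σ := σ) hσ hn hm) h0
    -- The construction works over any ordered field, so the rational bound is proved over `ℚ` and
    -- only then compared with real logarithms.
    have hle' : (M' : ℝ) ≤ ((6 * (I.plan σ).rounds + 18 : ℕ) : ℝ) * M := by exact_mod_cast hle
    exact ⟨y, t, _, M', hrun, ht, hy, Sched.Instance.unduplicated_isNoDupSchedule hσ hn hm, hM',
      by linarith⟩
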